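/- Let $A_2=H^*(S^2;\mathbb Q)=\mathbb Q[X]/(X^2)$, graded by $\deg 1=-1$, $\deg X=1$. For a closed planar trivalent graph $\Gamma$ with wide edges (near a wide edge with outgoing edges $x_1,x_2$ and incoming edges $x_3,x_4$), let $C(\Gamma)$ be the graded 2-periodic complex over the polynomial ring $R$ in the oriented edges ($\deg x_i=2$, the ring and the factorizations being specialized accordingly if an edge occurs twice at a vertex) obtained as the tensor product of the $n=2$ (potential $x^3$) Khovanov–Rozansky factorizations: $\{u_1,\,x_1+x_2-x_3-x_4\}\otimes\{u_2,\,x_1x_2-x_3x_4\}\{-1\}$ for each wide edge, where $u_1=(x_1+x_2)^2+(x_1+x_2)(x_3+x_4)+(x_3+x_4)^2-3x_1x_2$ and $u_2=-3(x_3+x_4)$; $\{x_i^2+x_ix_j+x_j^2,\,x_i-x_j\}$ for each arc from mark $j$ to mark $i$; and $A_2\langle1\rangle$ for each circle without marks. Here $\{a,b\}$ is the factorization $R\xrightarrow{a}R\{3-\deg a\}\xrightarrow{b}R$. Let $H(\Gamma)=\bigoplus_j H^j(\Gamma)$ be its cohomology (total over the $\mathbb Z/2$-grading). For a planar diagram $D$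 of an oriented link, assign to a positive (right-handed) crossing the complex $C(\Gamma^0)\{-1\}\xrightarrow{\chi_0}C(\Gamma^1)\{-2\}$ and to a negative crossing the complex $C(\Gamma^1)\{2\}\xrightarrow{\chi_1}C(\Gamma^0)\{1\}$, with $C(\Gamma^0)$ in cohomological degree $0$, where $\Gamma^0$ is the oriented smoothing, $\Gamma^1$ the wide-edge resolution and $\chi_0,\chi_1$ are the following homomorphisms. Let the two strands run upwards at the crossing, with outgoing left, outgoing right, incoming right, incoming left edges $x_1,x_2,x_3,x_4$, so that $\Gamma^0$ consists of the arcs $4\to1$ and $3\to2$. Write $\pi_{ij}=x_i^2+x_ix_j+x_j^2$ and $a_1=x_1-x_2-2x_3-x_4$. In suitable bases of $C^0$ and of $C^1$, the factorization $C(\Gamma^0)$ has differentials $\begin{pmatrix}\pi_{14}&x_2-x_3\\ \pi_{23}&x_4-x_1\end{pmatrix}:C^0\to C^1$ and $\begin{pmatrix}x_1-x_4&x_2-x_3\\ \pi_{23}&-\pi_{14}\end{pmatrix}:C^1\to C^0$, the factorization $C(\Gamma^1)$ has differentials $\begin{pmatrix}u_1&x_1x_2-x_3x_4\\ u_2&x_3+x_4-x_1-x_2\end{pmatrix}$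 and $\begin{pmatrix}x_1+x_2-x_3-x_4&x_1x_2-x_3x_4\\ u_2&-u_1\end{pmatrix}$, and on $(C^0,C^1)$ $$\chi_0=\left(\begin{pmatrix}x_1-x_3&0\\ a_1&1\end{pmatrix},\begin{pmatrix}x_1&-x_3\\-1&1\end{pmatrix}\right),\qquad \chi_1=\left(\begin{pmatrix}1&0\\-a_1&x_1-x_3\end{pmatrix},\begin{pmatrix}1&x_3\\1&x_1\end{pmatrix}\right).$$ Tensor these complexes over all crossings, pass to the cohomology $H(\Gamma)$ of every resolution $\Gamma$, and let $H_2^{i,j}(D)$ be the cohomology of the resulting complex of graded $\mathbb Q$-vector spaces ($i$ the cohomological and $j$ the internal degree). Up to isomorphism this is the invariant $H_2^{i,j}(L)$ of the link $L$ presented by $D$. Let $\mathcal H^{i,j}$ denote Khovanov's integral homology in the conventions of his original paper (built from $\mathbb Z[X]/(X^2)$ with $\deg 1=1$, $\deg X=-1$; the oriented smoothing of a negative crossing is its $0$-smoothing and that of a positive crossing is its $1$-smoothing), and let $D^!$ be the diagram obtained from $D$ by switching all crossings, which presents the mirror image $L^!$. Then: 1. For every closed planar graph $\Gamma$ as above and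 every $j\in\mathbb Z$, $H^j(\Gamma)\cong (A_2^{\otimes k})_j$ as $\mathbb Q$-vector spaces, where $k$ is the number of circles in the diagram obtained from $\Gamma$ by deleting all wide edges. 2. For every planar diagram $D$ of every oriented link $L$ and all $i,j\in\mathbb Z$, $$H_2^{i,j}(D)\;\cong\;\mathcal H^{i,-j}(D^!)\otimes_{\mathbb Z}\mathbb Q,$$ that is, $H_2^{i,j}(L)\cong\mathcal H^{i,-j}(L^!)\otimes_{\mathbb Z}\mathbb Q$. -/

import Mathlib

open scoped TensorProduct

namespace KR

/-! ## Planar diagrams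

Near every vertex the plane is rotated so that both strands run upwards.  The four edge ends at
the vertex `c` are then: outgoing left `x₁`, outgoing right `x₂`, incoming right `x₃`, incoming
left `x₄`.  An edge end is a pair `(c, b)` with `b = false` for left and `b = true` for right,
together with the information whether it is outgoing or incoming. -/

/-- Counterclockwise rotation by one step of the four edge ends at a vertex
(`Sum.inl` : outgoing end, `Sum.inr` : incoming end). -/
def rotate {n : ℕ} : (Fin n × Bool) ⊕ (Fin n × Bool) → (Fin n × Bool) ⊕ (Fin n × Bool)
  | Sum.inl (c, true) => Sum.inl (c, false)
  | Sum.inl (c, false) => Sum.inr (c, false)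
  | Sum.inr (c, false) => Sum.inr (c, true)
  | Sum.inr (c, true) => Sum.inl (c, true)

/-- Passing from one end of an edge to its other end, if the edge which starts at the outgoing
end `e` terminates at the incoming end `next e`. -/
def otherEnd {n : ℕ} (next : Equiv.Perm (Fin n × Bool)) :
    (Fin n × Bool) ⊕ (Fin n × Bool) → (Fin n × Bool) ⊕ (Fin n × Bool)
  | Sum.inl e => Sum.inr (next e)
  | Sum.inr e => Sum.inl (next.symm e)

/-- The faces of the ribbon graph: orbits of "go to the other end of the edge, then rotate". -/
def Face {n : ℕ} (next : Equiv.Perm (Fin n × Bool)) : Type :=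
  Quot fun h h' : (Fin n × Bool) ⊕ (Fin n × Bool) => rotate (otherEnd next h) = h'

/-- The connected components of the underlying four-valent graph. -/
def Component {n : ℕ} (next : Equiv.Perm (Fin n × Bool)) : Type :=
  Quot fun c c' : Fin n => ∃ b : Bool, (next (c, b)).1 = c'

/-- The shadow of an oriented planar diagram: `n` double points, whose edge ends are joined as
prescribed by `next`, and `loops` circles without double points.  Edges are named by their
outgoing ends: the edge `e` starts at the outgoing end `e` and terminates at the incoming end
`next e`.  Planarity is Euler's formula `V - E + F = 2 · (number of components)` with `V = n`
and `E = 2n`, i.e. every component of the ribbon graph has genus zero. -/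
structure Shadow where
  n : ℕ
  next : Equiv.Perm (Fin n × Bool)
  loops : ℕ
  planar : Nat.card (Face next) = n + 2 * Nat.card (Component next)

/-- A planar diagram of an oriented link.  At a positive crossing the strand which runs from the
bottom left to the top right is the upper one, at a negative crossing it is the lower one. -/
structure LinkDiagram extends Shadow where
  positive : Fin n → Bool

/-- The diagram of the mirror image: all crossings are switched. -/
def LinkDiagram.mirror (D : LinkDiagram) : LinkDiagram :=
  { D with positive := fun c => !D.positive c }

namespace Shadow

variable (Γ : Shadow)

/-- The oriented edges. -/
abbrev Edge : Type := Fin Γ.n × Bool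

/-- The edge which terminates at the incoming end `(c, b)`. -/
def incoming (c : Fin Γ.n) (b : Bool) : Γ.Edge := Γ.next.symm (c, b)

/-- A choice of one of the two smoothings at each double point.  It is also a closed trivalent
graph: `s c = false` stands for the oriented smoothing `Γ⁰` (two arcs), `s c = true` for the
graph `Γ¹` with a wide edge at `c`. -/
abbrev State : Type := Fin Γ.n → Bool

/-- Two edges are joined at a double point, if oriented smoothings are made where `s c = false`
and wide edges are deleted where `s c = true` (so that the two outgoing ends are joined to each
other, and so are the two incoming ends). -/
def Joined (s : Γ.State) (e e' : Γ.Edge) : Prop :=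
  ∃ c, (s c = false ∧ ∃ b, e = Γ.incoming c b ∧ e' = (c, b)) ∨
    (s c = true ∧ ((e = (c, false) ∧ e' = (c, true)) ∨
      (e = Γ.incoming c false ∧ e' = Γ.incoming c true)))

/-- The circles which the smoothing `s` (with all wide edges deleted) consists of. -/
abbrev Circle (s : Γ.State) : Type := Quot (Γ.Joined s) ⊕ Fin Γ.loops

/-- The circle to which an edge belongs. -/
def circleOf (s : Γ.State) (e : Γ.Edge) : Γ.Circle s := Sum.inl (Quot.mk _ e)

noncomputable instance (s : Γ.State) : Fintype (Γ.Circle s) := Fintype.ofFinite _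

end Shadow

/-! ## The matrix factorizations for `n = 2`

The potential is `x³`, all variables have degree `2` and differentials have degree `n + 1 = 3`.
A factorization `M⁰ → M¹ → M⁰` with `M⁰`, `M¹` free of rank two has the basis
`Fin 2 × Fin 2`, where the first entry is the `ℤ/2`-degree. -/

section Matrices

variable {S : Type*} [CommRing S] (x₁ x₂ x₃ x₄ : S)

/-- `π_{xy} = (x³ - y³) / (x - y)`. -/
def piPoly (x y : S) : S := x ^ 2 + x * y + y ^ 2

/-- `u₁ = (g(x₁+x₂, x₁x₂) - g(x₃+x₄, x₁x₂)) / (x₁+x₂-x₃-x₄)` for `g(s, p) = s³ - 3sp`, which is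
the polynomial with `g(x+y, xy) = x³ + y³`. -/
def u₁ : S := (x₁ + x₂) ^ 2 + (x₁ + x₂) * (x₃ + x₄) + (x₃ + x₄) ^ 2 - 3 * (x₁ * x₂)

/-- `u₂ = (g(x₃+x₄, x₁x₂) - g(x₃+x₄, x₃x₄)) / (x₁x₂-x₃x₄)`. -/
def u₂ (x₃ x₄ : S) : S := -3 * (x₃ + x₄)

/-- `a₁ = (u₁ + x₁u₂ - π₂₃) / (x₁ - x₄)`. -/
def a₁ : S := x₁ - x₂ - 2 * x₃ - x₄

theorem piPoly_spec (x y : S) : piPoly x y * (x - y) = x ^ 3 - y ^ 3 := by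
  unfold piPoly; ring

theorem u₁_spec : u₁ x₁ x₂ x₃ x₄ * (x₁ + x₂ - x₃ - x₄) =
    ((x₁ + x₂) ^ 3 - 3 * (x₁ + x₂) * (x₁ * x₂)) -
      ((x₃ + x₄) ^ 3 - 3 * (x₃ + x₄) * (x₁ * x₂)) := by
  unfold u₁; ring

theorem u₂_spec : u₂ x₃ x₄ * (x₁ * x₂ - x₃ * x₄) =
    ((x₃ + x₄) ^ 3 - 3 * (x₃ + x₄) * (x₁ * x₂)) -
      ((x₃ + x₄) ^ 3 - 3 * (x₃ + x₄) * (x₃ * x₄)) := by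
  unfold u₂; ring

theorem a₁_spec : a₁ x₁ x₂ x₃ x₄ * (x₁ - x₄) =
    u₁ x₁ x₂ x₃ x₄ + x₁ * u₂ x₃ x₄ - piPoly x₂ x₃ := by
  unfold a₁ u₁ u₂ piPoly; ring

/-- The differentials of `C(Γ⁰) = L¹₄ ⊗ L²₃`, i.e. of the tensor product of the factorizations
`{π₁₄, x₁ - x₄}` (basis `1, a`) and `{π₂₃, x₂ - x₃}` (basis `1, b`).  The ordered bases are
`1, ab` in `ℤ/2`-degree `0` and `a, b` in `ℤ/2`-degree `1`. -/
def diffArcs : Fin 2 → Matrix (Fin 2) (Fin 2) S :=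
  ![!![piPoly x₁ x₄, x₂ - x₃; piPoly x₂ x₃, x₄ - x₁],
    !![x₁ - x₄, x₂ - x₃; piPoly x₂ x₃, -piPoly x₁ x₄]]

/-- The differentials of `C(Γ¹)`, i.e. of the tensor product of the factorizations
`{u₁, x₁ + x₂ - x₃ - x₄}` and `{u₂, x₁x₂ - x₃x₄}`. -/
def diffWide : Fin 2 → Matrix (Fin 2) (Fin 2) S :=
  ![!![u₁ x₁ x₂ x₃ x₄, x₁ * x₂ - x₃ * x₄; u₂ x₃ x₄, x₃ + x₄ - x₁ - x₂],
    !![x₁ + x₂ - x₃ - x₄, x₁ * x₂ - x₃ * x₄; u₂ x₃ x₄, -u₁ x₁ x₂ x₃ x₄]]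

/-- The map `χ₀ : C(Γ⁰) → C(Γ¹)` (with the choice `μ = 1`). -/
def chiZero : Fin 2 → Matrix (Fin 2) (Fin 2) S :=
  ![!![x₁ - x₃, 0; a₁ x₁ x₂ x₃ x₄, 1],
    !![x₁, -x₃; -1, 1]]

/-- The map `χ₁ : C(Γ¹) → C(Γ⁰)` (with the choice `λ = 0`). -/
def chiOne : Fin 2 → Matrix (Fin 2) (Fin 2) S :=
  ![!![1, 0; -a₁ x₁ x₂ x₃ x₄, x₁ - x₃],
    !![1, x₃; 1, x₁]]

/-- The differential of `C(Γ⁰)` (`w = false`) or `C(Γ¹)` (`w = true`) as a matrix on the whole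
basis; it is odd. -/
def diffMat (w : Bool) : Matrix (Fin 2 × Fin 2) (Fin 2 × Fin 2) S := fun u v =>
  if u.1 = v.1 then 0
  else (if w then diffWide x₁ x₂ x₃ x₄ else diffArcs x₁ x₂ x₃ x₄) v.1 u.2 v.2

/-- The map `χ₀` (`w = true`) or `χ₁` (`w = false`) as a matrix on the whole basis; it is even.
The Boolean `w` describes the target. -/
def chiMat (w : Bool) : Matrix (Fin 2 × Fin 2) (Fin 2 × Fin 2) S := fun u v =>
  if u.1 = v.1 then
    (if w then chiZero x₁ x₂ x₃ x₄ else chiOne x₁ x₂ x₃ x₄) v.1 u.2 v.2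
  else 0

theorem diffMat_mul_chiMat (w : Bool) :
    diffMat x₁ x₂ x₃ x₄ w * chiMat x₁ x₂ x₃ x₄ w =
      chiMat x₁ x₂ x₃ x₄ w * diffMat x₁ x₂ x₃ x₄ (!w) := by
  ext ⟨p, i⟩ ⟨q, j⟩
  simp only [Matrix.mul_apply, Fintype.sum_prod_type, Fin.sum_univ_two]
  cases w <;> fin_cases p <;> fin_cases q <;> fin_cases i <;> fin_cases j <;>
    simp [diffMat, chiMat, diffArcs, diffWide, chiZero, chiOne, a₁, u₁, u₂, piPoly] <;> ring

/-- The square of the differential is multiplication by the potential. -/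
theorem diffMat_mul_diffMat (w : Bool) :
    diffMat x₁ x₂ x₃ x₄ w * diffMat x₁ x₂ x₃ x₄ w =
      (x₁ ^ 3 + x₂ ^ 3 - x₃ ^ 3 - x₄ ^ 3) • (1 : Matrix (Fin 2 × Fin 2) (Fin 2 × Fin 2) S) := by
  ext ⟨p, i⟩ ⟨q, j⟩
  simp only [Matrix.mul_apply, Fintype.sum_prod_type, Fin.sum_univ_two, Matrix.smul_apply,
    Matrix.one_apply]
  cases w <;> fin_cases p <;> fin_cases q <;> fin_cases i <;> fin_cases j <;>
    simp [diffMat, diffArcs, diffWide, u₁, u₂, piPoly] <;> ring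

end Matrices

/-- The internal degrees of the basis elements of `C(Γ⁰)` and of `C(Γ¹)`. -/
def genDeg (w : Bool) (u : Fin 2 × Fin 2) : ℤ :=
  if w then ![![-1, -1], ![-2, 0]] u.1 u.2 else ![![0, -2], ![-1, -1]] u.1 u.2

/-- The degrees of the basis `1, X` of `A = H^*(S², ℚ)`, shifted down by one
(`false` stands for `1` and `true` for `X`). -/
def circleDeg (b : Bool) : ℤ := if b then 1 else -1

namespace Shadow

variable (Γ : Shadow)

/-- The polynomial ring with one variable (one mark) for each edge. -/
abbrev Ring : Type := MvPolynomial Γ.Edge ℚ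

/-- The basis of `C(Γ)`: the tensor product of rank four factorizations over all double points,
in their order, and of a copy of `A` for each circle without marks. -/
abbrev Gen : Type := (Fin Γ.n → Fin 2 × Fin 2) × (Fin Γ.loops → Bool)

/-- The module underlying `C(Γ)`, with both `ℤ/2`-degrees taken together. -/
abbrev Chain : Type := Γ.Gen → Γ.Ring

/-- A matrix in the variables `x₁, x₂, x₃, x₄` is evaluated at the edges around `c`. -/
noncomputable def atVertex (c : Fin Γ.n)
    (A : Γ.Ring → Γ.Ring → Γ.Ring → Γ.Ring → Matrix (Fin 2 × Fin 2) (Fin 2 × Fin 2) Γ.Ring) :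
    Matrix (Fin 2 × Fin 2) (Fin 2 × Fin 2) Γ.Ring :=
  A (MvPolynomial.X (c, false)) (MvPolynomial.X (c, true))
    (MvPolynomial.X (Γ.incoming c true)) (MvPolynomial.X (Γ.incoming c false))

/-- A matrix acts on the tensor factor at `c`. -/
noncomputable def actAt (c : Fin Γ.n) (A : Matrix (Fin 2 × Fin 2) (Fin 2 × Fin 2) Γ.Ring) :
    Γ.Chain →ₗ[ℚ] Γ.Chain where
  toFun f g := ∑ u, A (g.1 c) u * f (Function.update g.1 c u, g.2)
  map_add' f f' := by
    funext g; simp [mul_add, Finset.sum_add_distrib]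
  map_smul' r f := by
    funext g; simp [Finset.smul_sum]

/-- The sign `(-1)^p`, where `p` is the `ℤ/2`-degree of the tensor factors before `c`. -/
noncomputable def koszulSign (c : Fin Γ.n) : Γ.Chain →ₗ[ℚ] Γ.Chain where
  toFun f g := (∏ c' ∈ Finset.univ.filter (· < c), (-1 : ℚ) ^ ((g.1 c').1 : ℕ)) • f g
  map_add' f f' := by
    funext g; simp [smul_add]
  map_smul' r f := by
    funext g; simp [smul_smul, mul_comm]

/-- The differential of `C(Γ)` for the closed graph given by `s`. -/
noncomputable def d (s : Γ.State) : Γ.Chain →ₗ[ℚ] Γ.Chain :=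
  ∑ c, Γ.koszulSign c ∘ₗ
    Γ.actAt c (Γ.atVertex c fun x₁ x₂ x₃ x₄ => diffMat x₁ x₂ x₃ x₄ (s c))

/-- The internal degree of a basis element of `C(Γ)`. -/
def deg (s : Γ.State) (g : Γ.Gen) : ℤ :=
  ∑ c, genDeg (s c) (g.1 c) + ∑ k, circleDeg (g.2 k)

/-- The elements of internal degree `j` in `C(Γ)`; the variables have degree `2`. -/
def chainDeg (s : Γ.State) (j : ℤ) : Submodule ℚ Γ.Chain where
  carrier := {f | ∀ g m, MvPolynomial.coeff m (f g) ≠ 0 → Γ.deg s g + 2 * (m.degree : ℤ) = j}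
  zero_mem' := by simp
  add_mem' {f f'} hf hf' g m h := by
    by_contra hc
    have h1 : MvPolynomial.coeff m (f g) = 0 := by_contra fun h1 => hc (hf g m h1)
    have h2 : MvPolynomial.coeff m (f' g) = 0 := by_contra fun h2 => hc (hf' g m h2)
    simp [h1, h2] at h
  smul_mem' r f hf g m h := by
    refine hf g m fun h1 => h ?_
    simp [h1]

/-- The cohomology `H(Γ) = ker d / im d` of the 2-complex `C(Γ)`, with both `ℤ/2`-degrees taken
together (only one of them contributes). -/
def H (s : Γ.State) : Type :=
  LinearMap.ker (Γ.d s) ⧸ (LinearMap.range (Γ.d s)).comap (LinearMap.ker (Γ.d s)).subtype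

noncomputable instance (s : Γ.State) : AddCommGroup (Γ.H s) :=
  inferInstanceAs (AddCommGroup (LinearMap.ker (Γ.d s) ⧸
    (LinearMap.range (Γ.d s)).comap (LinearMap.ker (Γ.d s)).subtype))

noncomputable instance (s : Γ.State) : Module ℚ (Γ.H s) :=
  inferInstanceAs (Module ℚ (LinearMap.ker (Γ.d s) ⧸
    (LinearMap.range (Γ.d s)).comap (LinearMap.ker (Γ.d s)).subtype))

/-- The subspace `H^j(Γ)` of `H(Γ)`. -/
noncomputable def HDeg (s : Γ.State) (j : ℤ) : Submodule ℚ (Γ.H s) :=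
  ((Γ.chainDeg s j).comap (LinearMap.ker (Γ.d s)).subtype).map (Submodule.mkQ _)

/-- The state which differs from `s` at `c` only. -/
def flip (s : Γ.State) (c : Fin Γ.n) : Γ.State := Function.update s c (!s c)

/-- The map `χ₀` or `χ₁` at `c` with values in `C(Γ)` for the graph given by `s`; the source is
the graph given by `flip s c`. -/
noncomputable def chi (s : Γ.State) (c : Fin Γ.n) : Γ.Chain →ₗ[ℚ] Γ.Chain :=
  Γ.actAt c (Γ.atVertex c fun x₁ x₂ x₃ x₄ => chiMat x₁ x₂ x₃ x₄ (s c))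

theorem actAt_comp_same (c : Fin Γ.n) (A B : Matrix (Fin 2 × Fin 2) (Fin 2 × Fin 2) Γ.Ring) :
    Γ.actAt c A ∘ₗ Γ.actAt c B = Γ.actAt c (A * B) := by
  refine LinearMap.ext fun f => funext fun g => ?_
  simp only [actAt, LinearMap.comp_apply, LinearMap.coe_mk, AddHom.coe_mk, Matrix.mul_apply,
    Function.update_self, Function.update_idem, Finset.mul_sum, Finset.sum_mul]
  rw [Finset.sum_comm]
  simp only [mul_assoc]

theorem actAt_comp_ne {c c' : Fin Γ.n} (h : c ≠ c')
    (A B : Matrix (Fin 2 × Fin 2) (Fin 2 × Fin 2) Γ.Ring) :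
    Γ.actAt c A ∘ₗ Γ.actAt c' B = Γ.actAt c' B ∘ₗ Γ.actAt c A := by
  refine LinearMap.ext fun f => funext fun g => ?_
  simp only [actAt, LinearMap.comp_apply, LinearMap.coe_mk, AddHom.coe_mk,
    Function.update_of_ne h.symm, Function.update_of_ne h, Finset.mul_sum]
  rw [Finset.sum_comm]
  refine Finset.sum_congr rfl fun u _ => Finset.sum_congr rfl fun v _ => ?_
  rw [Function.update_comm h]
  ring

theorem koszulSign_comp_chi (s : Γ.State) (c c' : Fin Γ.n) :
    Γ.koszulSign c' ∘ₗ Γ.chi s c = Γ.chi s c ∘ₗ Γ.koszulSign c' := by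
  refine LinearMap.ext fun f => funext fun g => ?_
  simp only [chi, koszulSign, actAt, LinearMap.comp_apply, LinearMap.coe_mk, AddHom.coe_mk,
    Finset.smul_sum]
  refine Finset.sum_congr rfl fun u _ => ?_
  by_cases hu : (g.1 c).1 = u.1
  · have : ∀ b : Fin Γ.n, (Function.update g.1 c u b).1 = (g.1 b).1 := by
      intro b
      by_cases hb : b = c
      · subst hb; simp [hu]
      · simp [Function.update_of_ne hb]
    simp only [this, mul_smul_comm]
  · simp [atVertex, chiMat, hu]

theorem actAt_comp_chi (s : Γ.State) (c c' : Fin Γ.n) :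
    Γ.actAt c' (Γ.atVertex c' fun x₁ x₂ x₃ x₄ => diffMat x₁ x₂ x₃ x₄ (s c')) ∘ₗ Γ.chi s c =
      Γ.chi s c ∘ₗ Γ.actAt c'
        (Γ.atVertex c' fun x₁ x₂ x₃ x₄ => diffMat x₁ x₂ x₃ x₄ (Γ.flip s c c')) := by
  by_cases h : c' = c
  · subst h
    have hs : Γ.flip s c' c' = !s c' := Function.update_self ..
    rw [hs, chi, actAt_comp_same, actAt_comp_same]
    exact congrArg _ (diffMat_mul_chiMat _ _ _ _ _)
  · have hs : Γ.flip s c c' = s c' := Function.update_of_ne h ..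
    rw [hs, chi]
    exact Γ.actAt_comp_ne h _ _

/-- The maps `χ₀`, `χ₁` are homomorphisms of factorizations. -/
theorem d_chi (s : Γ.State) (c : Fin Γ.n) (f : Γ.Chain) :
    Γ.d s (Γ.chi s c f) = Γ.chi s c (Γ.d (Γ.flip s c) f) := by
  rw [d, d, LinearMap.sum_apply, LinearMap.sum_apply, map_sum]
  refine Finset.sum_congr rfl fun c' _ => ?_
  have h1 := LinearMap.congr_fun (Γ.actAt_comp_chi s c c') f
  have h2 := LinearMap.congr_fun (Γ.koszulSign_comp_chi s c c')
  rw [LinearMap.comp_apply, LinearMap.comp_apply] at h1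
  rw [LinearMap.comp_apply, LinearMap.comp_apply, h1]
  exact h2 _

/-- The map `H(Γ') → H(Γ)` induced by `χ₀` or `χ₁` at `c`. -/
noncomputable def chiH (s : Γ.State) (c : Fin Γ.n) : Γ.H (Γ.flip s c) →ₗ[ℚ] Γ.H s :=
  Submodule.mapQ _ _
    ((Γ.chi s c).restrict (p := LinearMap.ker (Γ.d (Γ.flip s c))) (q := LinearMap.ker (Γ.d s))
      (fun f hf => by
        rw [LinearMap.mem_ker] at hf ⊢
        rw [Γ.d_chi, hf, map_zero]))
    (by
      rintro ⟨f, hf⟩ ⟨y, hy⟩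
      refine ⟨Γ.chi s c y, ?_⟩
      rw [Γ.d_chi, hy]
      rfl)

end Shadow

/-! ## The link homology `H₂` -/

namespace LinkDiagram

variable (D : LinkDiagram)

/-- A resolution of the diagram is a state of its shadow.  This is its cohomological degree: at a positive crossing `Γ⁰` has degree
`0` and `Γ¹` degree `1`, at a negative crossing `Γ¹` has degree `-1` and `Γ⁰` degree `0`. -/
def cohDeg (s : D.State) : ℤ :=
  ∑ c, if s c then (if D.positive c then 1 else -1) else 0

/-- The shift `{m}` of the internal degree: at a positive crossing `C(Γ⁰){1-n}` and `C(Γ¹){-n}`,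
at a negative crossing `C(Γ¹){n}` and `C(Γ⁰){n-1}`, for `n = 2`. -/
def shift (s : D.State) : ℤ :=
  ∑ c, if D.positive c then (if s c then -2 else -1) else (if s c then 2 else 1)

/-- The direct sum of `H(Γ)` over all resolutions `Γ`. -/
abbrev Cube : Type := ∀ s : D.State, D.H s

/-- The part of the cube of cohomological degree `i` and internal degree `j`. -/
def cubeDeg (i j : ℤ) : Submodule ℚ D.Cube where
  carrier := {f | ∀ s, f s ∈ D.HDeg s (j - D.shift s) ∧ (D.cohDeg s ≠ i → f s = 0)}
  zero_mem' s := ⟨Submodule.zero_mem _, fun _ => rfl⟩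
  add_mem' {f f'} hf hf' s := ⟨Submodule.add_mem _ (hf s).1 (hf' s).1, fun h => by
    simp [(hf s).2 h, (hf' s).2 h]⟩
  smul_mem' r f hf s := ⟨Submodule.smul_mem _ r (hf s).1, fun h => by simp [(hf s).2 h]⟩

/-- The differential of the tensor product, over all crossings, of the complexes
`C(Γ⁰) → C(Γ¹)` given by `χ₀` (positive crossings) and `C(Γ¹) → C(Γ⁰)` given by `χ₁` (negative
crossings), on the level of the cohomology groups `H(Γ)`.  The arrow at `c` ends at `s` if
`s c = D.positive c`.  The sign counts the earlier factors of odd cohomological degree. -/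
noncomputable def delta : D.Cube →ₗ[ℚ] D.Cube :=
  LinearMap.pi fun s => ∑ c, if s c = D.positive c then
    (∏ c' ∈ Finset.univ.filter (· < c), if s c' then (-1 : ℚ) else 1) •
      (D.chiH s c ∘ₗ LinearMap.proj (D.flip s c))
  else 0

/-- The homology `H₂^{i,j}(D)`. -/
abbrev H₂ (i j : ℤ) : Type :=
  ↥(D.cubeDeg i j ⊓ LinearMap.ker D.delta) ⧸
    ((D.cubeDeg (i - 1) j).map D.delta).comap (D.cubeDeg i j ⊓ LinearMap.ker D.delta).subtype

end LinkDiagram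

/-! ## Khovanov's categorification of the Jones polynomial

The conventions are those of Khovanov's original construction: `A = ℤ[X]/(X²)` with
`deg 1 = 1`, `deg X = -1`, and the crossings for which the oriented smoothing is the
`0`-smoothing are the negative (left-handed) ones.  (Passing to the mirror image gives the
convention, often used later, in which they are the positive ones.) -/

namespace LinkDiagram

variable (D : LinkDiagram)

/-- The smoothing of the shadow given by the vertex `t` of the cube: `t c = false` stands for the
`0`-smoothing at `c` and `t c = true` for the `1`-smoothing.  The oriented smoothing is the
`0`-smoothing of a negative crossing and the `1`-smoothing of a positive one. -/
def khSmoothing (t : Fin D.n → Bool) : D.State := fun c => xor (t c) (D.positive c)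

/-- The basis of the complex: a vertex of the cube and a label `1` (`false`) or `X` (`true`) for
each circle. -/
abbrev KhGen : Type := Σ t : Fin D.n → Bool, (D.Circle (D.khSmoothing t) → Bool)

noncomputable instance : Fintype D.KhGen := Fintype.ofFinite _

/-- The label of an edge. -/
def label (x : D.KhGen) (e : D.Edge) : Bool := x.2 (D.circleOf _ e)

/-- Two edges lie on the same circle. -/
def SameCircle (x : D.KhGen) (e e' : D.Edge) : Prop :=
  D.circleOf (D.khSmoothing x.1) e = D.circleOf (D.khSmoothing x.1) e'

/-- The coefficient of `r` in the product `p q` in `A`: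
`1·1 = 1`, `1·X = X·1 = X`, `X·X = 0`. -/
def mulCoeff : Bool → Bool → Bool → ℤ
  | false, false, false => 1
  | false, true, true => 1
  | true, false, true => 1
  | _, _, _ => 0

/-- The coefficient of `q ⊗ r` in `Δ(p)`: `Δ(1) = 1 ⊗ X + X ⊗ 1`, `Δ(X) = X ⊗ X`. -/
def comulCoeff : Bool → Bool → Bool → ℤ
  | false, false, true => 1
  | false, true, false => 1
  | true, true, true => 1
  | _, _, _ => 0

open Classical in
/-- The coefficient of `y` in the image of `x` under the map of the cube which changes the
`0`-smoothing at `c` into the `1`-smoothing.  The outgoing left end and the incoming right end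
at `c` lie on different arcs in each of the two smoothings at `c`; if these arcs belong to two
circles, then the circles are merged by the multiplication of `A`, and otherwise the circle is
split by the comultiplication.  The labels of all other circles do not change. -/
noncomputable def khCoeff (c : Fin D.n) (x y : D.KhGen) : ℤ :=
  if x.1 c = false ∧ y.1 = Function.update x.1 c true ∧
      (∀ k : Fin D.loops, x.2 (Sum.inr k) = y.2 (Sum.inr k)) ∧
      (∀ e : D.Edge, ¬ D.SameCircle x e (c, false) → ¬ D.SameCircle x e (D.incoming c true) →
        D.label x e = D.label y e) then
    if D.SameCircle x (c, false) (D.incoming c true) then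
      comulCoeff (D.label x (c, false)) (D.label y (c, false)) (D.label y (D.incoming c true))
    else
      mulCoeff (D.label x (c, false)) (D.label x (D.incoming c true)) (D.label y (c, false))
  else 0

/-- The differential of the complex, on functions `KhGen → ℤ` (coordinate vectors), with the
usual signs which make the cube anticommutative. -/
noncomputable def khD : (D.KhGen → ℤ) →ₗ[ℤ] (D.KhGen → ℤ) where
  toFun f y := ∑ x, ∑ c,
    (∏ c' ∈ Finset.univ.filter (· < c), if x.1 c' then (-1 : ℤ) else 1) * D.khCoeff c x y * f x
  map_add' f f' := by
    funext y; simp [mul_add, Finset.sum_add_distrib]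
  map_smul' r f := by
    funext y; simp [Finset.mul_sum, mul_left_comm]

/-- The number of crossings whose oriented smoothing is the `1`-smoothing. -/
def khX : ℤ := ∑ c, if D.positive c then 1 else 0

/-- The number of crossings whose oriented smoothing is the `0`-smoothing. -/
def khY : ℤ := ∑ c, if D.positive c then 0 else 1

/-- The number of `1`-smoothings. -/
def khHeight (x : D.KhGen) : ℤ := ∑ c, if x.1 c then 1 else 0

/-- The cohomological degree. -/
def khCohDeg (x : D.KhGen) : ℤ := D.khHeight x - D.khX

/-- The internal degree, where `1` and `X` have degrees `1` and `-1`. -/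
noncomputable def khDeg (x : D.KhGen) : ℤ :=
  (∑ k, if x.2 k then -1 else 1) + D.khHeight x + D.khY - 2 * D.khX

/-- The part of the complex of cohomological degree `i` and internal degree `j`. -/
def khPart (i j : ℤ) : Submodule ℤ (D.KhGen → ℤ) where
  carrier := {f | ∀ x, f x ≠ 0 → D.khCohDeg x = i ∧ D.khDeg x = j}
  zero_mem' := by simp
  add_mem' {f f'} hf hf' x h := by
    by_contra hc
    have h1 : f x = 0 := by_contra fun h1 => hc (hf x h1)
    have h2 : f' x = 0 := by_contra fun h2 => hc (hf' x h2)
    simp [h1, h2] at h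
  smul_mem' r f hf x h := by
    refine hf x fun h1 => h ?_
    simp [h1]

/-- Khovanov homology `ℋ^{i,j}(D)`, an abelian group. -/
abbrev Kh (i j : ℤ) : Type :=
  ↥(D.khPart i j ⊓ LinearMap.ker D.khD) ⧸
    ((D.khPart (i - 1) j).map D.khD).comap (D.khPart i j ⊓ LinearMap.ker D.khD).subtype

end LinkDiagram

/-! ## Tensor powers of the cohomology ring of the 2-sphere -/

/-- `A₂ = H^*(S², ℚ) = ℚ[X]/(X²)`. -/
abbrev A₂ : Type := DualNumber ℚ

/-- The homogeneous basis `1, X` of `A₂`. -/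
def A₂basis (b : Bool) : A₂ := if b then DualNumber.eps else 1

/-- The part of degree `j` of the tensor power `A₂^{⊗k}`, where `1` and `X` have degrees `-1`
and `1`. -/
def A₂pow (k : ℕ) (j : ℤ) : Submodule ℚ (⨂[ℚ] _ : Fin k, A₂) :=
  Submodule.span ℚ {z | ∃ l : Fin k → Bool, ∑ i, circleDeg (l i) = j ∧
    z = PiTensorProduct.tprod ℚ fun i => A₂basis (l i)}

end KR

/-! For potential `x³` a wide edge splits. After a unipotent change of basis over ℚ
(`shear_mul_diffMat`) its factorization is the tensor product of an arc factorization for `x₁` and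
`-x₂` and one for `x₃` and `-x₄`, the latter with its entries exchanged and rescaled. So a wide edge
behaves like the non-oriented smoothing, up to signs of variables. Planarity makes these signs
consistent: a checkerboard colouring of the faces (`exists_faceBoundary_eq_one`) yields a
two-colouring of the edges which oriented smoothings preserve and the other smoothings switch. With
`±x_e` in place of `x_e`, according to the colour, every resolution becomes a family of consistently
oriented circles cut by arcs.

The total potential of a closed graph is zero, and pairs `{a, b}` can be eliminated: if one entry
acts regularly, the factorization may be replaced by its quotient by that entry. On each circle the
linear entry `Z - Z'` is used at every arc but the last. There all variables of the circle already
agree, and the quadratic entry is a nonzero multiple of `3 Z²`. These entries form a regular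
sequence (`CycleSequence.regular`), so `reduces_chainD` identifies `H(Γ)` with the tensor product of
the algebras `ℚ[X]/(X²)` over all circles. Each of the `k` circles contributes `-1` to the degree of
the generator. This is the first statement.

For the second statement, each circle with marks contributes variables through which `R` acts, and
the part of `H(Γ)` from these circles is a cyclic `R`-module with generator `1`. The maps `χ₀` and
`χ₁` are `R`-linear of degree one, and both composites are multiplication by `x₁ - x₃ = ±(X_p +
X_q)`. The composite is nonzero, so the image of `1` is nonzero. Degree and `R`-linearity force it
to be a multiple of `1` (merging) or of `X_p + X_q` (splitting). Hence every edge map of the cube is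
a nonzero scalar times Khovanov's multiplication or comultiplication.

The scalars commute around squares (`edgeScalar_square`), so they form a multiplicative cocycle on
the cube, which is a coboundary (`exists_potential`). Rescaling the vertices turns the complex into
Khovanov's rational complex of the mirror image, with the internal degree negated. Homology commutes
with localization from ℤ to ℚ (`subHomology_rat`). -/

namespace KR

/-! ### Planarity: checkerboard colourings from Euler's formula modulo two. -/

section Planar

variable {n : ℕ} (next : Equiv.Perm (Fin n × Bool))

theorem otherEnd_otherEnd (h : (Fin n × Bool) ⊕ (Fin n × Bool)) :
    otherEnd next (otherEnd next h) = h := by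
  cases h <;> simp [otherEnd]

/-- The face on a fixed side of an edge end. -/
def faceOf (h : (Fin n × Bool) ⊕ (Fin n × Bool)) : Face next := Quot.mk _ h

theorem face_rotate (h : (Fin n × Bool) ⊕ (Fin n × Bool)) :
    faceOf next (rotate h) = faceOf next (otherEnd next h) := by
  have := Quot.sound (r := fun h h' : (Fin n × Bool) ⊕ (Fin n × Bool) =>
    rotate (otherEnd next h) = h') (a := otherEnd next h) rfl
  rw [otherEnd_otherEnd] at this
  exact this.symm

instance : Finite (Face next) := inferInstanceAs (Finite (Quot _))

instance : Finite (Component next) := inferInstanceAs (Finite (Quot _))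

/-- The boundary map from faces to edges, modulo two. -/
def faceBoundary : (Face next → ZMod 2) →ₗ[ZMod 2] (Fin n × Bool → ZMod 2) where
  toFun φ e := φ (faceOf next (Sum.inl e)) + φ (faceOf next (Sum.inr (next e)))
  map_add' φ φ' := by funext e; exact add_add_add_comm _ _ _ _
  map_smul' r φ := by funext e; exact (mul_add _ _ _).symm

/-- The incidence matrix of vertices and edges, modulo two. -/
def incidence : Matrix (Fin n) (Fin n × Bool) (ZMod 2) := fun c e =>
  (if e.1 = c then 1 else 0) + (if (next e).1 = c then 1 else 0)

theorem incidence_mulVec (ψ : Fin n × Bool → ZMod 2) (c : Fin n) :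
    (incidence next).mulVec ψ c = ψ (c, false) + ψ (c, true) +
      (ψ (next.symm (c, false)) + ψ (next.symm (c, true))) := by
  have h : ∀ χ : Fin n × Bool → ZMod 2,
      ∑ e, (if e.1 = c then 1 else 0) * χ e = χ (c, false) + χ (c, true) := by
    intro χ
    rw [Fintype.sum_prod_type, Finset.sum_eq_single c]
    · simp [add_comm]
    · intro b _ hb; simp [hb]
    · simp
  simp only [Matrix.mulVec, dotProduct, incidence, add_mul, Finset.sum_add_distrib]
  rw [h, ← h (fun e => ψ (next.symm e)),
    ← Equiv.sum_comp next (fun e => (if e.1 = c then 1 else 0) * ψ (next.symm e))]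
  simp

theorem incidence_transpose_mulVec (v : Fin n → ZMod 2) (e : Fin n × Bool) :
    (incidence next).transpose.mulVec v e = v e.1 + v (next e).1 := by
  simp [Matrix.mulVec, dotProduct, incidence, add_mul, Finset.sum_add_distrib]

/-- Over `ZMod 2` an element of this kernel takes equal values at both ends of each edge, so it
descends to the components. -/
theorem finrank_ker_incidence_transpose_le :
    Module.finrank (ZMod 2) (LinearMap.ker (incidence next).transpose.mulVecLin) ≤
      Nat.card (Component next) := by
  classical
  have := Fintype.ofFinite (Component next)
  have key : ∀ v ∈ LinearMap.ker (incidence next).transpose.mulVecLin, ∀ c c' : Fin n,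
      (∃ b : Bool, (next (c, b)).1 = c') → v c = v c' := by
    rintro v hv c c' ⟨b, rfl⟩
    have := congrFun (LinearMap.mem_ker.1 hv) (c, b)
    rw [Matrix.mulVecLin_apply, incidence_transpose_mulVec] at this
    exact CharTwo.add_eq_zero.1 this
  let F : LinearMap.ker (incidence next).transpose.mulVecLin →ₗ[ZMod 2]
      (Component next → ZMod 2) :=
    { toFun := fun v => Quot.lift v.1 (key v.1 v.2)
      map_add' := fun v w => by funext q; induction q using Quot.ind; rfl
      map_smul' := fun r v => by funext q; induction q using Quot.ind; rfl }
  have hF : Function.Injective F := by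
    intro v w h
    ext c
    exact congrFun h (Quot.mk _ c)
  have := LinearMap.finrank_le_finrank_of_injective hF
  rwa [Module.finrank_fintype_fun_eq_card, ← Nat.card_eq_fintype_card] at this

/-- Zero boundary means equal values on the two sides of every edge. The four faces around a vertex
then have one common value, which is carried along edges to the whole component. -/
theorem finrank_ker_faceBoundary_le :
    Module.finrank (ZMod 2) (LinearMap.ker (faceBoundary next)) ≤
      Nat.card (Component next) := by
  classical
  have := Fintype.ofFinite (Component next)
  have := Fintype.ofFinite (Face next)
  have h1 : ∀ φ ∈ LinearMap.ker (faceBoundary next), ∀ e : Fin n × Bool,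
      φ (faceOf next (Sum.inl e)) = φ (faceOf next (Sum.inr (next e))) := by
    intro φ hφ e
    exact CharTwo.add_eq_zero.1 (congrFun (LinearMap.mem_ker.1 hφ) e)
  have h2 : ∀ φ ∈ LinearMap.ker (faceBoundary next), ∀ h : (Fin n × Bool) ⊕ (Fin n × Bool),
      φ (faceOf next (rotate h)) = φ (faceOf next h) := by
    intro φ hφ h
    rw [face_rotate]
    rcases h with e | e
    · exact (h1 φ hφ e).symm
    · have := h1 φ hφ (next.symm e)
      rw [Equiv.apply_symm_apply] at this
      exact this
  have h3 : ∀ φ ∈ LinearMap.ker (faceBoundary next), ∀ c b,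
      φ (faceOf next (Sum.inl (c, b))) = φ (faceOf next (Sum.inl (c, false))) ∧
      φ (faceOf next (Sum.inr (c, b))) = φ (faceOf next (Sum.inl (c, false))) := by
    intro φ hφ c b
    have e1 := h2 φ hφ (Sum.inl (c, true))
    have e2 := h2 φ hφ (Sum.inl (c, false))
    have e3 := h2 φ hφ (Sum.inr (c, false))
    simp only [rotate] at e1 e2 e3
    cases b
    · exact ⟨rfl, e2⟩
    · exact ⟨e1.symm, e3.trans e2⟩
  let F : LinearMap.ker (faceBoundary next) →ₗ[ZMod 2] (Component next → ZMod 2) :=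
    { toFun := fun φ => Quot.lift (fun c => φ.1 (faceOf next (Sum.inl (c, false)))) (by
        rintro c c' ⟨b, rfl⟩
        rw [← (h3 _ φ.2 c b).1, h1 _ φ.2]
        exact (h3 _ φ.2 _ _).2)
      map_add' := fun v w => by funext q; induction q using Quot.ind; rfl
      map_smul' := fun r v => by funext q; induction q using Quot.ind; rfl }
  have hF : Function.Injective F := by
    intro v w h
    have h0 : ∀ c, v.1 (faceOf next (Sum.inl (c, false))) = w.1 (faceOf next (Sum.inl (c, false))) :=
      fun c => congrFun h (Quot.mk _ c)
    ext q
    induction q using Quot.ind with | mk a => ?_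
    change v.1 (faceOf next a) = w.1 (faceOf next a)
    rcases a with ⟨c, b⟩ | ⟨c, b⟩
    · rw [(h3 _ v.2 c b).1, (h3 _ w.2 c b).1, h0]
    · rw [(h3 _ v.2 c b).2, (h3 _ w.2 c b).2, h0]
  have := LinearMap.finrank_le_finrank_of_injective hF
  rwa [Module.finrank_fintype_fun_eq_card, ← Nat.card_eq_fintype_card] at this

/-- Boundaries are cycles: each of the four corners at a vertex is counted by two of the four edge
ends there, so it cancels modulo two. -/
theorem range_faceBoundary_le :
    LinearMap.range (faceBoundary next) ≤ LinearMap.ker (incidence next).mulVecLin := by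
  rintro _ ⟨φ, rfl⟩
  rw [LinearMap.mem_ker]
  funext c
  rw [Matrix.mulVecLin_apply, incidence_mulVec]
  have e1 : faceOf next (Sum.inl (c, false)) = faceOf next (Sum.inr (next (c, true))) :=
    face_rotate next (Sum.inl (c, true))
  have e2 : faceOf next (Sum.inr (c, false)) = faceOf next (Sum.inr (next (c, false))) :=
    face_rotate next (Sum.inl (c, false))
  have e3 : faceOf next (Sum.inr (c, true)) = faceOf next (Sum.inl (next.symm (c, false))) :=
    face_rotate next (Sum.inr (c, false))
  have e4 : faceOf next (Sum.inl (c, true)) = faceOf next (Sum.inl (next.symm (c, true))) :=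
    face_rotate next (Sum.inr (c, true))
  simp only [faceBoundary, LinearMap.coe_mk, AddHom.coe_mk, Equiv.apply_symm_apply,
    ← e1, ← e2, ← e3, ← e4, Pi.zero_apply]
  generalize φ (faceOf next (Sum.inl (c, false))) = a
  generalize φ (faceOf next (Sum.inl (c, true))) = b
  generalize φ (faceOf next (Sum.inr (c, false))) = d
  generalize φ (faceOf next (Sum.inr (c, true))) = e
  have : (a + d) + (b + a) + (e + d + (b + e)) = (a + a) + (b + b) + (d + d) + (e + e) := by ring
  rw [this]
  simp only [CharTwo.add_self_eq_zero]

/-- With `C` components, Euler's formula gives the boundary space dimension at least `n + C`, while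
the cycle space has dimension at most `n + C`; so every cycle is a boundary. The vector `1` is a
cycle because every vertex has valence four, and a face function with boundary `1` is a checkerboard
colouring. -/
theorem exists_faceBoundary_eq_one
    (planar : Nat.card (Face next) = n + 2 * Nat.card (Component next)) :
    ∃ φ, faceBoundary next φ = 1 := by
  classical
  have := Fintype.ofFinite (Face next)
  have hr := LinearMap.finrank_range_add_finrank_ker (faceBoundary next)
  have h1 := LinearMap.finrank_range_add_finrank_ker (incidence next).mulVecLin
  have h2 := LinearMap.finrank_range_add_finrank_ker (incidence next).transpose.mulVecLin
  have h3 : Module.finrank (ZMod 2) (LinearMap.range (incidence next).transpose.mulVecLin) =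
      Module.finrank (ZMod 2) (LinearMap.range (incidence next).mulVecLin) :=
    Matrix.rank_transpose (incidence next)
  have h4 := finrank_ker_incidence_transpose_le next
  have h5 := finrank_ker_faceBoundary_le next
  rw [Module.finrank_fintype_fun_eq_card] at hr h1 h2
  rw [← Nat.card_eq_fintype_card] at hr
  simp only [Fintype.card_prod, Fintype.card_fin, Fintype.card_bool] at h1 h2
  have heq := Submodule.eq_of_le_of_finrank_le (range_faceBoundary_le next) (by omega)
  have hone : (1 : Fin n × Bool → ZMod 2) ∈ LinearMap.ker (incidence next).mulVecLin := by
    rw [LinearMap.mem_ker]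
    funext c
    rw [Matrix.mulVecLin_apply, incidence_mulVec]
    exact (by decide : (1 : ZMod 2) + 1 + (1 + 1) = 0)
  rw [← heq] at hone
  exact hone

/-- The edges of a planar diagram can be coloured such that every oriented smoothing joins edges
of equal colours and the other smoothing joins edges of different colours. -/
theorem Shadow.exists_coloring (Γ : Shadow) : ∃ σ : Γ.Edge → Bool, ∀ c,
    σ (Γ.incoming c false) = σ (c, false) ∧ σ (c, true) = !σ (c, false) ∧
      σ (Γ.incoming c true) = !σ (c, false) := by
  obtain ⟨φ, hφ⟩ := exists_faceBoundary_eq_one Γ.next Γ.planar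
  have hother : ∀ h, φ (faceOf Γ.next (otherEnd Γ.next h)) = 1 + φ (faceOf Γ.next h) := by
    have h0 : ∀ e, φ (faceOf Γ.next (Sum.inl e)) + φ (faceOf Γ.next (Sum.inr (Γ.next e))) = 1 :=
      fun e => congrFun hφ e
    have h1 : ∀ a b : ZMod 2, a + b = 1 → b = 1 + a ∧ a = 1 + b := by decide
    rintro (e | e)
    · exact (h1 _ _ (h0 e)).1
    · have := (h1 _ _ (h0 (Γ.next.symm e))).2
      rwa [Equiv.apply_symm_apply] at this
  -- The colour of an edge is that of the face attached to its outgoing end. Crossing an edge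
  -- changes `φ` by one, and so does a rotation by one step.
  refine ⟨fun e => decide (φ (faceOf Γ.next (Sum.inl e)) = 1), fun c => ?_⟩
  have hrot : ∀ h, φ (faceOf Γ.next (rotate h)) = 1 + φ (faceOf Γ.next h) := fun h => by
    rw [face_rotate, hother]
  have e1 : φ (faceOf Γ.next (Sum.inl (c, false))) = _ := hrot (Sum.inl (c, true))
  have e2 : φ (faceOf Γ.next (Sum.inr (c, false))) = _ := hrot (Sum.inl (c, false))
  have e3 : φ (faceOf Γ.next (Sum.inr (c, true))) = _ := hrot (Sum.inr (c, false))
  have f1 : φ (faceOf Γ.next (Sum.inl (Γ.next.symm (c, false)))) = _ :=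
    hother (Sum.inr (c, false))
  have f2 : φ (faceOf Γ.next (Sum.inl (Γ.next.symm (c, true)))) = _ :=
    hother (Sum.inr (c, true))
  have key : ∀ x₁ x₂ d₃ d₄ y₃ y₄ : ZMod 2, x₁ = 1 + x₂ → d₄ = 1 + x₁ → d₃ = 1 + d₄ →
      y₄ = 1 + d₄ → y₃ = 1 + d₃ → decide (y₄ = 1) = decide (x₁ = 1) ∧
        decide (x₂ = 1) = !decide (x₁ = 1) ∧ decide (y₃ = 1) = !decide (x₁ = 1) := by
    rintro _ x₂ _ _ _ _ rfl rfl rfl rfl rfl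
    revert x₂
    decide
  exact key _ _ _ _ _ _ e1 e2 e3 f1 f2

end Planar

/-! ### Elimination of a pair `{a, b}` with a regular entry. -/

section Elimination

variable {R : Type*} [CommRing R] {V N N' : Type*} [AddCommGroup V] [Module R V]
  [AddCommGroup N] [Module R N] [AddCommGroup N'] [Module R N']

/-- The map `ε` induces an isomorphism between the homology of `(V, D)` modulo `W` and that of
`(N, d)` modulo `W'`. -/
structure Reduces (D : V →ₗ[R] V) (W : Submodule R V) (d : N →ₗ[R] N) (W' : Submodule R N)
    (ε : V →ₗ[R] N) : Prop where
  inj : ∀ f, D f ∈ W → ∀ n, ε f - d n ∈ W' → ∃ h, f - D h ∈ W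
  surj : ∀ m, d m ∈ W' → ∃ f, D f ∈ W ∧ ε f - m ∈ W'
  comm : ∃ u : R, u * u = 1 ∧ ∀ f, ε (D f) - u • d (ε f) ∈ W'
  maps : ∀ f ∈ W, ε f ∈ W'

theorem Reduces.comp {D : V →ₗ[R] V} {W : Submodule R V} {d : N →ₗ[R] N} {W' : Submodule R N}
    {ε : V →ₗ[R] N} {d' : N' →ₗ[R] N'} {W'' : Submodule R N'} {ε' : N →ₗ[R] N'}
    (h' : Reduces d W' d' W'' ε') (h : Reduces D W d W' ε) :
    Reduces D W d' W'' (ε' ∘ₗ ε) where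
  inj f hf n hn := by
    obtain ⟨u, hu, hc⟩ := h.comm
    have h1 : d (ε f) ∈ W' := by
      have := W'.smul_mem u (W'.sub_mem (h.maps _ hf) (hc f))
      rwa [sub_sub_cancel, smul_smul, hu, one_smul] at this
    obtain ⟨k, hk⟩ := h'.inj _ h1 n hn
    exact h.inj f hf k hk
  surj m hm := by
    obtain ⟨n, hn, hn'⟩ := h'.surj m hm
    obtain ⟨f, hf, hf'⟩ := h.surj n hn
    refine ⟨f, hf, ?_⟩
    have := W''.add_mem (h'.maps _ hf') hn'
    rw [map_sub, sub_add_sub_cancel] at this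
    exact this
  comm := by
    obtain ⟨u, hu, hc⟩ := h.comm
    obtain ⟨u', hu', hc'⟩ := h'.comm
    refine ⟨u * u', by linear_combination u' * u' * hu + hu', fun f => ?_⟩
    have := W''.add_mem (h'.maps _ (hc f)) (W''.smul_mem u (hc' (ε f)))
    rw [map_sub, map_smul, smul_sub, sub_add_sub_cancel, smul_smul] at this
    exact this
  maps f hf := h'.maps _ (h.maps f hf)

theorem Reduces.of_equiv {D : V →ₗ[R] V} {W : Submodule R V} {d : N →ₗ[R] N}
    {W' : Submodule R N} (e : V ≃ₗ[R] N) (hD : ∀ f, e (D f) = d (e f))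
    (hW : ∀ f, f ∈ W ↔ e f ∈ W') : Reduces D W d W' e.toLinearMap where
  inj f _ n hn := by
    refine ⟨e.symm n, (hW _).2 ?_⟩
    rw [map_sub, hD, e.apply_symm_apply]
    exact hn
  surj m hm := by
    refine ⟨e.symm m, (hW _).2 ?_, ?_⟩
    · rwa [hD, e.apply_symm_apply]
    · simp
  comm := ⟨1, by simp, fun f => by simp [hD]⟩
  maps f hf := (hW f).1 hf

/-- The tensor product of `(N, d)` with the factorization `{a, b}`. -/
def cone (d : N →ₗ[R] N) (a b : R) : (N × N) →ₗ[R] (N × N) :=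
  LinearMap.prod (d ∘ₗ LinearMap.fst R N N + b • LinearMap.snd R N N)
    (a • LinearMap.fst R N N - d ∘ₗ LinearMap.snd R N N)

theorem cone_apply (d : N →ₗ[R] N) (a b : R) (m m' : N) :
    cone d a b (m, m') = (d m + b • m', a • m - d m') := rfl

/-- A cycle `(m, m')` modulo `W` satisfies `d m = -b m'`, so `m` is a cycle modulo `W'`. Conversely
`b` can be cancelled modulo `W`, so `m` determines `m'`, and `d² = -ab` supplies the second cycle
equation. -/
theorem reduces_cone_fst (d : N →ₗ[R] N) (W W' : Submodule R N) (a b : R)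
    (hd : ∀ n ∈ W, d n ∈ W) (hb : ∀ n, b • n ∈ W → n ∈ W)
    (hsq : ∀ n, d (d n) + (a * b) • n ∈ W) (hW' : ∀ n, n ∈ W' ↔ ∃ k, n - b • k ∈ W) :
    Reduces (cone d a b) (W.prod W) d W' (LinearMap.fst R N N) where
  inj := by
    rintro ⟨m, m'⟩ hf n hn
    obtain ⟨k, hk⟩ := (hW' _).1 hn
    rw [cone_apply, Submodule.mem_prod] at hf
    obtain ⟨h1, -⟩ := hf
    simp only [LinearMap.fst_apply] at hk h1
    refine ⟨(n, k), ?_⟩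
    rw [cone_apply, Submodule.mem_prod]
    refine ⟨by simpa [sub_sub] using hk, hb _ ?_⟩
    have := W.sub_mem (W.sub_mem h1 (hd _ hk)) (hsq n)
    convert this using 1
    simp only [Prod.snd_sub, map_sub, map_smul]
    module
  surj m hm := by
    obtain ⟨k, hk⟩ := (hW' _).1 hm
    refine ⟨(m, -k), ?_, by simp⟩
    rw [cone_apply, Submodule.mem_prod]
    refine ⟨by simpa [sub_eq_add_neg] using hk, hb _ ?_⟩
    have := W.sub_mem (hsq m) (hd _ hk)
    convert this using 1
    simp only [map_sub, map_smul, map_neg]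
    module
  comm := ⟨1, by simp, fun ⟨m, m'⟩ => (hW' _).2 ⟨m', by simp [cone_apply]⟩⟩
  maps f hf := (hW' _).2 ⟨0, by simpa using hf.1⟩

theorem reduces_cone_snd (d : N →ₗ[R] N) (W W' : Submodule R N) (a b : R)
    (hd : ∀ n ∈ W, d n ∈ W) (ha : ∀ n, a • n ∈ W → n ∈ W)
    (hsq : ∀ n, d (d n) + (a * b) • n ∈ W) (hW' : ∀ n, n ∈ W' ↔ ∃ k, n - a • k ∈ W) :
    Reduces (cone d a b) (W.prod W) d W' (LinearMap.snd R N N) where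
  inj := by
    rintro ⟨m', m⟩ hf n hn
    obtain ⟨k, hk⟩ := (hW' _).1 hn
    rw [cone_apply, Submodule.mem_prod] at hf
    obtain ⟨-, h1⟩ := hf
    simp only [LinearMap.snd_apply] at hk h1
    refine ⟨(k, -n), ?_⟩
    rw [cone_apply, Submodule.mem_prod]
    refine ⟨ha _ ?_, by simpa [sub_sub, add_comm] using hk⟩
    have := W.sub_mem (W.add_mem h1 (hd _ hk)) (W.neg_mem (hsq n))
    convert this using 1
    simp only [Prod.fst_sub, map_sub, map_smul, map_neg]
    module
  surj m hm := by
    obtain ⟨k, hk⟩ := (hW' _).1 hm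
    refine ⟨(k, m), ?_, by simp⟩
    rw [cone_apply, Submodule.mem_prod]
    refine ⟨ha _ ?_, by simpa using W.neg_mem hk⟩
    have := W.sub_mem (hsq m) (hd _ hk)
    convert this using 1
    simp only [map_sub, map_smul]
    module
  -- The second summand sits in shifted `ℤ/2`-degree, so the projection anticommutes with the
  -- differentials. This is why `Reduces` admits a factor `u` with `u² = 1`.
  comm := ⟨-1, by simp, fun ⟨m, m'⟩ => (hW' _).2 ⟨m, by simp [cone_apply]⟩⟩
  maps f hf := (hW' _).2 ⟨0, by simpa using hf.2⟩

/-- The differentials of `{α₁, β₁} ⊗ {α₂, β₂}` in the ordered bases `1, ab` and `a, b`. -/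
def stdDiff (α₁ β₁ α₂ β₂ : R) : Fin 2 → Matrix (Fin 2) (Fin 2) R :=
  ![!![α₁, β₂; α₂, -β₁], !![β₁, β₂; α₂, -α₁]]

/-- The differential of `{α₁, β₁} ⊗ {α₂, β₂}` as a matrix on the whole basis. -/
def stdMat (α₁ β₁ α₂ β₂ : R) : Matrix (Fin 2 × Fin 2) (Fin 2 × Fin 2) R := fun u v =>
  if u.1 = v.1 then 0 else stdDiff α₁ β₁ α₂ β₂ v.1 u.2 v.2

/-- The tensor product of `(N, d)` with a factorization of rank four. -/
def vertexD (A : Matrix (Fin 2 × Fin 2) (Fin 2 × Fin 2) R) (d : N →ₗ[R] N) :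
    (Fin 2 × Fin 2 → N) →ₗ[R] (Fin 2 × Fin 2 → N) :=
  LinearMap.pi fun u => ∑ v, A u v • LinearMap.proj v +
    (-1 : R) ^ (u.1 : ℕ) • (d ∘ₗ LinearMap.proj u)

theorem vertexD_apply (A : Matrix (Fin 2 × Fin 2) (Fin 2 × Fin 2) R) (d : N →ₗ[R] N)
    (f : Fin 2 × Fin 2 → N) (u : Fin 2 × Fin 2) :
    vertexD A d f u = ∑ v, A u v • f v + (-1 : R) ^ (u.1 : ℕ) • d (f u) := by
  simp [vertexD]

/-- The functions with values in `W`. -/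
def valued (ι : Type*) (W : Submodule R N) : Submodule R (ι → N) :=
  Submodule.pi Set.univ fun _ => W

theorem mem_valued {ι : Type*} {W : Submodule R N} {f : ι → N} :
    f ∈ valued ι W ↔ ∀ i, f i ∈ W := by
  simp [valued, Submodule.mem_pi]

/-- The change of basis by an invertible matrix. -/
def matrixEquiv (P Q : Matrix (Fin 2 × Fin 2) (Fin 2 × Fin 2) R) (hPQ : P * Q = 1)
    (hQP : Q * P = 1) : (Fin 2 × Fin 2 → N) ≃ₗ[R] (Fin 2 × Fin 2 → N) where
  toFun f u := ∑ v, P u v • f v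
  invFun f u := ∑ v, Q u v • f v
  map_add' f g := by funext u; simp [Finset.sum_add_distrib]
  map_smul' r f := by funext u; simp [Finset.smul_sum, smul_comm r]
  left_inv f := by
    funext u
    simp only [Finset.smul_sum, smul_smul]
    rw [Finset.sum_comm]
    simp only [← Finset.sum_smul, ← Matrix.mul_apply, hQP, Matrix.one_apply]
    simp
  right_inv f := by
    funext u
    simp only [Finset.smul_sum, smul_smul]
    rw [Finset.sum_comm]
    simp only [← Finset.sum_smul, ← Matrix.mul_apply, hPQ, Matrix.one_apply]
    simp

theorem matrixEquiv_apply {P Q : Matrix (Fin 2 × Fin 2) (Fin 2 × Fin 2) R} (hPQ : P * Q = 1)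
    (hQP : Q * P = 1) (f : Fin 2 × Fin 2 → N) (u : Fin 2 × Fin 2) :
    matrixEquiv P Q hPQ hQP f u = ∑ v, P u v • f v := rfl

/-- An even matrix commutes with the signs in front of `d`, so intertwining the rank four parts
suffices. -/
theorem reduces_matrixEquiv {A B P Q : Matrix (Fin 2 × Fin 2) (Fin 2 × Fin 2) R}
    (hPQ : P * Q = 1) (hQP : Q * P = 1) (hP : ∀ u v : Fin 2 × Fin 2, u.1 ≠ v.1 → P u v = 0)
    (hPA : P * A = B * P) (d : N →ₗ[R] N) (W : Submodule R N) :
    Reduces (vertexD A d) (valued _ W) (vertexD B d) (valued _ W)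
      (matrixEquiv P Q hPQ hQP).toLinearMap := by
  refine Reduces.of_equiv _ (fun f => ?_) (fun f => ?_)
  · funext u
    have h : ∀ v, (P u v * (-1 : R) ^ (v.1 : ℕ)) • d (f v) =
        ((-1 : R) ^ (u.1 : ℕ) * P u v) • d (f v) := by
      intro v
      by_cases huv : u.1 = v.1
      · rw [huv, mul_comm]
      · rw [hP u v huv, zero_mul, mul_zero]
    simp only [matrixEquiv_apply, vertexD_apply, smul_add, Finset.sum_add_distrib, map_sum,
      map_smul, Finset.smul_sum, smul_smul, h]
    congr 1
    rw [Finset.sum_comm, Finset.sum_comm (f := fun x x_1 => (B u x * P x x_1) • f x_1)]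
    simp only [← Finset.sum_smul, ← Matrix.mul_apply, hPA]
  · simp only [mem_valued]
    constructor
    · intro h u
      rw [matrixEquiv_apply]
      exact W.sum_mem fun v _ => W.smul_mem _ (h v)
    · intro h
      rw [← (matrixEquiv P Q hPQ hQP).symm_apply_apply f]
      intro u
      change ∑ v, Q u v • matrixEquiv P Q hPQ hQP f v ∈ W
      exact W.sum_mem fun v _ => W.smul_mem _ (h v)

/-- The coordinates of the tensor product of two factorizations of rank two. -/
def pairEquiv : (Fin 2 × Fin 2 → N) ≃ₗ[R] (N × N) × (N × N) where
  toFun f := ((f (0, 0), f (1, 1)), (f (1, 0), -f (0, 1)))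
  invFun m u := ![![m.1.1, -m.2.2], ![m.2.1, m.1.2]] u.1 u.2
  map_add' f g := by ext <;> simp [add_comm]
  map_smul' r f := by ext <;> simp
  left_inv f := by
    funext ⟨i, j⟩
    fin_cases i <;> fin_cases j <;> simp
  right_inv m := by ext <;> simp

/-- The minus sign on the coordinate of `ab` in `pairEquiv` translates the ordered basis `1, ab, a,
b` into the sign rule of an iterated cone. -/
theorem pairEquiv_vertexD (α₁ β₁ α₂ β₂ : R) (d : N →ₗ[R] N) (f : Fin 2 × Fin 2 → N) :
    pairEquiv (R := R) (vertexD (stdMat α₁ β₁ α₂ β₂) d f) =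
      cone (cone d α₂ β₂) α₁ β₁ (pairEquiv (R := R) f) := by
  simp only [pairEquiv, LinearEquiv.coe_mk, LinearMap.coe_mk, AddHom.coe_mk, cone_apply,
    vertexD_apply, Fintype.sum_prod_type, Fin.sum_univ_two, stdMat, stdDiff]
  ext <;> simp <;> abel

/-- The coordinate which survives if the first pair is eliminated with the help of its first
(`x`) or second (`!x`) entry, and similarly for the second pair. -/
def survivor (x y : Bool) : Fin 2 × Fin 2 :=
  if x then (if y then (0, 1) else (1, 0)) else (if y then (1, 1) else (0, 0))

theorem Reduces.neg {D : V →ₗ[R] V} {W : Submodule R V} {d : N →ₗ[R] N} {W' : Submodule R N}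
    {ε : V →ₗ[R] N} (h : Reduces D W d W' ε) : Reduces D W d W' (-ε) where
  inj f hf n hn := h.inj f hf (-n) (by
    have := W'.neg_mem hn
    convert this using 1
    simp only [LinearMap.neg_apply, map_neg]; abel)
  surj m hm := by
    obtain ⟨f, hf, hf'⟩ := h.surj (-m) (by simpa using hm)
    refine ⟨f, hf, ?_⟩
    have := W'.neg_mem hf'
    convert this using 1
    simp only [LinearMap.neg_apply]; abel
  comm := by
    obtain ⟨u, hu, hc⟩ := h.comm
    refine ⟨u, hu, fun f => ?_⟩
    have := W'.neg_mem (hc f)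
    convert this using 1
    simp only [LinearMap.neg_apply, map_neg, smul_neg]; abel
  maps f hf := W'.neg_mem (h.maps f hf)

/-- Elimination of the first pair makes `α₁β₁` act as zero modulo `W₁`, so the second pair meets the
hypotheses of the same argument. The Booleans allow either entry of each pair to be used. -/
theorem reduces_std (d : N →ₗ[R] N) (W W₁ W₂ : Submodule R N) (α₁ β₁ α₂ β₂ : R) (x y : Bool)
    (hd : ∀ n ∈ W, d n ∈ W)
    (h₁ : ∀ n, (if x then α₁ else β₁) • n ∈ W → n ∈ W)
    (h₂ : ∀ n, (if y then α₂ else β₂) • n ∈ W₁ → n ∈ W₁)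
    (hsq : ∀ n, d (d n) + (α₁ * β₁ + α₂ * β₂) • n ∈ W)
    (hW₁ : ∀ n, n ∈ W₁ ↔ ∃ k, n - (if x then α₁ else β₁) • k ∈ W)
    (hW₂ : ∀ n, n ∈ W₂ ↔ ∃ k, n - (if y then α₂ else β₂) • k ∈ W₁) :
    Reduces (vertexD (stdMat α₁ β₁ α₂ β₂) d) (valued _ W) d W₂
      (LinearMap.proj (survivor x y)) := by
  have e0 : Reduces (vertexD (stdMat α₁ β₁ α₂ β₂) d) (valued _ W) (cone (cone d α₂ β₂) α₁ β₁)
      ((W.prod W).prod (W.prod W)) (pairEquiv (R := R) (N := N)).toLinearMap := by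
    refine Reduces.of_equiv _ (pairEquiv_vertexD α₁ β₁ α₂ β₂ d) fun f => ?_
    simp only [mem_valued, Prod.forall, Fin.forall_fin_two, pairEquiv, LinearEquiv.coe_mk,
      LinearMap.coe_mk, AddHom.coe_mk, Submodule.mem_prod, neg_mem_iff]
    tauto
  have hle : ∀ n ∈ W, n ∈ W₁ := fun n hn => (hW₁ n).2 ⟨0, by simpa using hn⟩
  have hmul : ∀ n, (α₁ * β₁) • n ∈ W₁ := by
    intro n
    cases x
    · exact (hW₁ _).2 ⟨α₁ • n, by simp [smul_smul, mul_comm]⟩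
    · exact (hW₁ _).2 ⟨β₁ • n, by simp [smul_smul]⟩
  have hd₁ : ∀ n ∈ W₁, d n ∈ W₁ := by
    intro n hn
    obtain ⟨k, hk⟩ := (hW₁ _).1 hn
    exact (hW₁ _).2 ⟨d k, by simpa only [map_sub, map_smul] using hd _ hk⟩
  have hdc : ∀ n ∈ W.prod W, cone d α₂ β₂ n ∈ W.prod W := by
    rintro ⟨n, n'⟩ ⟨hn, hn'⟩
    exact ⟨W.add_mem (hd _ hn) (W.smul_mem _ hn'), W.sub_mem (W.smul_mem _ hn) (hd _ hn')⟩
  have hsqc : ∀ n : N × N, cone d α₂ β₂ (cone d α₂ β₂ n) + (α₁ * β₁) • n ∈ W.prod W := by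
    rintro ⟨n, n'⟩
    simp only [cone_apply, Submodule.mem_prod, Prod.smul_mk, Prod.mk_add_mk]
    constructor
    · convert hsq n using 1
      simp only [map_add, map_smul]
      module
    · convert hsq n' using 1
      simp only [map_sub, map_smul]
      module
  have hW₁c : ∀ n : N × N, n ∈ W₁.prod W₁ ↔
      ∃ k, n - (if x then α₁ else β₁) • k ∈ W.prod W := by
    rintro ⟨n, n'⟩
    simp only [Submodule.mem_prod, hW₁, Prod.exists, Prod.smul_mk, Prod.mk_sub_mk]
    constructor
    · rintro ⟨⟨k, hk⟩, k', hk'⟩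
      exact ⟨k, k', hk, hk'⟩
    · rintro ⟨k, k', hk, hk'⟩
      exact ⟨⟨k, hk⟩, k', hk'⟩
  have hsq₁ : ∀ n, d (d n) + (α₂ * β₂) • n ∈ W₁ := by
    intro n
    have := W₁.sub_mem (hle _ (hsq n)) (hmul n)
    convert this using 1
    module
  cases x
  · have e1 := reduces_cone_fst (cone d α₂ β₂) (W.prod W) (W₁.prod W₁) α₁ β₁ hdc
      (fun n hn => ⟨h₁ _ hn.1, h₁ _ hn.2⟩) hsqc hW₁c
    cases y
    · have e2 := reduces_cone_fst d W₁ W₂ α₂ β₂ hd₁ h₂ hsq₁ hW₂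
      exact (e2.comp e1).comp e0
    · have e2 := reduces_cone_snd d W₁ W₂ α₂ β₂ hd₁ h₂ hsq₁ hW₂
      exact (e2.comp e1).comp e0
  · have e1 := reduces_cone_snd (cone d α₂ β₂) (W.prod W) (W₁.prod W₁) α₁ β₁ hdc
      (fun n hn => ⟨h₁ _ hn.1, h₁ _ hn.2⟩) hsqc hW₁c
    cases y
    · have e2 := reduces_cone_fst d W₁ W₂ α₂ β₂ hd₁ h₂ hsq₁ hW₂
      exact (e2.comp e1).comp e0
    · have e2 := reduces_cone_snd d W₁ W₂ α₂ β₂ hd₁ h₂ hsq₁ hW₂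
      -- Here the survivor is the coordinate of `ab`, which carries the sign of `pairEquiv`.
      have := ((e2.comp e1).comp e0).neg
      convert this using 1
      ext f
      simp [pairEquiv, survivor]

end Elimination

/-! ### Iterated elimination over all vertices. -/

section ChainReduction

variable {R : Type*} [CommRing R]

/-- A factorization of rank four with an isomorphism to a tensor product of two factorizations of
rank two, and a choice of one entry from each of the two. -/
structure LocalFactorization (R : Type*) [CommRing R] where
  A : Matrix (Fin 2 × Fin 2) (Fin 2 × Fin 2) R
  (α₁ β₁ α₂ β₂ : R)
  (P Q : Matrix (Fin 2 × Fin 2) (Fin 2 × Fin 2) R)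
  (x y : Bool)
  odd : ∀ u v : Fin 2 × Fin 2, u.1 = v.1 → A u v = 0
  sq : A * A = (α₁ * β₁ + α₂ * β₂) • (1 : Matrix (Fin 2 × Fin 2) (Fin 2 × Fin 2) R)
  mul_inv : P * Q = 1
  inv_mul : Q * P = 1
  even : ∀ u v : Fin 2 × Fin 2, u.1 ≠ v.1 → P u v = 0
  intertwine : P * A = stdMat α₁ β₁ α₂ β₂ * P

namespace LocalFactorization

variable (L : LocalFactorization R)

/-- The entry chosen from the first pair. -/
def c₁ : R := if L.x then L.α₁ else L.β₁

/-- The entry chosen from the second pair. -/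
def c₂ : R := if L.y then L.α₂ else L.β₂

/-- The potential. -/
def potential : R := L.α₁ * L.β₁ + L.α₂ * L.β₂

/-- The projection to the surviving coordinate. -/
def functional (N : Type*) [AddCommGroup N] [Module R N] : (Fin 2 × Fin 2 → N) →ₗ[R] N :=
  LinearMap.proj (survivor L.x L.y) ∘ₗ (matrixEquiv L.P L.Q L.mul_inv L.inv_mul).toLinearMap

theorem functional_apply {N : Type*} [AddCommGroup N] [Module R N] (f : Fin 2 × Fin 2 → N) :
    L.functional N f = ∑ v, L.P (survivor L.x L.y) v • f v := rfl

end LocalFactorization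

/-- The mixed terms cancel because `L.A` is odd and hence anticommutes with the sign in front of
`d`. -/
theorem vertexD_vertexD {N : Type*} [AddCommGroup N] [Module R N] (L : LocalFactorization R)
    (d : N →ₗ[R] N) (f : Fin 2 × Fin 2 → N) (u : Fin 2 × Fin 2) :
    vertexD L.A d (vertexD L.A d f) u = L.potential • f u + d (d (f u)) := by
  have h : ∀ v, (L.A u v * (-1 : R) ^ (v.1 : ℕ)) • d (f v) =
      -(((-1 : R) ^ (u.1 : ℕ) * L.A u v) • d (f v)) := by
    intro v
    by_cases huv : u.1 = v.1
    · simp [L.odd u v huv]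
    · have : (-1 : R) ^ (v.1 : ℕ) = -(-1 : R) ^ (u.1 : ℕ) := by
        obtain ⟨u1, u2⟩ := u
        obtain ⟨v1, v2⟩ := v
        fin_cases u1 <;> fin_cases v1 <;> simp at huv ⊢
      rw [this, ← neg_smul]
      congr 1
      ring
  simp only [vertexD_apply, smul_add, Finset.sum_add_distrib, map_add, map_sum, map_smul,
    Finset.smul_sum, smul_smul, h, Finset.sum_neg_distrib]
  rw [Finset.sum_comm]
  simp only [← Finset.sum_smul, ← Matrix.mul_apply, L.sq, Matrix.smul_apply, Matrix.one_apply]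
  simp [LocalFactorization.potential, ← mul_pow]

variable {m : ℕ}

/-- The differential of a tensor product of factorizations of rank four. -/
def chainD (A : Fin m → Matrix (Fin 2 × Fin 2) (Fin 2 × Fin 2) R) :
    ((Fin m → Fin 2 × Fin 2) → R) →ₗ[R] ((Fin m → Fin 2 × Fin 2) → R) where
  toFun f g := ∑ c, (∏ c' ∈ Finset.univ.filter (· < c), (-1 : R) ^ ((g c').1 : ℕ)) *
    ∑ u, A c (g c) u * f (Function.update g c u)
  map_add' f f' := by
    funext g; simp [mul_add, Finset.sum_add_distrib]
  map_smul' r f := by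
    funext g; simp [Finset.mul_sum, mul_left_comm]

/-- Separation of the first index. -/
def consEquiv (ι : Type*) (m : ℕ) : ((Fin (m + 1) → ι) → R) ≃ₗ[R] (ι → (Fin m → ι) → R) where
  toFun f u g := f (Fin.cons u g)
  invFun F g := F (g 0) (Fin.tail g)
  map_add' f f' := rfl
  map_smul' r f := rfl
  left_inv f := by funext g; simp
  right_inv F := by funext u g; simp

theorem consEquiv_chainD (A : Fin (m + 1) → Matrix (Fin 2 × Fin 2) (Fin 2 × Fin 2) R)
    (f : (Fin (m + 1) → Fin 2 × Fin 2) → R) :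
    consEquiv _ m (chainD A f) =
      vertexD (A 0) (chainD (Fin.tail A)) (consEquiv (Fin 2 × Fin 2) m f) := by
  funext u g
  rw [vertexD_apply]
  simp only [consEquiv, LinearEquiv.coe_mk, LinearMap.coe_mk, AddHom.coe_mk, chainD,
    Pi.add_apply, Finset.sum_apply, Pi.smul_apply, smul_eq_mul, Fin.sum_univ_succ,
    Finset.prod_filter, Fin.prod_univ_succ]
  simp [Fin.update_cons_zero, ← Fin.cons_update, Finset.mul_sum, Fin.tail, mul_assoc]

/-- The iterated projection to the surviving coordinates. -/
def eps : (m : ℕ) → (Fin m → LocalFactorization R) → ((Fin m → Fin 2 × Fin 2) → R) →ₗ[R] R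
  | 0, _ => LinearMap.proj Fin.elim0
  | m + 1, L => eps m (Fin.tail L) ∘ₗ (L 0).functional _ ∘ₗ
      (consEquiv (Fin 2 × Fin 2) m).toLinearMap

/-- The ideal generated by the entries chosen at the first `k` vertices. -/
def before (L : Fin m → LocalFactorization R) (k : ℕ) : Ideal R :=
  Ideal.span {r | ∃ i : Fin m, (i : ℕ) < k ∧ (r = (L i).c₁ ∨ r = (L i).c₂)}

theorem before_zero (L : Fin m → LocalFactorization R) : before L 0 = ⊥ := by
  simp [before]

theorem before_succ (L : Fin (m + 1) → LocalFactorization R) (k : ℕ) :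
    before L (k + 1) =
      Ideal.span {(L 0).c₁} ⊔ Ideal.span {(L 0).c₂} ⊔ before (Fin.tail L) k := by
  rw [before, before, ← Ideal.span_union, ← Ideal.span_union]
  congr 1
  ext r
  simp only [Set.mem_ofPred_eq, Set.mem_union, Set.mem_singleton_iff, Fin.exists_fin_succ,
    Fin.val_zero, Fin.val_succ, Fin.tail, Nat.zero_lt_succ, true_and, Nat.succ_lt_succ_iff]

theorem chainD_chainD : ∀ (m : ℕ) (L : Fin m → LocalFactorization R)
    (f : (Fin m → Fin 2 × Fin 2) → R),
    chainD (fun i => (L i).A) (chainD (fun i => (L i).A) f) = (∑ i, (L i).potential) • f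
  | 0, L, f => by
    funext g
    simp [chainD]
  | m + 1, L, f => by
    apply (consEquiv _ m).injective
    rw [consEquiv_chainD, consEquiv_chainD]
    funext u
    rw [vertexD_vertexD, Fin.sum_univ_succ]
    have := chainD_chainD m (Fin.tail L) (consEquiv (Fin 2 × Fin 2) m f u)
    change _ • _ + (chainD fun i => (Fin.tail L i).A) ((chainD fun i => (Fin.tail L i).A) _) = _
    rw [this, ← add_smul]
    rfl

theorem smul_mem_valued_iff {ι : Type*} (J : Ideal R) (c : R) (n : ι → R) :
    n ∈ valued ι (J ⊔ Ideal.span {c} : Ideal R) ↔ ∃ k : ι → R, n - c • k ∈ valued ι J := by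
  simp only [mem_valued]
  constructor
  · intro h
    have h' : ∀ i, ∃ k, n i - c * k ∈ J := by
      intro i
      obtain ⟨a, ha, b, hb, hab⟩ := Submodule.mem_sup.1 (h i)
      obtain ⟨k, rfl⟩ := Ideal.mem_span_singleton.1 hb
      exact ⟨k, by rwa [← hab, add_sub_cancel_right]⟩
    choose k hk using h'
    exact ⟨k, hk⟩
  · rintro ⟨k, hk⟩ i
    refine Submodule.mem_sup.2 ⟨_, hk i, c * k i, Ideal.mem_span_singleton.2 ⟨_, rfl⟩, ?_⟩
    simp

/-- The last two hypotheses say that the chosen entries form a regular sequence modulo `J`. The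
induction removes vertex `0` and enlarges `J` by its two entries; its potential lies in the enlarged
ideal, so the remaining potentials still sum to an element of it. What survives is one copy of `R`
modulo all entries, with zero differential. -/
theorem reduces_chainD : ∀ (m : ℕ) (L : Fin m → LocalFactorization R) (J : Ideal R),
    ∑ i, (L i).potential ∈ J →
    (∀ (i : Fin m) (r : R), (L i).c₁ * r ∈ J ⊔ before L i → r ∈ J ⊔ before L i) →
    (∀ (i : Fin m) (r : R), (L i).c₂ * r ∈ J ⊔ before L i ⊔ Ideal.span {(L i).c₁} →
      r ∈ J ⊔ before L i ⊔ Ideal.span {(L i).c₁}) →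
    Reduces (chainD fun i => (L i).A) (valued _ J) (0 : R →ₗ[R] R) (J ⊔ before L m) (eps m L)
  | 0, L, J, _, _, _ => by
    refine Reduces.of_equiv (LinearEquiv.funUnique (Fin 0 → Fin 2 × Fin 2) R R) ?_ ?_
    · intro f
      simp [chainD]
    · intro f
      rw [before_zero, sup_bot_eq, mem_valued, Unique.forall_iff]
      rfl
  | m + 1, L, J, hw, h₁, h₂ => by
    set d := chainD fun i => (Fin.tail L i).A with hd
    have hd' : ∀ I : Ideal R, ∀ n ∈ valued (Fin m → Fin 2 × Fin 2) I, d n ∈ valued _ I := by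
      intro I n hn
      rw [mem_valued] at hn ⊢
      intro g
      change ∑ c, (∏ c' ∈ Finset.univ.filter (· < c), (-1 : R) ^ ((g c').1 : ℕ)) *
        ∑ u, (Fin.tail L c).A (g c) u * n (Function.update g c u) ∈ I
      exact I.sum_mem fun c _ => I.mul_mem_left _ (I.sum_mem fun u _ => I.mul_mem_left _ (hn _))
    set J₁ : Ideal R := J ⊔ Ideal.span {(L 0).c₁} with hJ₁
    set J₂ : Ideal R := J₁ ⊔ Ideal.span {(L 0).c₂} with hJ₂
    have hsup : ∀ k, J ⊔ before L (k + 1) = J₂ ⊔ before (Fin.tail L) k := by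
      intro k
      rw [before_succ, hJ₂, hJ₁]
      simp only [sup_assoc]
    have e0 : Reduces (chainD fun i => (L i).A) (valued _ J) (vertexD (L 0).A d)
        (valued _ (valued _ J)) (consEquiv (Fin 2 × Fin 2) m).toLinearMap := by
      refine Reduces.of_equiv _ (fun f => consEquiv_chainD _ f) fun f => ?_
      simp only [mem_valued]
      exact ⟨fun h u g => h _, fun h g => by simpa [consEquiv] using h (g 0) (Fin.tail g)⟩
    have e1 := reduces_matrixEquiv (L 0).mul_inv (L 0).inv_mul (L 0).even (L 0).intertwine d
      (valued _ J)
    have e2 := reduces_std d (valued _ J) (valued _ J₁) (valued _ J₂) (L 0).α₁ (L 0).β₁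
      (L 0).α₂ (L 0).β₂ (L 0).x (L 0).y (hd' J)
      (fun n hn => by
        rw [mem_valued] at hn ⊢
        intro g
        have := h₁ 0 (n g)
        rw [Fin.val_zero, before_zero, sup_bot_eq] at this
        exact this (hn g))
      (fun n hn => by
        rw [mem_valued] at hn ⊢
        intro g
        have := h₂ 0 (n g)
        rw [Fin.val_zero, before_zero, sup_bot_eq] at this
        exact this (hn g))
      (fun n => by
        rw [hd, chainD_chainD, ← add_smul, mem_valued]
        intro g
        rw [Fin.sum_univ_succ, add_comm] at hw
        exact J.mul_mem_right _ hw)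
      (fun n => smul_mem_valued_iff J _ n)
      (fun n => smul_mem_valued_iff J₁ _ n)
    have e3 := reduces_chainD m (Fin.tail L) J₂ (by
        rw [Fin.sum_univ_succ] at hw
        have h3 : (L 0).potential ∈ J₂ := by
          rw [hJ₂, hJ₁]
          refine Ideal.add_mem _ ?_ ?_
          · refine Ideal.mem_sup_left (Ideal.mem_sup_right (Ideal.mem_span_singleton.2 ?_))
            rw [LocalFactorization.c₁]
            split_ifs
            · exact dvd_mul_right _ _
            · exact dvd_mul_left _ _
          · refine Ideal.mem_sup_right (Ideal.mem_span_singleton.2 ?_)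
            rw [LocalFactorization.c₂]
            split_ifs
            · exact dvd_mul_right _ _
            · exact dvd_mul_left _ _
        have h4 := J₂.sub_mem (Ideal.mem_sup_left (Ideal.mem_sup_left hw)) h3
        rwa [add_sub_cancel_left] at h4)
      (fun i r => by
        have := h₁ i.succ r
        rwa [Fin.val_succ, hsup] at this)
      (fun i r => by
        have := h₂ i.succ r
        rwa [Fin.val_succ, hsup] at this)
    rw [hsup]
    exact e3.comp ((e2.comp e1).comp e0)

end ChainReduction

/-! ### Regularity of the linear and quadratic entries along cycles. -/

section CycleAlgebra

/-- The kernels of the powers `f ^ n` stabilize. If `f ((f ^ n) z) = 0`, then `z` lies in the stable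
kernel, so already `(f ^ n) z = 0`. -/
theorem injective_of_surjective_ringEnd {S : Type*} [CommRing S] [IsNoetherianRing S]
    (f : S →+* S) (hf : Function.Surjective f) : Function.Injective f := by
  have hsurj : ∀ n : ℕ, Function.Surjective (f ^ n) := by
    intro n
    induction n with
    | zero => exact fun x => ⟨x, rfl⟩
    | succ k ih => rw [pow_succ]; exact ih.comp hf
  have hmono : Monotone fun n : ℕ => RingHom.ker (f ^ n) := by
    refine monotone_nat_of_le_succ fun n x hx => ?_
    rw [RingHom.mem_ker] at hx ⊢
    rw [pow_succ']
    change f ((f ^ n) x) = 0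
    rw [hx, map_zero]
  obtain ⟨n, hn⟩ := monotone_stabilizes_iff_noetherian.2 ‹IsNoetherianRing S› ⟨_, hmono⟩
  refine (injective_iff_map_eq_zero f).2 fun x hx => ?_
  obtain ⟨z, rfl⟩ := hsurj n x
  have h1 : z ∈ RingHom.ker (f ^ (n + 1)) := by
    rw [RingHom.mem_ker, pow_succ']
    exact hx
  have h2 : RingHom.ker (f ^ n) = RingHom.ker (f ^ (n + 1)) := hn (n + 1) n.le_succ
  rw [← h2] at h1
  exact h1

/-- Membership in a monomial ideal is tested monomial by monomial, and a power of `X j` does not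
affect divisibility by powers of other variables. -/
theorem mem_span_monomial_of_mul {ι : Type*} (S : Set ι) (e : ι → ℕ) (j : ι) (hj : j ∉ S)
    (k : ℕ) (p : MvPolynomial ι ℚ)
    (h : MvPolynomial.X j ^ k * p ∈
      Ideal.span ((fun i => (MvPolynomial.X i ^ e i : MvPolynomial ι ℚ)) '' S)) :
    p ∈ Ideal.span ((fun i => (MvPolynomial.X i ^ e i : MvPolynomial ι ℚ)) '' S) := by
  classical
  have hS : (fun i => (MvPolynomial.X i ^ e i : MvPolynomial ι ℚ)) '' S =
      (fun s => MvPolynomial.monomial s (1 : ℚ)) '' ((fun i => Finsupp.single i (e i)) '' S) := by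
    rw [Set.image_image]
    simp only [MvPolynomial.X_pow_eq_monomial]
  rw [hS, MvPolynomial.mem_ideal_span_monomial_image] at h ⊢
  intro m hm
  obtain ⟨_, ⟨i, hi, rfl⟩, hle⟩ := h (m + Finsupp.single j k) (by
    rw [MvPolynomial.mem_support_iff] at hm ⊢
    rwa [MvPolynomial.X_pow_eq_monomial, mul_comm, MvPolynomial.coeff_mul_monomial, mul_one])
  refine ⟨_, ⟨i, hi, rfl⟩, ?_⟩
  have hij : j ≠ i := fun h => hj (h ▸ hi)
  simp only [Finsupp.single_le_iff, Finsupp.add_apply, Finsupp.single_eq_of_ne' hij,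
    add_zero] at hle ⊢
  exact hle

variable {ι : Type*} {R : Type*} [CommRing R]

/-- Every cycle of `τ` describes a circle, and `Z i`, `Z (τ i)` are the variables before and after
the mark `i`.  The mark is the last one of its circle with respect to `ρ`. -/
def IsLastMark (τ : Equiv.Perm ι) (ρ : ι → ℕ) (i : ι) : Prop :=
  ∀ j, τ.SameCycle i j → ρ j ≤ ρ i

theorem exists_isLastMark [Finite ι] (τ : Equiv.Perm ι) (ρ : ι → ℕ) (i : ι) :
    ∃ j, τ.SameCycle i j ∧ IsLastMark τ ρ j := by
  obtain ⟨j, hj, hmax⟩ := Set.exists_max_image {j | τ.SameCycle i j} ρ (Set.toFinite _)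
    ⟨i, Equiv.Perm.SameCycle.refl _ _⟩
  exact ⟨j, hj, fun k hk => hmax k (hj.trans hk)⟩

theorem IsLastMark.eq {τ : Equiv.Perm ι} {ρ : ι → ℕ} (hρ : Function.Injective ρ) {i j : ι}
    (hi : IsLastMark τ ρ i) (hj : IsLastMark τ ρ j) (h : τ.SameCycle i j) : i = j :=
  hρ (le_antisymm (hj i h.symm) (hi j h))

/-- The differences along a cycle of which one mark is omitted. -/
theorem sub_mem_of_sameCycle [Finite ι] (τ : Equiv.Perm ι) (Z : ι → R) (G : AddSubgroup R) (i : ι)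
    (hG : ∀ k, τ.SameCycle i k → k ≠ i → Z k - Z (τ k) ∈ G) (j : ι) (hj : τ.SameCycle i j) :
    Z j - Z i ∈ G := by
  obtain ⟨n, -, hn⟩ := hj.symm.exists_pow_eq'
  induction n generalizing j with
  | zero =>
    simp only [pow_zero, Equiv.Perm.coe_one, id_eq] at hn
    rw [hn, sub_self]
    exact G.zero_mem
  | succ n ih =>
    by_cases hji : j = i
    · rw [hji, sub_self]
      exact G.zero_mem
    · have h1 := ih (τ j) (by rwa [Equiv.Perm.sameCycle_apply_right]) (by
        rwa [pow_succ, Equiv.Perm.mul_apply] at hn)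
      have h2 := G.add_mem (hG j hj hji) h1
      rwa [sub_add_sub_cancel] at h2

variable [Algebra ℚ R]

/-- A choice of one entry from each pair `{q (Z² + Z Z' + Z'²), r (Z - Z')}`, such that for each
cycle the quadratic entry is chosen exactly at the last mark. -/
structure CycleSequence (τ : Equiv.Perm ι) (ρ : ι → ℕ) (Z c : ι → R) (q r : ι → ℚ) : Prop where
  inj : Function.Injective ρ
  bij : Function.Bijective (MvPolynomial.aeval Z : MvPolynomial ι ℚ →ₐ[ℚ] R)
  q_ne : ∀ i, q i ≠ 0
  r_ne : ∀ i, r i ≠ 0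
  last : ∀ i, IsLastMark τ ρ i → c i = q i • (Z i ^ 2 + Z i * Z (τ i) + Z (τ i) ^ 2)
  not_last : ∀ i, ¬ IsLastMark τ ρ i → c i = r i • (Z i - Z (τ i))

namespace CycleSequence

variable {τ : Equiv.Perm ι} {ρ : ι → ℕ} {Z c : ι → R} {q r : ι → ℚ}

theorem sub_succ_mem (h : CycleSequence τ ρ Z c q r) {I : Ideal R} {i : ι}
    (hi : ¬ IsLastMark τ ρ i) (hc : c i ∈ I) : Z i - Z (τ i) ∈ I := by
  have h1 : Z i - Z (τ i) = algebraMap ℚ R (r i)⁻¹ * c i := by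
    rw [h.not_last i hi, ← Algebra.smul_def, smul_smul, inv_mul_cancel₀ (h.r_ne i), one_smul]
  rw [h1]
  exact I.mul_mem_left _ hc

variable [Finite ι]

theorem sub_last_mem (h : CycleSequence τ ρ Z c q r) {I : Ideal R} {i : ι}
    (hi : IsLastMark τ ρ i) (hI : ∀ j, ρ j < ρ i → c j ∈ I) {j : ι} (hj : τ.SameCycle i j) :
    Z j - Z i ∈ I := by
  refine sub_mem_of_sameCycle τ Z I.toAddSubgroup i (fun k hk hki => ?_) j hj
  have hlt : ρ k < ρ i := lt_of_le_of_ne (hi k hk) fun he => hki (h.inj he)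
  exact h.sub_succ_mem (fun hl => hlt.not_ge (hl i hk.symm)) (hI k hlt)

/-- All other marks of the circle come earlier, so modulo their entries the two variables at the
last mark agree and the quadratic form becomes three times a square. -/
theorem last_sub_mem (h : CycleSequence τ ρ Z c q r) {I : Ideal R} {i : ι}
    (hi : IsLastMark τ ρ i) (hI : ∀ j, ρ j < ρ i → c j ∈ I) :
    c i - (3 * q i) • Z i ^ 2 ∈ I := by
  have h1 := h.sub_last_mem hi hI (j := τ i) (Equiv.Perm.sameCycle_apply_right.2 (Equiv.Perm.SameCycle.refl _ _))
  -- The multiplier comes from `Z² + ZZ' + Z'² - 3Z² = (Z' - Z)(Z' + 2Z)`.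
  have h2 := I.mul_mem_left (algebraMap ℚ R (q i) * (Z (τ i) + 2 * Z i)) h1
  convert h2 using 1
  rw [h.last i hi, Algebra.smul_def, Algebra.smul_def, map_mul, map_ofNat]
  ring

theorem sq_mem (h : CycleSequence τ ρ Z c q r) {I : Ideal R} {i : ι}
    (hi : IsLastMark τ ρ i) (hI : ∀ j, ρ j ≤ ρ i → c j ∈ I) : Z i ^ 2 ∈ I := by
  have h1 := I.sub_mem (hI i le_rfl) (h.last_sub_mem hi fun j hj => hI j hj.le)
  rw [sub_sub_cancel] at h1
  have h2 := I.mul_mem_left (algebraMap ℚ R (3 * q i)⁻¹) h1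
  have h3 : 3 * q i ≠ 0 := mul_ne_zero (by norm_num) (h.q_ne i)
  rwa [← Algebra.smul_def, smul_smul, inv_mul_cancel₀ h3, one_smul] at h2

open Classical in
/-- New coordinates. -/
noncomputable def coord (τ : Equiv.Perm ι) (ρ : ι → ℕ) (Z : ι → R) (i : ι) : R :=
  if IsLastMark τ ρ i then Z i else Z i - Z (τ i)

/-- Telescoping along each cycle, starting from its last mark, recovers every `Z j`, which gives
surjectivity. Composition with the inverse of `aeval Z` gives a surjective endomorphism of a
Noetherian ring, hence an injective one. -/
theorem coord_bijective (h : CycleSequence τ ρ Z c q r) :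
    Function.Bijective (MvPolynomial.aeval (coord τ ρ Z) : MvPolynomial ι ℚ →ₐ[ℚ] R) := by
  have hsurj : Function.Surjective
      (MvPolynomial.aeval (coord τ ρ Z) : MvPolynomial ι ℚ →ₐ[ℚ] R) := by
    rw [← AlgHom.range_eq_top, eq_top_iff]
    set G := (MvPolynomial.aeval (coord τ ρ Z) : MvPolynomial ι ℚ →ₐ[ℚ] R).range
    have hy : ∀ i, coord τ ρ Z i ∈ G := fun i => ⟨MvPolynomial.X i, by simp⟩
    have hZ : ∀ j, Z j ∈ G := by
      intro j
      obtain ⟨i, hji, hi⟩ := exists_isLastMark τ ρ j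
      have h1 := hy i
      rw [coord, if_pos hi] at h1
      have h2 := sub_mem_of_sameCycle τ Z G.toSubmodule.toAddSubgroup i (fun k hk hki => by
        have h3 := hy k
        rw [coord, if_neg (fun hk' => hki (hk'.eq h.inj hi hk.symm))] at h3
        exact h3) j hji.symm
      have := G.add_mem h2 h1
      rwa [sub_add_cancel] at this
    intro x _
    obtain ⟨p, rfl⟩ := h.bij.2 x
    rw [MvPolynomial.aeval_def]
    induction p using MvPolynomial.induction_on with
    | C a => simp
    | add p p' hp hp' => rw [MvPolynomial.eval₂_add]; exact G.add_mem (hp trivial) (hp' trivial)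
    | mul_X p i hp => rw [MvPolynomial.eval₂_mul, MvPolynomial.eval₂_X]
                      exact G.mul_mem (hp trivial) (hZ i)
  refine ⟨?_, hsurj⟩
  let e := AlgEquiv.ofBijective _ h.bij
  have h1 := injective_of_surjective_ringEnd
    ((e.symm : R →ₐ[ℚ] MvPolynomial ι ℚ).comp
      (MvPolynomial.aeval (coord τ ρ Z))).toRingHom (e.symm.surjective.comp hsurj)
  exact Function.Injective.of_comp (f := e.symm) h1

open Classical in
/-- The exponents of the new coordinates. -/
noncomputable def expo (τ : Equiv.Perm ι) (ρ : ι → ℕ) (i : ι) : ℕ :=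
  if IsLastMark τ ρ i then 2 else 1

/-- An initial segment which contains a last mark contains its whole circle. There the linear
entries identify the variables, so the quadratic entry may be exchanged for the square of one
coordinate. In the new coordinates the ideal is thus generated by powers of variables. -/
theorem span_eq (h : CycleSequence τ ρ Z c q r) (k : ℕ) :
    Ideal.span (c '' {i | ρ i < k}) =
      Ideal.span ((fun i => coord τ ρ Z i ^ expo τ ρ i) '' {i | ρ i < k}) := by
  apply le_antisymm
  · rw [Ideal.span_le]
    rintro _ ⟨i, hi, rfl⟩
    set I := Ideal.span ((fun i => coord τ ρ Z i ^ expo τ ρ i) '' {i | ρ i < k})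
    have hnot : ∀ j, ρ j < k → ¬ IsLastMark τ ρ j → c j ∈ I := by
      intro j hj hl
      have h1 : coord τ ρ Z j ^ expo τ ρ j ∈ I := Ideal.subset_span ⟨j, hj, rfl⟩
      rw [coord, expo, if_neg hl, if_neg hl, pow_one] at h1
      rw [h.not_last j hl, Algebra.smul_def]
      exact I.mul_mem_left _ h1
    by_cases hl : IsLastMark τ ρ i
    · have h1 : coord τ ρ Z i ^ expo τ ρ i ∈ I := Ideal.subset_span ⟨i, hi, rfl⟩
      rw [coord, expo, if_pos hl, if_pos hl] at h1
      have h2 : Z (τ i) - Z i ∈ I := by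
        refine sub_mem_of_sameCycle τ Z I.toAddSubgroup i (fun j hj hji => ?_) _
          (Equiv.Perm.sameCycle_apply_right.2 (Equiv.Perm.SameCycle.refl _ _))
        exact h.sub_succ_mem (fun hl' => hji (hl'.eq h.inj hl hj.symm))
          (hnot j (lt_of_le_of_lt (hl j hj) hi) fun hl' => hji (hl'.eq h.inj hl hj.symm))
      have h3 := I.add_mem (I.mul_mem_left (algebraMap ℚ R (q i) * (Z (τ i) + 2 * Z i)) h2)
        (I.mul_mem_left (algebraMap ℚ R (q i) * 3) h1)
      rw [SetLike.mem_coe]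
      convert h3 using 1
      rw [h.last i hl, Algebra.smul_def]
      ring
    · exact hnot i hi hl
  · rw [Ideal.span_le]
    rintro _ ⟨i, hi, rfl⟩
    set I := Ideal.span (c '' {i | ρ i < k})
    have hc : ∀ j, ρ j < k → c j ∈ I := fun j hj => Ideal.subset_span ⟨j, hj, rfl⟩
    simp only [SetLike.mem_coe, coord, expo]
    split_ifs with hl
    · exact h.sq_mem hl fun j hj => hc j (lt_of_le_of_lt hj hi)
    · rw [pow_one]
      exact h.sub_succ_mem hl (hc i hi)

theorem mem_of_coord_pow_mul (h : CycleSequence τ ρ Z c q r) (i : ι) (k : ℕ) (a : R)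
    (ha : coord τ ρ Z i ^ k * a ∈ Ideal.span (c '' {j | ρ j < ρ i})) :
    a ∈ Ideal.span (c '' {j | ρ j < ρ i}) := by
  let e := AlgEquiv.ofBijective _ h.coord_bijective
  have he : ∀ j, e (MvPolynomial.X j) = coord τ ρ Z j := fun j => by
    simp [e]
  have hI : Ideal.span (c '' {j | ρ j < ρ i}) = Ideal.map (e : MvPolynomial ι ℚ →+* R)
      (Ideal.span ((fun i => (MvPolynomial.X i ^ expo τ ρ i : MvPolynomial ι ℚ)) ''
        {j | ρ j < ρ i})) := by
    rw [h.span_eq, Ideal.map_span, Set.image_image]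
    congr 2
    funext j
    rw [RingHom.coe_coe, map_pow, he]
  have hmem : ∀ p : MvPolynomial ι ℚ, e p ∈ Ideal.span (c '' {j | ρ j < ρ i}) ↔
      p ∈ Ideal.span ((fun i => (MvPolynomial.X i ^ expo τ ρ i : MvPolynomial ι ℚ)) ''
        {j | ρ j < ρ i}) := by
    intro p
    rw [hI]
    constructor
    · intro hp
      obtain ⟨p', hp', hpp⟩ := (Ideal.mem_map_iff_of_surjective _ e.surjective).1 hp
      rwa [← e.injective hpp]
    · exact fun hp => Ideal.mem_map_of_mem _ hp
  obtain ⟨p, rfl⟩ := e.surjective a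
  have h1 : e (MvPolynomial.X i ^ k * p) ∈ Ideal.span (c '' {j | ρ j < ρ i}) := by
    rw [map_mul, map_pow, he]
    exact ha
  rw [hmem] at h1
  rw [hmem]
  exact mem_span_monomial_of_mul _ _ i (by simp) k p h1

/-- Modulo the earlier entries, `c i` is a nonzero rational multiple of a power of the coordinate at
`i`, while their ideal is generated by powers of other coordinates. -/
theorem regular (h : CycleSequence τ ρ Z c q r) (i : ι) (a : R)
    (ha : c i * a ∈ Ideal.span (c '' {j | ρ j < ρ i})) :
    a ∈ Ideal.span (c '' {j | ρ j < ρ i}) := by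
  set I := Ideal.span (c '' {j | ρ j < ρ i}) with hI
  by_cases hl : IsLastMark τ ρ i
  · refine h.mem_of_coord_pow_mul i 2 a ?_
    rw [coord, if_pos hl, ← hI]
    have h1 := I.mul_mem_left a (h.last_sub_mem hl (I := I) fun j hj =>
      Ideal.subset_span ⟨j, hj, rfl⟩)
    have h2 := I.mul_mem_left (algebraMap ℚ R (3 * q i)⁻¹) (I.sub_mem ha h1)
    have h3 : algebraMap ℚ R (3 * q i)⁻¹ * algebraMap ℚ R (3 * q i) = 1 := by
      rw [← map_mul, inv_mul_cancel₀ (mul_ne_zero (by norm_num) (h.q_ne i)), map_one]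
    convert h2 using 1
    rw [Algebra.smul_def]
    linear_combination -(Z i ^ 2 * a) * h3
  · refine h.mem_of_coord_pow_mul i 1 a ?_
    rw [coord, if_neg hl, ← hI, pow_one]
    have h2 := I.mul_mem_left (algebraMap ℚ R (r i)⁻¹) ha
    have h3 : algebraMap ℚ R (r i)⁻¹ * algebraMap ℚ R (r i) = 1 := by
      rw [← map_mul, inv_mul_cancel₀ (h.r_ne i), map_one]
    convert h2 using 1
    rw [h.not_last i hl, Algebra.smul_def]
    linear_combination -((Z i - Z (τ i)) * a) * h3

theorem sub_mem_span (h : CycleSequence τ ρ Z c q r) {i j : ι} (hij : τ.SameCycle i j) :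
    Z i - Z j ∈ Ideal.span (Set.range c) := by
  obtain ⟨k, hk, hl⟩ := exists_isLastMark τ ρ i
  set I := Ideal.span (Set.range c)
  have hI : ∀ j, ρ j < ρ k → c j ∈ I := fun j _ => Ideal.subset_span ⟨j, rfl⟩
  have := I.sub_mem (h.sub_last_mem hl hI hk.symm) (h.sub_last_mem hl hI (hk.symm.trans hij))
  rwa [sub_sub_sub_cancel_right] at this

theorem sq_mem_span (h : CycleSequence τ ρ Z c q r) (i : ι) :
    Z i ^ 2 ∈ Ideal.span (Set.range c) := by
  obtain ⟨k, hk, hl⟩ := exists_isLastMark τ ρ i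
  set I := Ideal.span (Set.range c)
  have h1 := h.sq_mem hl (I := I) fun j _ => Ideal.subset_span ⟨j, rfl⟩
  have h2 := I.add_mem (I.mul_mem_left (Z i + Z k) (h.sub_mem_span hk)) h1
  convert h2 using 1
  ring

end CycleSequence
end CycleAlgebra

/-! ### Local models: two arcs, or a wide edge in split form. -/

section LocalModels

variable {S : Type*} [CommRing S] (x₁ x₂ x₃ x₄ : S)

theorem diffMat_odd (w : Bool) (u v : Fin 2 × Fin 2) (h : u.1 = v.1) :
    diffMat x₁ x₂ x₃ x₄ w u v = 0 := by
  simp [diffMat, h]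

theorem diffMat_false_eq_stdMat : diffMat x₁ x₂ x₃ x₄ false =
    stdMat (piPoly x₁ x₄) (x₁ - x₄) (piPoly x₂ x₃) (x₂ - x₃) := by
  ext ⟨p, i⟩ ⟨q, j⟩
  simp only [diffMat, stdMat, diffArcs, stdDiff, neg_sub, Bool.false_eq_true, if_false]

/-- The tensor product of the factorizations at two unmarked arcs, with the choices `x`, `y`. -/
def arcsFactorization (x y : Bool) : LocalFactorization S where
  A := diffMat x₁ x₂ x₃ x₄ false
  α₁ := piPoly x₁ x₄
  β₁ := x₁ - x₄
  α₂ := piPoly x₂ x₃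
  β₂ := x₂ - x₃
  P := 1
  Q := 1
  x := x
  y := y
  odd := diffMat_odd x₁ x₂ x₃ x₄ false
  sq := by
    rw [diffMat_mul_diffMat]
    congr 1
    unfold piPoly
    ring
  mul_inv := one_mul 1
  inv_mul := one_mul 1
  even u v h := Matrix.one_apply_ne fun h' => h (congrArg Prod.fst h')
  intertwine := by rw [one_mul, mul_one, diffMat_false_eq_stdMat]

/-- Block diagonal unipotent matrices. -/
def shear (a b : S) : Matrix (Fin 2 × Fin 2) (Fin 2 × Fin 2) S := fun u v =>
  if u.1 = v.1 then (![!![1, a; 0, 1], !![1, b; 0, 1]] u.1) u.2 v.2 else 0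

theorem shear_mul_shear (a b : S) : shear a b * shear (-a) (-b) = 1 := by
  ext ⟨p, i⟩ ⟨q, j⟩
  simp only [Matrix.mul_apply, Fintype.sum_prod_type, Fin.sum_univ_two]
  fin_cases p <;> fin_cases q <;> fin_cases i <;> fin_cases j <;>
    simp [shear]

/-- This is where a wide edge becomes a smoothing. The first pair is `{π(x₁,-x₂), x₁ - (-x₂)}`,
since `(x₁+x₂)² - 3x₁x₂ = x₁² - x₁x₂ + x₂²`. The second is the analogous pair for `x₃` and `-x₄`
with entries exchanged and rescaled by `-3` and `t = 1/3`. -/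
theorem shear_mul_diffMat (t : S) (ht : 3 * t = 1) :
    shear (-t) (t * (x₁ + x₂ + x₃ + x₄)) * diffMat x₁ x₂ x₃ x₄ true =
      stdMat ((x₁ + x₂) ^ 2 - 3 * (x₁ * x₂)) (x₁ + x₂) (-3 * (x₃ + x₄))
        (t * ((x₃ + x₄) ^ 2 - 3 * (x₃ * x₄))) * shear (-t) (t * (x₁ + x₂ + x₃ + x₄)) := by
  ext ⟨p, i⟩ ⟨q, j⟩
  simp only [Matrix.mul_apply, Fintype.sum_prod_type, Fin.sum_univ_two]
  fin_cases p <;> fin_cases q <;> fin_cases i <;> fin_cases j <;>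
    simp [shear, stdMat, stdDiff, diffMat, diffWide, u₁, u₂] <;> grind

/-- The factorization of a wide edge, with the choices `x`, `y`. -/
def wideFactorization (t : S) (ht : 3 * t = 1) (x y : Bool) : LocalFactorization S where
  A := diffMat x₁ x₂ x₃ x₄ true
  α₁ := (x₁ + x₂) ^ 2 - 3 * (x₁ * x₂)
  β₁ := x₁ + x₂
  α₂ := -3 * (x₃ + x₄)
  β₂ := t * ((x₃ + x₄) ^ 2 - 3 * (x₃ * x₄))
  P := shear (-t) (t * (x₁ + x₂ + x₃ + x₄))
  Q := shear t (-(t * (x₁ + x₂ + x₃ + x₄)))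
  x := x
  y := y
  odd := diffMat_odd x₁ x₂ x₃ x₄ true
  sq := by
    rw [diffMat_mul_diffMat]
    congr 1
    linear_combination ((x₃ + x₄) * ((x₃ + x₄) ^ 2 - 3 * (x₃ * x₄))) * ht
  mul_inv := by
    have := shear_mul_shear (-t) (t * (x₁ + x₂ + x₃ + x₄))
    rwa [neg_neg] at this
  inv_mul := by
    have := shear_mul_shear t (-(t * (x₁ + x₂ + x₃ + x₄)))
    rwa [neg_neg] at this
  even u v h := if_neg h
  intertwine := shear_mul_diffMat x₁ x₂ x₃ x₄ t ht

end LocalModels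

/-! ### Circles of a smoothing as cycles of a permutation of the arcs. -/

namespace Shadow

variable (Γ : Shadow)

/-- A colouring of the edges such that oriented smoothings join edges of equal colours and the
other smoothings join edges of different colours. -/
def IsColoring (σ : Γ.Edge → Bool) : Prop := ∀ c,
  σ (Γ.incoming c false) = σ (c, false) ∧ σ (c, true) = !σ (c, false) ∧
    σ (Γ.incoming c true) = !σ (c, false)

variable {Γ}

theorem IsColoring.not {σ : Γ.Edge → Bool} (h : Γ.IsColoring σ) :
    Γ.IsColoring fun e => !σ e := fun c => by
  obtain ⟨h1, h2, h3⟩ := h c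
  simp [h1, h2, h3]

/-- If all edges of colour `false` are reversed, then each smoothing consists of oriented
circles.  The arcs at `c` are named `(c, false)` and `(c, true)`; this is the edge at the
beginning of an arc. -/
def source (σ : Γ.Edge → Bool) (s : Γ.State) (p : Fin Γ.n × Bool) : Γ.Edge :=
  if σ (p.1, false) then
    (if xor p.2 (s p.1) then (p.1, true) else Γ.incoming p.1 false)
  else if p.2 then Γ.incoming p.1 true else (p.1, false)

/-- The edge at the end of an arc. -/
def target (σ : Γ.Edge → Bool) (s : Γ.State) (p : Fin Γ.n × Bool) : Γ.Edge :=
  source (fun e => !σ e) s p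

theorem next_incoming (c : Fin Γ.n) (b : Bool) : Γ.next (Γ.incoming c b) = (c, b) := by
  simp [incoming]

theorem source_injective {σ : Γ.Edge → Bool} (h : Γ.IsColoring σ) (s : Γ.State) :
    Function.Injective (source σ s) := by
  -- The inverse finds the arc which begins at `e`: an edge of colour `true` is followed to the
  -- vertex where it terminates, and a reversed edge to the vertex where it starts.
  refine Function.LeftInverse.injective (g := fun e =>
    if σ e then ((Γ.next e).1, if σ ((Γ.next e).1, false) then s (Γ.next e).1 else true)
    else (e.1, if σ (e.1, false) then !s e.1 else false)) ?_
  rintro ⟨c, b⟩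
  obtain ⟨h1, h2, h3⟩ := h c
  cases hk : σ (c, false) <;> cases b <;> cases hs : s c <;>
    simp [source, hk, hs, h1, h2, h3, next_incoming]

theorem source_bijective {σ : Γ.Edge → Bool} (h : Γ.IsColoring σ) (s : Γ.State) :
    Function.Bijective (source σ s) :=
  Finite.injective_iff_bijective.1 (source_injective h s)

/-- The permutation of the arcs which passes to the next arc of the circle. -/
noncomputable def nextArc {σ : Γ.Edge → Bool} (h : Γ.IsColoring σ) (s : Γ.State) :
    Equiv.Perm (Fin Γ.n × Bool) :=
  (Equiv.ofBijective _ (source_bijective h.not s)).trans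
    (Equiv.ofBijective _ (source_bijective h s)).symm

theorem source_nextArc {σ : Γ.Edge → Bool} (h : Γ.IsColoring σ) (s : Γ.State)
    (p : Fin Γ.n × Bool) : source σ s (nextArc h s p) = target σ s p :=
  Equiv.ofBijective_apply_symm_apply _ (source_bijective h s) _

theorem mk_source_eq_mk_target (σ : Γ.Edge → Bool) (s : Γ.State) (p : Fin Γ.n × Bool) :
    (Quot.mk (Γ.Joined s) (source σ s p)) = Quot.mk (Γ.Joined s) (target σ s p) := by
  have h1 : s p.1 = false → ∀ b, Quot.mk (Γ.Joined s) (Γ.incoming p.1 b) =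
      Quot.mk (Γ.Joined s) (p.1, b) := fun h b =>
    Quot.sound ⟨p.1, Or.inl ⟨h, b, rfl, rfl⟩⟩
  have h2 : s p.1 = true → Quot.mk (Γ.Joined s) (p.1, false) = Quot.mk (Γ.Joined s) (p.1, true) :=
    fun h => Quot.sound ⟨p.1, Or.inr ⟨h, Or.inl ⟨rfl, rfl⟩⟩⟩
  have h3 : s p.1 = true → Quot.mk (Γ.Joined s) (Γ.incoming p.1 false) =
      Quot.mk (Γ.Joined s) (Γ.incoming p.1 true) :=
    fun h => Quot.sound ⟨p.1, Or.inr ⟨h, Or.inr ⟨rfl, rfl⟩⟩⟩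
  obtain ⟨c, b⟩ := p
  cases hk : σ (c, false) <;> cases b <;> cases hs : s c <;>
    simp_all [source, target]

/-- Each generating identification of edges joins the two ends of one arc, and `nextArc` passes to
the arc beginning where the previous one ends. So the classes of edges are exactly the cycles. -/
theorem mk_source_eq_iff {σ : Γ.Edge → Bool} (h : Γ.IsColoring σ) (s : Γ.State)
    (p q : Fin Γ.n × Bool) :
    Quot.mk (Γ.Joined s) (source σ s p) = Quot.mk (Γ.Joined s) (source σ s q) ↔
      (nextArc h s).SameCycle p q := by
  constructor
  · intro hpq
    let e := Equiv.ofBijective _ (source_bijective h s)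
    have hst : ∀ p : Fin Γ.n × Bool, (nextArc h s).SameCycle (e.symm (source σ s p))
        (e.symm (target σ s p)) := by
      intro p
      rw [← source_nextArc h]
      change (nextArc h s).SameCycle (e.symm (e p)) (e.symm (e _))
      rw [e.symm_apply_apply, e.symm_apply_apply, Equiv.Perm.sameCycle_apply_right]
    have hlift : ∀ a b, Γ.Joined s a b →
        (Quotient.mk (Equiv.Perm.SameCycle.setoid (nextArc h s)) (e.symm a)) =
          Quotient.mk _ (e.symm b) := by
      rintro a b ⟨c, hc⟩
      apply Quotient.sound
      change (nextArc h s).SameCycle _ _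
      have hf := hst (c, false)
      have ht := hst (c, true)
      rcases hc with ⟨hs, b', rfl, rfl⟩ | ⟨hs, ⟨rfl, rfl⟩ | ⟨rfl, rfl⟩⟩
      · cases hk : σ (c, false) <;> cases b' <;> simp [source, target, hs, hk] at hf ht
        exacts [hf.symm, ht, hf, ht.symm]
      · cases hk : σ (c, false) <;> simp [source, target, hs, hk] at hf ht
        exacts [hf, hf.symm]
      · cases hk : σ (c, false) <;> simp [source, target, hs, hk] at hf ht
        exacts [ht.symm, ht]
    have := congrArg (Quot.lift _ hlift) hpq
    have h2 : (nextArc h s).SameCycle (e.symm (e p)) (e.symm (e q)) := Quotient.exact this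
    rwa [e.symm_apply_apply, e.symm_apply_apply] at h2
  · intro hpq
    obtain ⟨i, -, hi⟩ := hpq.exists_pow_eq'
    induction i generalizing p with
    | zero => rw [show p = q from hi]
    | succ i ih =>
      rw [mk_source_eq_mk_target, ← source_nextArc h]
      refine ih _ (by rwa [Equiv.Perm.sameCycle_apply_left]) ?_
      rwa [pow_succ, Equiv.Perm.mul_apply] at hi

end Shadow
-- Elimination for a closed graph.
namespace Shadow

variable {Γ : Shadow}

/-- The sign of a colour. -/
def colorSign (σ : Γ.Edge → Bool) (e : Γ.Edge) : ℚ := if σ e then 1 else -1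

theorem colorSign_mul_self (σ : Γ.Edge → Bool) (e : Γ.Edge) :
    colorSign σ e * colorSign σ e = 1 := by
  unfold colorSign
  split_ifs <;> norm_num

/-- The variable of an edge with the sign of its colour. -/
noncomputable def signedX (σ : Γ.Edge → Bool) (e : Γ.Edge) : Γ.Ring :=
  MvPolynomial.C (colorSign σ e) * MvPolynomial.X e

theorem signedX_bijective (σ : Γ.Edge → Bool) :
    Function.Bijective (MvPolynomial.aeval (signedX σ) : Γ.Ring →ₐ[ℚ] Γ.Ring) := by
  refine Function.Involutive.bijective fun p => ?_
  have : (MvPolynomial.aeval (signedX σ) : Γ.Ring →ₐ[ℚ] Γ.Ring).comp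
      (MvPolynomial.aeval (signedX σ)) = AlgHom.id ℚ Γ.Ring := by
    refine MvPolynomial.algHom_ext fun e => ?_
    simp only [AlgHom.comp_apply, MvPolynomial.aeval_X, signedX, map_mul, AlgHom.id_apply,
      MvPolynomial.algHom_C, MvPolynomial.algebraMap_eq]
    rw [← mul_assoc, ← map_mul, colorSign_mul_self, map_one, one_mul]
  exact AlgHom.congr_fun this p

theorem aeval_signedX_source_bijective {σ : Γ.Edge → Bool} (h : Γ.IsColoring σ) (s : Γ.State) :
    Function.Bijective (MvPolynomial.aeval (fun p => signedX σ (source σ s p)) :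
      Γ.Ring →ₐ[ℚ] Γ.Ring) := by
  have h1 := (signedX_bijective σ).comp
    (MvPolynomial.renameEquiv ℚ (Equiv.ofBijective _ (source_bijective h s))).bijective
  convert h1 using 1
  funext p
  exact (MvPolynomial.aeval_rename (source σ s) (signedX σ) p).symm

/-- The order in which the arcs are processed. -/
def arcRank (p : Fin Γ.n × Bool) : ℕ := 2 * p.1 + if p.2 then 1 else 0

theorem arcRank_injective : Function.Injective (arcRank (Γ := Γ)) := by
  rintro ⟨c, b⟩ ⟨c', b'⟩ h
  cases b <;> cases b' <;> simp [arcRank] at h ⊢ <;> omega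

open Classical in
/-- Whether an arc is the last one of its circle. -/
noncomputable def lastArc {σ : Γ.Edge → Bool} (h : Γ.IsColoring σ) (s : Γ.State)
    (p : Fin Γ.n × Bool) : Bool :=
  decide (IsLastMark (nextArc h s) arcRank p)

/-- The factorization at a vertex.  For the last arc of each circle the quadratic entry is
chosen, for all other arcs the linear one. -/
noncomputable def localData {σ : Γ.Edge → Bool} (h : Γ.IsColoring σ) (s : Γ.State)
    (c : Fin Γ.n) : LocalFactorization Γ.Ring :=
  if s c then
    wideFactorization (MvPolynomial.X (c, false)) (MvPolynomial.X (c, true))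
      (MvPolynomial.X (Γ.incoming c true)) (MvPolynomial.X (Γ.incoming c false))
      (MvPolynomial.C 3⁻¹) (by
        rw [← map_ofNat (MvPolynomial.C : ℚ →+* Γ.Ring) 3, ← map_mul]; norm_num)
      (lastArc h s (c, false)) (!lastArc h s (c, true))
  else
    arcsFactorization (MvPolynomial.X (c, false)) (MvPolynomial.X (c, true))
      (MvPolynomial.X (Γ.incoming c true)) (MvPolynomial.X (Γ.incoming c false))
      (lastArc h s (c, false)) (lastArc h s (c, true))

theorem localData_A {σ : Γ.Edge → Bool} (h : Γ.IsColoring σ) (s : Γ.State) (c : Fin Γ.n) :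
    (localData h s c).A = Γ.atVertex c fun x₁ x₂ x₃ x₄ => diffMat x₁ x₂ x₃ x₄ (s c) := by
  cases hs : s c <;> simp [localData, hs, atVertex, arcsFactorization, wideFactorization]

theorem localData_potential {σ : Γ.Edge → Bool} (h : Γ.IsColoring σ) (s : Γ.State)
    (c : Fin Γ.n) : (localData h s c).potential =
      MvPolynomial.X (c, false) ^ 3 + MvPolynomial.X (c, true) ^ 3 -
        (MvPolynomial.X (Γ.incoming c false) ^ 3 + MvPolynomial.X (Γ.incoming c true) ^ 3) := by
  have h3 : (3 : Γ.Ring) * MvPolynomial.C 3⁻¹ = 1 := by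
    rw [← map_ofNat (MvPolynomial.C : ℚ →+* Γ.Ring) 3, ← map_mul]; norm_num
  cases hs : s c
  · simp only [localData, hs, arcsFactorization, LocalFactorization.potential, piPoly,
      Bool.false_eq_true, if_false]
    ring
  · simp only [localData, hs, wideFactorization, LocalFactorization.potential, if_true]
    linear_combination (-(MvPolynomial.X (Γ.incoming c true) + MvPolynomial.X (Γ.incoming c false))
      * ((MvPolynomial.X (Γ.incoming c true) + MvPolynomial.X (Γ.incoming c false)) ^ 2
        - 3 * (MvPolynomial.X (Γ.incoming c true) * MvPolynomial.X (Γ.incoming c false)))) * h3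

/-- Each edge leaves one vertex and enters one vertex, so its cube occurs once with each sign. -/
theorem sum_potential {σ : Γ.Edge → Bool} (h : Γ.IsColoring σ) (s : Γ.State) :
    ∑ c, (localData h s c).potential = 0 := by
  simp only [localData_potential, Finset.sum_sub_distrib]
  have h1 : ∀ F : Γ.Edge → Γ.Ring, ∑ c, (F (c, false) + F (c, true)) = ∑ e, F e := by
    intro F
    rw [Fintype.sum_prod_type]
    simp [add_comm]
  have h2 := h1 fun e => MvPolynomial.X (Γ.next.symm e) ^ 3
  rw [Equiv.sum_comp Γ.next.symm fun e => (MvPolynomial.X e ^ 3 : Γ.Ring)] at h2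
  rw [h1 fun e => MvPolynomial.X e ^ 3, sub_eq_zero]
  exact h2.symm

/-- The entry chosen for an arc. -/
noncomputable def chosen {σ : Γ.Edge → Bool} (h : Γ.IsColoring σ) (s : Γ.State)
    (p : Fin Γ.n × Bool) : Γ.Ring :=
  if p.2 then (localData h s p.1).c₂ else (localData h s p.1).c₁

/-- The scalars `3⁻¹` and `-3` belong to the second arc of a wide edge, where the pair was rescaled.
Elsewhere the quadratic scalar is `1`, and `-1` is the sign between the linear entry and the signed
difference along the orientation of the circle. -/
theorem cycleSequence {σ : Γ.Edge → Bool} (h : Γ.IsColoring σ) (s : Γ.State) :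
    CycleSequence (nextArc h s) arcRank (fun p => signedX σ (source σ s p)) (chosen h s)
      (fun p => if p.2 && s p.1 then 3⁻¹ else 1) (fun p => if p.2 && s p.1 then -3 else -1) where
  inj := arcRank_injective
  bij := aeval_signedX_source_bijective h s
  q_ne p := by split_ifs <;> norm_num
  r_ne p := by split_ifs <;> norm_num
  last p hp := by
    have hp' : lastArc h s p = true := by simpa [lastArc] using hp
    rw [source_nextArc]
    obtain ⟨c, b⟩ := p
    obtain ⟨h1, h2, h3⟩ := h c
    cases hk : σ (c, false) <;> cases b <;> cases hs : s c <;>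
      simp [source, target, hs, hk, chosen, localData, LocalFactorization.c₁,
        LocalFactorization.c₂, arcsFactorization, wideFactorization, hp', signedX, colorSign,
        h1, h2, h3, piPoly, MvPolynomial.smul_eq_C_mul] <;> ring
  not_last p hp := by
    have hp' : lastArc h s p = false := by simpa [lastArc] using hp
    rw [source_nextArc]
    obtain ⟨c, b⟩ := p
    obtain ⟨h1, h2, h3⟩ := h c
    have h4 : (MvPolynomial.C 3 : Γ.Ring) = 3 := map_ofNat MvPolynomial.C 3
    cases hk : σ (c, false) <;> cases b <;> cases hs : s c <;>
      simp [source, target, hs, hk, chosen, localData, LocalFactorization.c₁,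
        LocalFactorization.c₂, arcsFactorization, wideFactorization, hp', signedX, colorSign,
        h1, h2, h3, MvPolynomial.smul_eq_C_mul, h4] <;> ring

theorem before_localData {σ : Γ.Edge → Bool} (h : Γ.IsColoring σ) (s : Γ.State) (k : ℕ) :
    before (localData h s) k = Ideal.span (chosen h s '' {p | arcRank p < 2 * k}) := by
  rw [before]
  congr 1
  ext r
  simp only [Set.mem_ofPred_eq, Set.mem_image, Prod.exists, Bool.exists_bool, chosen, arcRank]
  constructor
  · rintro ⟨i, hi, rfl | rfl⟩
    · exact ⟨i, Or.inl ⟨by simp; omega, by simp⟩⟩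
    · exact ⟨i, Or.inr ⟨by simp; omega, by simp⟩⟩
  · rintro ⟨i, ⟨hi, rfl⟩ | ⟨hi, rfl⟩⟩
    · exact ⟨i, by simp at hi; omega, by simp⟩
    · exact ⟨i, by simp at hi; omega, by simp⟩

/-- The tensor product of the factorizations at all vertices. -/
abbrev CoreChain (Γ : Shadow) : Type := (Fin Γ.n → Fin 2 × Fin 2) → Γ.Ring

variable (Γ) in
/-- The differential of the tensor product of the factorizations at all vertices. -/
noncomputable def coreD (s : Γ.State) : Γ.CoreChain →ₗ[Γ.Ring] Γ.CoreChain :=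
  chainD fun c => Γ.atVertex c fun x₁ x₂ x₃ x₄ => diffMat x₁ x₂ x₃ x₄ (s c)

/-- The ideal generated by the chosen entries. -/
noncomputable def chosenIdeal {σ : Γ.Edge → Bool} (h : Γ.IsColoring σ) (s : Γ.State) :
    Ideal Γ.Ring := Ideal.span (Set.range (chosen h s))

theorem reduces_coreD {σ : Γ.Edge → Bool} (h : Γ.IsColoring σ) (s : Γ.State) :
    Reduces (Γ.coreD s) (valued _ ⊥) (0 : Γ.Ring →ₗ[Γ.Ring] Γ.Ring) (chosenIdeal h s)
      (eps Γ.n (localData h s)) := by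
  have h1 := reduces_chainD Γ.n (localData h s) ⊥ (by rw [sum_potential]; exact zero_mem _)
    (fun i r => by
      rw [bot_sup_eq, before_localData]
      have := (cycleSequence h s).regular (i, false) r
      simpa [arcRank, chosen] using this)
    (fun i r => by
      -- When the second pair at vertex `i` is treated, the only addition to the earlier vertices is
      -- the arc `(i, false)`, of rank `2 * i`.
      have h2 : (⊥ ⊔ before (localData h s) i ⊔ Ideal.span {(localData h s i).c₁} :
          Ideal Γ.Ring) = Ideal.span (chosen h s '' {p | arcRank p < 2 * i + 1}) := by
        rw [bot_sup_eq, before_localData, ← Ideal.span_union]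
        congr 1
        have : {p : Fin Γ.n × Bool | arcRank p < 2 * (i : ℕ) + 1} =
            {p | arcRank p < 2 * (i : ℕ)} ∪ {(i, false)} := by
          ext p
          have h3 : arcRank p = 2 * (i : ℕ) ↔ p = (i, false) := by
            rw [← arcRank_injective.eq_iff]
            simp [arcRank]
          simp only [Set.mem_ofPred_eq, Set.mem_union, Set.mem_singleton_iff, ← h3]
          omega
        rw [this, Set.image_union, Set.image_singleton]
        simp [chosen]
      rw [h2]
      have := (cycleSequence h s).regular (i, true) r
      simpa [arcRank, chosen] using this)
  rw [bot_sup_eq, before_localData] at h1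
  have h3 : chosen h s '' {p | arcRank p < 2 * Γ.n} = Set.range (chosen h s) := by
    rw [← Set.image_univ]
    congr 1
    ext ⟨c, b⟩
    simp only [arcRank, Set.mem_ofPred_eq, Set.mem_univ, iff_true]
    have := c.2
    split_ifs <;> omega
  rw [h3] at h1
  have h4 : (fun c => (localData h s c).A) =
      fun c => Γ.atVertex c fun x₁ x₂ x₃ x₄ => diffMat x₁ x₂ x₃ x₄ (s c) :=
    funext fun c => localData_A h s c
  rw [h4] at h1
  exact h1

end Shadow

/-! ### Squarefree monomials as labels of circles. -/

section Labels

variable {K : Type*} [Finite K]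

/-- The exponents of the squarefree monomial given by a set of labels. -/
noncomputable def labelExp (l : K → Bool) : K →₀ ℕ :=
  Finsupp.equivFunOnFinite.symm fun k => if l k then 1 else 0

theorem labelExp_apply (l : K → Bool) (k : K) : labelExp l k = if l k then 1 else 0 := rfl

theorem labelExp_injective : Function.Injective (labelExp (K := K)) := by
  intro l l' h
  funext k
  have := DFunLike.congr_fun h k
  rw [labelExp_apply, labelExp_apply] at this
  cases hl : l k <;> cases hl' : l' k <;> simp [hl, hl'] at this ⊢

/-- The coefficients of the squarefree monomials. -/
noncomputable def labelCoeff (K : Type*) [Finite K] :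
    MvPolynomial K ℚ →ₗ[ℚ] ((K → Bool) → ℚ) :=
  LinearMap.pi fun l => MvPolynomial.lcoeff ℚ (labelExp l)

theorem labelCoeff_apply (p : MvPolynomial K ℚ) (l : K → Bool) :
    labelCoeff K p l = MvPolynomial.coeff (labelExp l) p := rfl

/-- The monomials outside the ideal of the squares are those with all exponents at most one, which
are exactly the labels. -/
theorem labelCoeff_eq_zero_iff (p : MvPolynomial K ℚ) : labelCoeff K p = 0 ↔
    p ∈ Ideal.span (Set.range fun k => (MvPolynomial.X k ^ 2 : MvPolynomial K ℚ)) := by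
  have hS : Set.range (fun k => (MvPolynomial.X k ^ 2 : MvPolynomial K ℚ)) =
      (fun s => MvPolynomial.monomial s (1 : ℚ)) '' Set.range fun k => Finsupp.single k 2 := by
    rw [← Set.range_comp]
    simp only [MvPolynomial.X_pow_eq_monomial, Function.comp_def]
  rw [hS, MvPolynomial.mem_ideal_span_monomial_image]
  constructor
  · intro h m hm
    by_contra hc
    push Not at hc
    have h1 : ∀ k, m k < 2 := by
      intro k
      have := hc _ ⟨k, rfl⟩
      rwa [Finsupp.single_le_iff, not_le] at this
    have h2 : labelExp (fun k => decide (m k = 1)) = m := by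
      ext k
      rw [labelExp_apply]
      have := h1 k
      split_ifs with h3 <;> simp at h3 <;> omega
    have h3 := congrFun h fun k => decide (m k = 1)
    rw [labelCoeff_apply, h2] at h3
    exact (MvPolynomial.mem_support_iff.1 hm) h3
  · intro h
    funext l
    by_contra hc
    obtain ⟨_, ⟨k, rfl⟩, hk⟩ := h _ (MvPolynomial.mem_support_iff.2 hc)
    rw [Finsupp.single_le_iff, labelExp_apply] at hk
    split_ifs at hk <;> omega

theorem labelCoeff_surjective : Function.Surjective (labelCoeff K) := by
  classical
  intro F
  have := Fintype.ofFinite K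
  refine ⟨∑ l, MvPolynomial.monomial (labelExp l) (F l), ?_⟩
  funext l
  simp only [labelCoeff_apply, MvPolynomial.coeff_sum, MvPolynomial.coeff_monomial,
    labelExp_injective.eq_iff]
  simp

open Classical in
theorem labelCoeff_X_mul (k : K) (p : MvPolynomial K ℚ) (l : K → Bool) :
    labelCoeff K (MvPolynomial.X k * p) l =
      if l k then labelCoeff K p (Function.update l k false) else 0 := by
  simp only [labelCoeff_apply, MvPolynomial.coeff_X_mul', Finsupp.mem_support_iff,
    labelExp_apply]
  cases hl : l k
  · simp
  · simp only [if_true, ne_eq, one_ne_zero, not_false_eq_true]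
    congr 1
    ext k'
    rw [Finsupp.tsub_apply, labelExp_apply, labelExp_apply]
    by_cases hk : k' = k
    · subst hk; simp [hl]
    · simp [Function.update_of_ne hk, Finsupp.single_eq_of_ne hk]

end Labels

/-! ### The surviving quotient as `ℚ[X_k]/(X_k²)` over the circles with marks. -/

namespace Shadow

variable {Γ : Shadow}

/-- All edges of a circle are identified, up to the signs of their colours. -/
noncomputable def toCircles (σ : Γ.Edge → Bool) (s : Γ.State) :
    Γ.Ring →ₐ[ℚ] MvPolynomial (Quot (Γ.Joined s)) ℚ :=
  MvPolynomial.aeval fun e => MvPolynomial.C (colorSign σ e) * MvPolynomial.X (Quot.mk _ e)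

theorem toCircles_X (σ : Γ.Edge → Bool) (s : Γ.State) (e : Γ.Edge) :
    toCircles σ s (MvPolynomial.X e) =
      MvPolynomial.C (colorSign σ e) * MvPolynomial.X (Quot.mk _ e) :=
  MvPolynomial.aeval_X _ _

theorem toCircles_signedX (σ : Γ.Edge → Bool) (s : Γ.State) (e : Γ.Edge) :
    toCircles σ s (signedX σ e) = MvPolynomial.X (Quot.mk _ e) := by
  rw [signedX, map_mul, toCircles_X, MvPolynomial.algHom_C, MvPolynomial.algebraMap_eq,
    ← mul_assoc, ← map_mul, colorSign_mul_self, map_one, one_mul]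

/-- A section of `toCircles`. -/
noncomputable def ofCircles (σ : Γ.Edge → Bool) (s : Γ.State) :
    MvPolynomial (Quot (Γ.Joined s)) ℚ →ₐ[ℚ] Γ.Ring :=
  MvPolynomial.aeval fun k => signedX σ k.out

theorem toCircles_ofCircles (σ : Γ.Edge → Bool) (s : Γ.State)
    (p : MvPolynomial (Quot (Γ.Joined s)) ℚ) : toCircles σ s (ofCircles σ s p) = p := by
  have : (toCircles σ s).comp (ofCircles σ s) = AlgHom.id ℚ _ := by
    refine MvPolynomial.algHom_ext fun k => ?_
    rw [AlgHom.comp_apply, ofCircles, MvPolynomial.aeval_X, toCircles_signedX, Quot.out_eq,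
      AlgHom.id_apply]
  exact AlgHom.congr_fun this p

variable {σ : Γ.Edge → Bool}

theorem C_colorSign_mul_signedX (σ : Γ.Edge → Bool) (e : Γ.Edge) :
    MvPolynomial.C (colorSign σ e) * signedX σ e = MvPolynomial.X e := by
  rw [signedX, ← mul_assoc, ← map_mul, colorSign_mul_self, map_one, one_mul]

theorem signedX_sub_mem (h : Γ.IsColoring σ) (s : Γ.State) {e e' : Γ.Edge}
    (he : Quot.mk (Γ.Joined s) e = Quot.mk _ e') :
    signedX σ e - signedX σ e' ∈ chosenIdeal h s := by
  obtain ⟨p, rfl⟩ := (source_bijective h s).2 e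
  obtain ⟨q, rfl⟩ := (source_bijective h s).2 e'
  exact (cycleSequence h s).sub_mem_span ((mk_source_eq_iff h s p q).1 he)

theorem signedX_sq_mem (h : Γ.IsColoring σ) (s : Γ.State) (e : Γ.Edge) :
    signedX σ e ^ 2 ∈ chosenIdeal h s := by
  obtain ⟨p, rfl⟩ := (source_bijective h s).2 e
  exact (cycleSequence h s).sq_mem_span p

theorem sub_ofCircles_mem (h : Γ.IsColoring σ) (s : Γ.State) (r : Γ.Ring) :
    r - ofCircles σ s (toCircles σ s r) ∈ chosenIdeal h s := by
  rw [← Ideal.Quotient.eq]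
  have : (Ideal.Quotient.mkₐ ℚ (chosenIdeal h s)) = (Ideal.Quotient.mkₐ ℚ (chosenIdeal h s)).comp
      ((ofCircles σ s).comp (toCircles σ s)) := by
    refine MvPolynomial.algHom_ext fun e => ?_
    simp only [AlgHom.comp_apply, Ideal.Quotient.mkₐ_eq_mk]
    rw [Ideal.Quotient.eq, toCircles_X, map_mul, MvPolynomial.algHom_C,
      MvPolynomial.algebraMap_eq, ofCircles, MvPolynomial.aeval_X]
    have h1 := (chosenIdeal h s).mul_mem_left (MvPolynomial.C (colorSign σ e))
      (signedX_sub_mem h s (Quot.out_eq (Quot.mk (Γ.Joined s) e)).symm)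
    convert h1 using 1
    rw [mul_sub, C_colorSign_mul_signedX]
  exact AlgHom.congr_fun this r

theorem chosenIdeal_le (h : Γ.IsColoring σ) (s : Γ.State) :
    chosenIdeal h s ≤ Ideal.comap (toCircles σ s)
      (Ideal.span (Set.range fun k => MvPolynomial.X k ^ 2)) := by
  rw [chosenIdeal, Ideal.span_le]
  rintro _ ⟨p, rfl⟩
  rw [SetLike.mem_coe, Ideal.mem_comap]
  have h1 : toCircles σ s (signedX σ (source σ s p)) =
      toCircles σ s (signedX σ (source σ s (nextArc h s p))) := by
    rw [toCircles_signedX, toCircles_signedX, source_nextArc, mk_source_eq_mk_target]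
  by_cases hp : IsLastMark (nextArc h s) arcRank p
  · rw [(cycleSequence h s).last p hp, map_smul, map_add, map_add, map_pow, map_mul, map_pow,
      ← h1, toCircles_signedX, MvPolynomial.smul_eq_C_mul]
    refine Ideal.mul_mem_left _ _ ?_
    have h2 : (MvPolynomial.X (Quot.mk _ (source σ s p)) ^ 2 :
        MvPolynomial (Quot (Γ.Joined s)) ℚ) ∈
        Ideal.span (Set.range fun k => MvPolynomial.X k ^ 2) := Ideal.subset_span ⟨_, rfl⟩
    exact Ideal.add_mem _ (Ideal.add_mem _ h2 (by rwa [← pow_two])) h2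
  · rw [(cycleSequence h s).not_last p hp, map_smul, map_sub, ← h1, sub_self, smul_zero]
    exact Ideal.zero_mem _

/-- The coefficients of the squarefree monomials in the variables of the circles. -/
noncomputable def evalLabels (σ : Γ.Edge → Bool) (s : Γ.State) :
    Γ.Ring →ₗ[ℚ] ((Quot (Γ.Joined s) → Bool) → ℚ) :=
  labelCoeff _ ∘ₗ (toCircles σ s).toLinearMap

theorem evalLabels_apply (σ : Γ.Edge → Bool) (s : Γ.State) (r : Γ.Ring) :
    evalLabels σ s r = labelCoeff _ (toCircles σ s r) := rfl

/-- The chosen entries identify the signed variables along each circle and kill their squares, and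
they generate no further relation. So the polynomial ring modulo them is the squarefree algebra on
the circles. -/
theorem evalLabels_eq_zero_iff (h : Γ.IsColoring σ) (s : Γ.State) (r : Γ.Ring) :
    evalLabels σ s r = 0 ↔ r ∈ chosenIdeal h s := by
  rw [evalLabels_apply, labelCoeff_eq_zero_iff]
  constructor
  · intro hr
    have h1 : ofCircles σ s (toCircles σ s r) ∈ chosenIdeal h s := by
      have h2 : Ideal.span (Set.range fun k => MvPolynomial.X k ^ 2) ≤
          Ideal.comap (ofCircles σ s) (chosenIdeal h s) := by
        rw [Ideal.span_le]
        rintro _ ⟨k, rfl⟩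
        rw [SetLike.mem_coe, Ideal.mem_comap, map_pow, ofCircles, MvPolynomial.aeval_X]
        exact signedX_sq_mem h s _
      exact h2 hr
    have := (chosenIdeal h s).add_mem (sub_ofCircles_mem h s r) h1
    rwa [sub_add_cancel] at this
  · exact fun hr => chosenIdeal_le h s hr

theorem evalLabels_surjective (σ : Γ.Edge → Bool) (s : Γ.State) :
    Function.Surjective (evalLabels σ s) := by
  intro F
  obtain ⟨p, hp⟩ := labelCoeff_surjective F
  exact ⟨ofCircles σ s p, by rw [evalLabels_apply, toCircles_ofCircles, hp]⟩

/-- The map which identifies the homology of the core complex with functions of labels. -/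
noncomputable def coreMap (h : Γ.IsColoring σ) (s : Γ.State) :
    Γ.CoreChain →ₗ[ℚ] ((Quot (Γ.Joined s) → Bool) → ℚ) :=
  evalLabels σ s ∘ₗ (eps Γ.n (localData h s)).restrictScalars ℚ

theorem coreMap_apply (h : Γ.IsColoring σ) (s : Γ.State) (f : Γ.CoreChain) :
    coreMap h s f = evalLabels σ s (eps Γ.n (localData h s) f) := rfl

theorem coreMap_coreD (h : Γ.IsColoring σ) (s : Γ.State) (f : Γ.CoreChain) :
    coreMap h s (Γ.coreD s f) = 0 := by
  obtain ⟨u, -, hu⟩ := (reduces_coreD h s).comm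
  rw [coreMap_apply, evalLabels_eq_zero_iff h]
  simpa using hu f

theorem exists_coreD_eq (h : Γ.IsColoring σ) (s : Γ.State) (f : Γ.CoreChain)
    (hf : Γ.coreD s f = 0) (hf' : coreMap h s f = 0) : ∃ k, f = Γ.coreD s k := by
  rw [coreMap_apply, evalLabels_eq_zero_iff h] at hf'
  obtain ⟨k, hk⟩ := (reduces_coreD h s).inj f (by rw [hf]; exact zero_mem _) 0 (by simpa using hf')
  refine ⟨k, sub_eq_zero.1 ?_⟩
  funext g
  simpa using (mem_valued.1 hk) g

theorem exists_coreMap_eq (h : Γ.IsColoring σ) (s : Γ.State)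
    (F : (Quot (Γ.Joined s) → Bool) → ℚ) : ∃ f, Γ.coreD s f = 0 ∧ coreMap h s f = F := by
  obtain ⟨r, rfl⟩ := evalLabels_surjective σ s F
  obtain ⟨f, hf, hf'⟩ := (reduces_coreD h s).surj r (by simp)
  refine ⟨f, ?_, ?_⟩
  · funext g
    simpa using (mem_valued.1 hf) g
  · rw [coreMap_apply, ← sub_eq_zero, ← map_sub, evalLabels_eq_zero_iff h]
    exact hf'

/-- If `f` represents the same class as `r` times a generator. -/
theorem coreMap_smul (h : Γ.IsColoring σ) (s : Γ.State) (r a : Γ.Ring) {f : Γ.CoreChain}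
    (hf : coreMap h s f = evalLabels σ s a) : coreMap h s (r • f) = evalLabels σ s (r * a) := by
  rw [coreMap_apply, ← sub_eq_zero, ← map_sub, evalLabels_eq_zero_iff h] at hf
  rw [coreMap_apply, ← sub_eq_zero, ← map_sub, evalLabels_eq_zero_iff h, map_smul, smul_eq_mul,
    ← mul_sub]
  exact (chosenIdeal h s).mul_mem_left r hf

/-- Labels of circles without marks are mere parameters: the differential acts on each slice
separately. -/
theorem d_apply (s : Γ.State) (f : Γ.Chain) (g : Γ.Gen) :
    Γ.d s f g = Γ.coreD s (fun g' => f (g', g.2)) g.1 := by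
  simp only [d, LinearMap.sum_apply, Finset.sum_apply, LinearMap.comp_apply, koszulSign, actAt,
    coreD, chainD, LinearMap.coe_mk, AddHom.coe_mk]
  refine Finset.sum_congr rfl fun c _ => ?_
  rw [MvPolynomial.smul_eq_C_mul]
  simp

end Shadow

/-! ### Homogeneous parts and internal degrees. -/

section Homogeneous

variable {ι : Type*}

/-- Homogeneous polynomials, if the variables have degree two. -/
abbrev IsHomog (p : MvPolynomial ι ℚ) (n : ℤ) : Prop :=
  MvPolynomial.IsWeightedHomogeneous (fun _ => (2 : ℤ)) p n

/-- The homogeneous part of a polynomial, if the variables have degree two. -/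
noncomputable def part (n : ℤ) : MvPolynomial ι ℚ →ₗ[ℚ] MvPolynomial ι ℚ :=
  MvPolynomial.weightedHomogeneousComponent (fun _ => (2 : ℤ)) n

theorem weight_two (m : ι →₀ ℕ) : Finsupp.weight (fun _ => (2 : ℤ)) m = 2 * (m.degree : ℤ) := by
  rw [Finsupp.weight_apply, Finsupp.sum, Finsupp.degree_apply, Nat.cast_sum, Finset.mul_sum]
  refine Finset.sum_congr rfl fun i _ => ?_
  rw [nsmul_eq_mul, mul_comm]

theorem isHomog_iff (p : MvPolynomial ι ℚ) (n : ℤ) :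
    IsHomog p n ↔ ∀ m, MvPolynomial.coeff m p ≠ 0 → 2 * (m.degree : ℤ) = n := by
  simp only [← weight_two]
  exact ⟨fun h m hm => h hm, fun h m hm => h m hm⟩

theorem part_isHomog (n : ℤ) (p : MvPolynomial ι ℚ) : IsHomog (part n p) n :=
  MvPolynomial.weightedHomogeneousComponent_isWeightedHomogeneous _ _

theorem coeff_part (n : ℤ) (p : MvPolynomial ι ℚ) (m : ι →₀ ℕ) :
    MvPolynomial.coeff m (part n p) =
      if 2 * (m.degree : ℤ) = n then MvPolynomial.coeff m p else 0 := by
  rw [part, MvPolynomial.coeff_weightedHomogeneousComponent, weight_two]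

theorem part_mul {a : MvPolynomial ι ℚ} {k : ℤ} (ha : IsHomog a k) (n : ℤ)
    (p : MvPolynomial ι ℚ) : part (k + n) (a * p) = a * part n p := by
  classical
  ext m
  rw [coeff_part, MvPolynomial.coeff_mul, MvPolynomial.coeff_mul]
  have h : ∀ x ∈ Finset.HasAntidiagonal.antidiagonal m, MvPolynomial.coeff x.1 a *
      MvPolynomial.coeff x.2 (part n p) = if 2 * (m.degree : ℤ) = k + n then
        MvPolynomial.coeff x.1 a * MvPolynomial.coeff x.2 p else 0 := by
    intro x hx
    rw [coeff_part]
    by_cases h0 : MvPolynomial.coeff x.1 a = 0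
    · simp [h0]
    · have h1 := (isHomog_iff a k).1 ha _ h0
      have h2 : m.degree = x.1.degree + x.2.degree := by
        rw [← Finset.HasAntidiagonal.mem_antidiagonal.1 hx, map_add]
      have h3 : 2 * (m.degree : ℤ) = k + n ↔ 2 * (x.2.degree : ℤ) = n := by
        rw [h2]; push_cast; omega
      simp only [h3]
      split_ifs <;> simp
  rw [Finset.sum_congr rfl h]
  split_ifs <;> simp

theorem part_mul' {a : MvPolynomial ι ℚ} {k n n' : ℤ} (ha : IsHomog a k) (hn : n' = k + n)
    (p : MvPolynomial ι ℚ) : part n' (a * p) = a * part n p := by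
  rw [hn, part_mul ha]

theorem isHomog_X (i : ι) : IsHomog (MvPolynomial.X i) 2 :=
  MvPolynomial.isWeightedHomogeneous_X _ _ _

theorem IsHomog.part_eq {p : MvPolynomial ι ℚ} {n : ℤ} (h : IsHomog p n) : part n p = p := by
  ext m
  rw [coeff_part]
  split_ifs with hm
  · rfl
  · by_contra hc
    exact hm ((isHomog_iff p n).1 h m fun h0 => hc h0.symm)

theorem labelExp_degree {K : Type*} [Fintype K] (l : K → Bool) :
    ((labelExp l).degree : ℤ) = ∑ k, if l k then 1 else 0 := by
  rw [Finsupp.degree_eq_sum, Nat.cast_sum]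
  refine Finset.sum_congr rfl fun k _ => ?_
  rw [labelExp_apply]
  split_ifs <;> rfl

theorem sum_circleDeg {K : Type*} [Fintype K] (l : K → Bool) :
    ∑ k, circleDeg (l k) = 2 * ((labelExp l).degree : ℤ) - Fintype.card K := by
  rw [labelExp_degree, Finset.mul_sum, Fintype.card, Finset.card_eq_sum_ones, Nat.cast_sum,
    ← Finset.sum_sub_distrib]
  refine Finset.sum_congr rfl fun k _ => ?_
  cases l k <;> rfl

/-- The homogeneous part of a vector of polynomials. -/
noncomputable def vecPart {G : Type*} (δ : G → ℤ) (j : ℤ) :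
    (G → MvPolynomial ι ℚ) →ₗ[ℚ] (G → MvPolynomial ι ℚ) :=
  LinearMap.pi fun g => part (j - δ g) ∘ₗ LinearMap.proj g

theorem vecPart_apply {G : Type*} (δ : G → ℤ) (j : ℤ) (f : G → MvPolynomial ι ℚ) (g : G) :
    vecPart δ j f g = part (j - δ g) (f g) := rfl

theorem chainD_vecPart {m : ℕ} (A : Fin m → Matrix (Fin 2 × Fin 2) (Fin 2 × Fin 2)
    (MvPolynomial ι ℚ)) (δ : Fin m → Fin 2 × Fin 2 → ℤ) (k : ℤ)
    (hA : ∀ c u v, IsHomog (A c u v) (δ c v + k - δ c u)) (j : ℤ)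
    (f : (Fin m → Fin 2 × Fin 2) → MvPolynomial ι ℚ) :
    chainD A (vecPart (fun g => ∑ c, δ c (g c)) j f) =
      vecPart (fun g => ∑ c, δ c (g c)) (j + k) (chainD A f) := by
  funext g
  rw [vecPart_apply]
  simp only [chainD, LinearMap.coe_mk, AddHom.coe_mk, map_sum]
  refine Finset.sum_congr rfl fun c _ => ?_
  have h1 : ∀ r : MvPolynomial ι ℚ, ∀ n, part n ((∏ c' ∈ Finset.univ.filter (· < c),
      (-1 : MvPolynomial ι ℚ) ^ ((g c').1 : ℕ)) * r) = (∏ c' ∈ Finset.univ.filter (· < c),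
      (-1 : MvPolynomial ι ℚ) ^ ((g c').1 : ℕ)) * part n r := by
    intro r n
    refine part_mul' (k := 0) ?_ (by ring) r
    have h2 : (∏ c' ∈ Finset.univ.filter (· < c), (-1 : MvPolynomial ι ℚ) ^ ((g c').1 : ℕ)) =
        MvPolynomial.C (∏ c' ∈ Finset.univ.filter (· < c), (-1 : ℚ) ^ ((g c').1 : ℕ)) := by
      simp
    rw [h2]
    exact MvPolynomial.isWeightedHomogeneous_C _ _
  rw [h1, map_sum]
  congr 1
  refine Finset.sum_congr rfl fun u _ => ?_
  rw [vecPart_apply]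
  refine (part_mul' (hA c (g c) u) ?_ _).symm
  have h3 : ∀ g' : Fin m → Fin 2 × Fin 2, ∑ c', δ c' (g' c') =
      δ c (g' c) + ∑ c' ∈ Finset.univ.erase c, δ c' (g' c') := fun g' =>
    (Finset.add_sum_erase _ _ (Finset.mem_univ c)).symm
  have h4 : ∑ c' ∈ Finset.univ.erase c, δ c' (Function.update g c u c') =
      ∑ c' ∈ Finset.univ.erase c, δ c' (g c') :=
    Finset.sum_congr rfl fun c' hc' => by
      rw [Function.update_of_ne (Finset.ne_of_mem_erase hc')]
  rw [h3, h3, h4, Function.update_self]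
  ring

/-- Each projection is homogeneous at its vertex, so their composite shifts the internal degree by
the sum of the local shifts `γ`. -/
theorem eps_vecPart : ∀ (m : ℕ) (L : Fin m → LocalFactorization (MvPolynomial ι ℚ))
    (δ : Fin m → Fin 2 × Fin 2 → ℤ) (γ : Fin m → ℤ),
    (∀ c v, IsHomog ((L c).P (survivor (L c).x (L c).y) v) (δ c v - γ c)) → ∀ (j : ℤ)
    (f : (Fin m → Fin 2 × Fin 2) → MvPolynomial ι ℚ),
    eps m L (vecPart (fun g => ∑ c, δ c (g c)) j f) = part (j - ∑ c, γ c) (eps m L f)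
  | 0, L, δ, γ, _, j, f => by
    simp [eps, vecPart_apply]
  | m + 1, L, δ, γ, hL, j, f => by
    have ih := eps_vecPart m (Fin.tail L) (Fin.tail δ) (Fin.tail γ) (fun c => hL c.succ) (j - γ 0)
      ((L 0).functional _ (consEquiv (Fin 2 × Fin 2) m f))
    have h1 : j - ∑ c, γ c = j - γ 0 - ∑ c, Fin.tail γ c := by
      rw [Fin.sum_univ_succ, sub_sub]
      rfl
    rw [h1]
    change eps m (Fin.tail L) _ = part _ (eps m (Fin.tail L) _)
    rw [LinearMap.comp_apply, LinearMap.comp_apply]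
    refine Eq.trans ?_ ih
    congr 1
    funext g
    rw [vecPart_apply]
    simp only [LocalFactorization.functional_apply, Finset.sum_apply, Pi.smul_apply, smul_eq_mul,
      map_sum, LinearEquiv.coe_coe]
    refine Finset.sum_congr rfl fun v _ => ?_
    refine (part_mul' (hL 0 v) ?_ _).symm
    change _ = δ 0 v - γ 0 + (j - ∑ c, δ c ((Fin.cons v g : Fin (m + 1) → Fin 2 × Fin 2) c))
    rw [Fin.sum_univ_succ]
    simp only [Fin.cons_zero, Fin.cons_succ, Fin.tail]
    ring

end Homogeneous

/-! ### Degrees of the local differentials and of the maps `χ`. -/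

section LocalDegrees

variable {ι : Type*} (x₁ x₂ x₃ x₄ : ι)

open MvPolynomial in
theorem diffMat_isHomog (w : Bool) (u v : Fin 2 × Fin 2) :
    IsHomog (diffMat (X x₁ : MvPolynomial ι ℚ) (X x₂) (X x₃) (X x₄) w u v)
      (genDeg w v + 3 - genDeg w u) := by
  have hX := fun i : ι => isHomog_X i
  have hXX : ∀ i j : ι, IsHomog (X i * X j) 4 := fun i j => (hX i).mul (hX j)
  have hpi : ∀ i j : ι, IsHomog (piPoly (X i) (X j)) 4 := fun i j => by
    rw [piPoly, pow_two, pow_two]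
    exact ((hXX i i).add (hXX i j)).add (hXX j j)
  have h3 : ∀ (p : MvPolynomial ι ℚ) n, IsHomog p n → IsHomog (3 * p) n := fun p n hp => by
    have := hp.C_mul 3
    rwa [map_ofNat] at this
  have hu₂ : IsHomog (u₂ (X x₃ : MvPolynomial ι ℚ) (X x₄)) 2 := by
    rw [u₂, neg_mul]
    exact (h3 _ _ ((hX _).add (hX _))).neg
  have hu₁ : IsHomog (u₁ (X x₁ : MvPolynomial ι ℚ) (X x₂) (X x₃) (X x₄)) 4 := by
    rw [u₁, pow_two, pow_two]
    have h12 := (hX x₁).add (hX x₂)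
    have h34 := (hX x₃).add (hX x₄)
    exact (((h12.mul h12).add (h12.mul h34)).add (h34.mul h34)).sub (h3 _ _ (hXX x₁ x₂))
  have hq := (hXX x₁ x₂).sub (hXX x₃ x₄)
  have hz := fun n : ℤ => MvPolynomial.isWeightedHomogeneous_zero ℚ (fun _ : ι => (2 : ℤ)) n
  obtain ⟨p, i⟩ := u
  obtain ⟨q, j⟩ := v
  cases w <;> fin_cases p <;> fin_cases q <;> fin_cases i <;> fin_cases j <;>
    simp [diffMat, diffArcs, diffWide, genDeg, hz] <;>
    first
    | with_reducible exact hpi _ _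
    | with_reducible exact (hpi _ _).neg
    | with_reducible exact (hX _).sub (hX _)
    | with_reducible exact hu₁
    | with_reducible exact hu₁.neg
    | with_reducible exact hu₂
    | with_reducible exact hq
    | with_reducible exact (((hX _).add (hX _)).sub (hX _)).sub (hX _)

open MvPolynomial in
theorem chiMat_isHomog (w : Bool) (u v : Fin 2 × Fin 2) :
    IsHomog (chiMat (X x₁ : MvPolynomial ι ℚ) (X x₂) (X x₃) (X x₄) w u v)
      (genDeg (!w) v + 1 - genDeg w u) := by
  have hX := fun i : ι => isHomog_X i
  have h2 : ∀ (p : MvPolynomial ι ℚ) n, IsHomog p n → IsHomog (2 * p) n := fun p n hp => by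
    have := hp.C_mul 2
    rwa [map_ofNat] at this
  have h1 : IsHomog (1 : MvPolynomial ι ℚ) 0 := MvPolynomial.isWeightedHomogeneous_one _ _
  have ha : IsHomog (a₁ (X x₁ : MvPolynomial ι ℚ) (X x₂) (X x₃) (X x₄)) 2 :=
    (((hX _).sub (hX _)).sub (h2 _ _ (hX _))).sub (hX _)
  have hz := fun n : ℤ => MvPolynomial.isWeightedHomogeneous_zero ℚ (fun _ : ι => (2 : ℤ)) n
  obtain ⟨p, i⟩ := u
  obtain ⟨q, j⟩ := v
  cases w <;> fin_cases p <;> fin_cases q <;> fin_cases i <;> fin_cases j <;>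
    simp [chiMat, chiZero, chiOne, genDeg, hz] <;>
    first
    | with_reducible exact h1
    | with_reducible exact h1.neg
    | with_reducible exact ha
    | with_reducible exact ha.neg
    | with_reducible exact hX _
    | with_reducible exact (hX _).neg
    | with_reducible exact (hX _).sub (hX _)

end LocalDegrees

namespace Shadow

variable {Γ : Shadow} {σ : Γ.Edge → Bool}

/-- The degree of the surviving coordinate at a vertex. -/
noncomputable def survivorDeg (h : Γ.IsColoring σ) (s : Γ.State) (c : Fin Γ.n) : ℤ :=
  -((if lastArc h s (c, false) then 1 else 0) + (if lastArc h s (c, true) then 1 else 0))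

theorem localData_isHomog (h : Γ.IsColoring σ) (s : Γ.State) (c : Fin Γ.n) (v : Fin 2 × Fin 2) :
    IsHomog ((localData h s c).P (survivor (localData h s c).x (localData h s c).y) v)
      (genDeg (s c) v - survivorDeg h s c) := by
  have h1 : IsHomog (1 : Γ.Ring) 0 := MvPolynomial.isWeightedHomogeneous_one _ _
  have hz := fun n : ℤ => MvPolynomial.isWeightedHomogeneous_zero ℚ (fun _ : Γ.Edge => (2 : ℤ)) n
  have hC := fun a : ℚ => MvPolynomial.isWeightedHomogeneous_C (fun _ : Γ.Edge => (2 : ℤ)) a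
  have hX := fun i : Γ.Edge => isHomog_X i
  have hμ : ∀ (a : ℚ) (i j k l : Γ.Edge), IsHomog (MvPolynomial.C a * (MvPolynomial.X i +
      MvPolynomial.X j + MvPolynomial.X k + MvPolynomial.X l)) 2 := fun a i j k l =>
    ((((hX i).add (hX j)).add (hX k)).add (hX l)).C_mul a
  obtain ⟨p, i⟩ := v
  cases hs : s c <;> cases hx : lastArc h s (c, false) <;> cases hy : lastArc h s (c, true) <;>
    simp only [localData, hs, hx, hy, survivorDeg, arcsFactorization, wideFactorization,
      Bool.false_eq_true, if_false, if_true, Bool.not_true, Bool.not_false, survivor] <;>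
    fin_cases p <;> fin_cases i <;> simp [shear, genDeg, hz, Matrix.one_apply] <;>
    first
    | with_reducible exact h1
    | with_reducible exact hμ _ _ _ _ _
    | with_reducible exact (hC _).neg

end Shadow
-- The graded vector space `H(Γ)`.
namespace Shadow

variable {Γ : Shadow} {σ : Γ.Edge → Bool}

noncomputable instance (s : Γ.State) : Fintype (Quot (Γ.Joined s)) := Fintype.ofFinite _

theorem card_lastArc (h : Γ.IsColoring σ) (s : Γ.State) :
    Fintype.card {p // lastArc h s p = true} = Fintype.card (Quot (Γ.Joined s)) := by
  refine Fintype.card_of_bijective (f := fun p => Quot.mk _ (source σ s p.1)) ⟨?_, ?_⟩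
  · rintro ⟨p, hp⟩ ⟨q, hq⟩ hpq
    have h1 := (mk_source_eq_iff h s p q).1 hpq
    simp only [lastArc, decide_eq_true_eq] at hp hq
    exact Subtype.ext (hp.eq arcRank_injective hq h1)
  · intro k
    induction k using Quot.ind with | mk e => ?_
    obtain ⟨p, rfl⟩ := (source_bijective h s).2 e
    obtain ⟨q, hpq, hq⟩ := exists_isLastMark (nextArc h s) arcRank p
    exact ⟨⟨q, by simpa [lastArc] using hq⟩, ((mk_source_eq_iff h s p q).2 hpq).symm⟩

/-- Each last arc lowers the degree of the surviving coordinate by one, and every circle with marks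
has exactly one. The total is the degree of `1 ⊗ ⋯ ⊗ 1`. -/
theorem sum_survivorDeg (h : Γ.IsColoring σ) (s : Γ.State) :
    ∑ c, survivorDeg h s c = -(Fintype.card (Quot (Γ.Joined s)) : ℤ) := by
  rw [← card_lastArc h, Fintype.card_subtype, Finset.card_filter, Nat.cast_sum,
    Fintype.sum_prod_type, ← Finset.sum_neg_distrib]
  refine Finset.sum_congr rfl fun c _ => ?_
  rw [survivorDeg, Fintype.sum_bool]
  push_cast
  ring

/-- The internal degree of a basis element of the core complex. -/
def coreDeg (s : Γ.State) (g : Fin Γ.n → Fin 2 × Fin 2) : ℤ := ∑ c, genDeg (s c) (g c)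

theorem coreD_vecPart (s : Γ.State) (j : ℤ) (f : Γ.CoreChain) :
    Γ.coreD s (vecPart (coreDeg s) j f) = vecPart (coreDeg s) (j + 3) (Γ.coreD s f) :=
  chainD_vecPart _ (fun c => genDeg (s c)) 3 (fun c u v => diffMat_isHomog _ _ _ _ (s c) u v) j f

theorem evalLabels_part (s : Γ.State) (n : ℤ) (r : Γ.Ring) (l : Quot (Γ.Joined s) → Bool) :
    evalLabels σ s (part n r) l =
      if 2 * ((labelExp l).degree : ℤ) = n then evalLabels σ s r l else 0 := by
  induction r using MvPolynomial.induction_on' with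
  | monomial m a =>
    have h1 : part n (MvPolynomial.monomial m a) =
        if 2 * (m.degree : ℤ) = n then MvPolynomial.monomial m a else 0 := by
      classical
      ext m'
      rw [coeff_part]
      split_ifs with h1 h2 h2
      · rfl
      · rw [MvPolynomial.coeff_monomial, if_neg (fun h3 => h2 (by rw [h3]; exact h1)), MvPolynomial.coeff_zero]
      · rw [MvPolynomial.coeff_monomial, if_neg (fun h3 => h1 (by rw [← h3]; exact h2))]
      · rfl
    by_cases h2 : m.degree = (labelExp l).degree
    · rw [h1, h2]
      split_ifs <;> simp
    · have h3 : evalLabels σ s (MvPolynomial.monomial m a) l = 0 := by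
        have h4 : (toCircles σ s (MvPolynomial.monomial m a)).IsHomogeneous (1 * m.degree) :=
          (MvPolynomial.isHomogeneous_monomial a rfl).aeval _ fun e =>
            (MvPolynomial.isHomogeneous_X ℚ _).C_mul _
        exact h4.coeff_eq_zero fun h5 => h2 (by rw [h5, one_mul])
      rw [h1, h3]
      split_ifs <;> first | exact h3 | simp
  | add p q hp hq =>
    rw [map_add, map_add, map_add, Pi.add_apply, Pi.add_apply, hp, hq]
    split_ifs <;> simp

theorem coreMap_vecPart (h : Γ.IsColoring σ) (s : Γ.State) (j : ℤ) (f : Γ.CoreChain)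
    (l : Quot (Γ.Joined s) → Bool) :
    coreMap h s (vecPart (coreDeg s) j f) l =
      if ∑ k, circleDeg (l k) = j then coreMap h s f l else 0 := by
  have h1 : eps Γ.n (localData h s) (vecPart (coreDeg s) j f) = _ :=
    eps_vecPart Γ.n (localData h s) (fun c => genDeg (s c)) (survivorDeg h s)
      (localData_isHomog h s) j f
  rw [coreMap_apply, coreMap_apply, h1, evalLabels_part, sum_circleDeg, sum_survivorDeg h]
  congr 1
  rw [eq_iff_iff]
  constructor <;> intro h <;> linarith

theorem sum_circle {M : Type*} [AddCommMonoid M] (s : Γ.State) (F : Γ.Circle s → M) :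
    ∑ k, F k = ∑ q, F (Sum.inl q) + ∑ k, F (Sum.inr k) := by
  rw [← Fintype.sum_sum_type]
  exact Finset.sum_congr (by ext; simp) fun _ _ => rfl

/-- The map which identifies `H(Γ)` with functions of labels of the circles. -/
noncomputable def chainMap (h : Γ.IsColoring σ) (s : Γ.State) :
    Γ.Chain →ₗ[ℚ] ((Γ.Circle s → Bool) → ℚ) where
  toFun f l := coreMap h s (fun g => f (g, fun k => l (Sum.inr k))) fun k => l (Sum.inl k)
  map_add' f f' := by
    funext l
    exact congrFun (map_add (coreMap h s) (fun g => f (g, fun k => l (Sum.inr k)))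
      fun g => f' (g, fun k => l (Sum.inr k))) _
  map_smul' r f := by
    funext l
    exact congrFun (map_smul (coreMap h s) r fun g => f (g, fun k => l (Sum.inr k))) _

theorem chainMap_apply (h : Γ.IsColoring σ) (s : Γ.State) (f : Γ.Chain)
    (l : Γ.Circle s → Bool) : chainMap h s f l =
      coreMap h s (fun g => f (g, fun k => l (Sum.inr k))) fun k => l (Sum.inl k) := rfl

theorem d_eq_zero_iff (s : Γ.State) (f : Γ.Chain) :
    Γ.d s f = 0 ↔ ∀ L, Γ.coreD s (fun g => f (g, L)) = 0 := by
  constructor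
  · intro h L
    funext g
    rw [← d_apply s f (g, L), h]
    rfl
  · intro h
    funext g
    rw [d_apply, h]
    rfl

theorem chainMap_d (h : Γ.IsColoring σ) (s : Γ.State) (f : Γ.Chain) :
    chainMap h s (Γ.d s f) = 0 := by
  funext l
  have h1 : (fun g => Γ.d s f (g, fun k => l (Sum.inr k))) =
      Γ.coreD s (fun g => f (g, fun k => l (Sum.inr k))) := by
    funext g
    rw [d_apply]
  rw [chainMap_apply, h1, coreMap_coreD]
  rfl

theorem exists_d_eq (h : Γ.IsColoring σ) (s : Γ.State) (f : Γ.Chain) (hf : Γ.d s f = 0)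
    (hf' : chainMap h s f = 0) : ∃ k, Γ.d s k = f := by
  have h1 : ∀ L, ∃ k, (fun g => f (g, L)) = Γ.coreD s k := by
    intro L
    refine exists_coreD_eq h s _ ((d_eq_zero_iff s f).1 hf L) ?_
    funext l
    exact congrFun hf' (Sum.elim l L)
  choose k hk using h1
  refine ⟨fun g => k g.2 g.1, ?_⟩
  funext g
  rw [d_apply]
  exact (congrFun (hk g.2) g.1).symm

theorem exists_chainMap_eq (h : Γ.IsColoring σ) (s : Γ.State) (F : (Γ.Circle s → Bool) → ℚ) :
    ∃ f, Γ.d s f = 0 ∧ chainMap h s f = F := by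
  choose f hf hf' using fun L : Fin Γ.loops → Bool =>
    exists_coreMap_eq h s fun l => F (Sum.elim l L)
  refine ⟨fun g => f g.2 g.1, (d_eq_zero_iff s _).2 hf, ?_⟩
  funext l
  rw [chainMap_apply]
  refine (congrFun (hf' _) _).trans ?_
  congr 1
  funext k
  cases k <;> rfl

/-- `H(Γ)` has a basis indexed by the labels of the circles. -/
noncomputable def hEquiv (h : Γ.IsColoring σ) (s : Γ.State) :
    Γ.H s ≃ₗ[ℚ] ((Γ.Circle s → Bool) → ℚ) :=
  LinearEquiv.ofBijective
    (Submodule.liftQ ((LinearMap.range (Γ.d s)).comap (LinearMap.ker (Γ.d s)).subtype)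
      ((chainMap h s) ∘ₗ (LinearMap.ker (Γ.d s)).subtype) (by
      rintro ⟨f, hf⟩ ⟨k, rfl⟩
      exact chainMap_d h s k)) (by
    constructor
    · refine (injective_iff_map_eq_zero _).2 fun x hx => ?_
      obtain ⟨⟨f, hf⟩, rfl⟩ := Submodule.mkQ_surjective _ x
      exact (Submodule.Quotient.mk_eq_zero _).2 (exists_d_eq h s f hf hx)
    · intro F
      obtain ⟨f, hf, hF⟩ := exists_chainMap_eq h s F
      exact ⟨Submodule.mkQ _ ⟨f, hf⟩, hF⟩)

variable (Γ) in
/-- The class of a cocycle. -/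
noncomputable def cls (s : Γ.State) (f : Γ.Chain) (hf : Γ.d s f = 0) : Γ.H s :=
  Submodule.Quotient.mk ⟨f, hf⟩

theorem exists_cls_eq (s : Γ.State) (x : Γ.H s) : ∃ f hf, Γ.cls s f hf = x := by
  obtain ⟨⟨f, hf⟩, rfl⟩ := Submodule.mkQ_surjective _ x
  exact ⟨f, hf, rfl⟩

theorem hEquiv_cls (h : Γ.IsColoring σ) (s : Γ.State) (f : Γ.Chain) (hf : Γ.d s f = 0) :
    hEquiv h s (Γ.cls s f hf) = chainMap h s f := rfl

theorem vecPart_slice (s : Γ.State) (j : ℤ) (f : Γ.Chain) (L : Fin Γ.loops → Bool) :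
    (fun g => vecPart (Γ.deg s) j f (g, L)) =
      vecPart (coreDeg s) (j - ∑ k, circleDeg (L k)) (fun g => f (g, L)) := by
  funext g
  rw [vecPart_apply, vecPart_apply]
  congr 1
  simp only [deg, coreDeg]
  ring_nf

theorem chainMap_vecPart (h : Γ.IsColoring σ) (s : Γ.State) (j : ℤ) (f : Γ.Chain)
    (l : Γ.Circle s → Bool) : chainMap h s (vecPart (Γ.deg s) j f) l =
      if ∑ k, circleDeg (l k) = j then chainMap h s f l else 0 := by
  rw [chainMap_apply, vecPart_slice, coreMap_vecPart, sum_circle, ← chainMap_apply]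
  congr 1
  rw [eq_iff_iff]
  constructor <;> intro h <;> linarith

theorem vecPart_mem_chainDeg (s : Γ.State) (j : ℤ) (f : Γ.Chain) :
    vecPart (Γ.deg s) j f ∈ Γ.chainDeg s j := by
  intro g m hm
  rw [vecPart_apply, coeff_part] at hm
  split_ifs at hm with h
  · linarith
  · exact absurd rfl hm

theorem vecPart_eq_of_mem (s : Γ.State) (j : ℤ) (f : Γ.Chain) (hf : f ∈ Γ.chainDeg s j) :
    vecPart (Γ.deg s) j f = f := by
  funext g
  refine IsHomog.part_eq ((isHomog_iff _ _).2 fun m hm => ?_)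
  have := hf g m hm
  linarith

theorem d_vecPart_eq_zero (s : Γ.State) (j : ℤ) (f : Γ.Chain) (hf : Γ.d s f = 0) :
    Γ.d s (vecPart (Γ.deg s) j f) = 0 := by
  rw [d_eq_zero_iff] at hf ⊢
  intro L
  rw [vecPart_slice, coreD_vecPart, hf, map_zero]

/-- The functions of labels of degree `j`. -/
def labelPart (K : Type*) [Fintype K] (j : ℤ) : Submodule ℚ ((K → Bool) → ℚ) where
  carrier := {F | ∀ l, ∑ k, circleDeg (l k) ≠ j → F l = 0}
  zero_mem' := fun _ _ => rfl
  add_mem' {F F'} hF hF' l hl := by simp [hF l hl, hF' l hl]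
  smul_mem' r F hF l hl := by simp [hF l hl]

/-- Homogeneous parts of cocycles are cocycles. If the labels of a class lie in degree `j`, then the
class equals that of its homogeneous part, because labels determine classes. -/
theorem mem_HDeg_iff (h : Γ.IsColoring σ) (s : Γ.State) (j : ℤ) (x : Γ.H s) :
    x ∈ Γ.HDeg s j ↔ hEquiv h s x ∈ labelPart (Γ.Circle s) j := by
  constructor
  · rintro ⟨⟨f, hf⟩, hfj, rfl⟩ l hl
    have h1 : chainMap h s f l = 0 := by
      rw [← vecPart_eq_of_mem s j f hfj, chainMap_vecPart, if_neg hl]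
    exact h1
  · intro hx
    obtain ⟨f, hf, rfl⟩ := exists_cls_eq s x
    rw [hEquiv_cls] at hx
    refine ⟨⟨_, d_vecPart_eq_zero s j f hf⟩, vecPart_mem_chainDeg s j f, ?_⟩
    apply (hEquiv h s).injective
    change chainMap h s (vecPart (Γ.deg s) j f) = chainMap h s f
    funext l
    rw [chainMap_vecPart]
    split_ifs with hl
    · rfl
    · exact (hx l hl).symm

end Shadow

/-! ### Counting classes after two of them are glued. -/

theorem card_quot_glue {E : Type*} [Finite E] (r : E → E → Prop) (a b : E) :
    Nat.card (Quot fun e e' => r e e' ∨ (e = a ∧ e' = b)) =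
      Nat.card {k : Quot r // k ≠ Quot.mk r b ∨ Quot.mk r a = Quot.mk r b} := by
  classical
  let r' : E → E → Prop := fun e e' => r e e' ∨ (e = a ∧ e' = b)
  let π : Quot r → Quot r' := Quot.map id fun _ _ h => Or.inl h
  -- A section of the projection: the class of `b` is represented by that of `a`, and every other
  -- class by itself.
  let g : Quot r' → Quot r := Quot.lift
    (fun e => if Quot.mk r e = Quot.mk r b then Quot.mk r a else Quot.mk r e) (by
      rintro e e' (h | ⟨rfl, rfl⟩)
      · simp only [Quot.sound h]
      · simp)
  have hab : (Quot.mk r' a) = Quot.mk r' b := Quot.sound (Or.inr ⟨rfl, rfl⟩)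
  have hπg : ∀ k, π (g k) = k := by
    intro k
    induction k using Quot.ind with | mk e => ?_
    change π (if Quot.mk r e = Quot.mk r b then Quot.mk r a else Quot.mk r e) = _
    split_ifs with h
    · have h1 := congrArg π h
      exact hab.trans h1.symm
    · rfl
  have hg : ∀ k, g k ≠ Quot.mk r b ∨ Quot.mk r a = Quot.mk r b := by
    intro k
    induction k using Quot.ind with | mk e => ?_
    change (if Quot.mk r e = Quot.mk r b then Quot.mk r a else Quot.mk r e) ≠ _ ∨ _
    split_ifs with h
    · exact (em _).symm
    · exact Or.inl h
  refine Nat.card_congr (Equiv.ofBijective (fun k => ⟨g k, hg k⟩) ⟨fun k k' h => ?_, ?_⟩)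
  · have h1 : g k = g k' := congrArg Subtype.val h
    rw [← hπg k, h1, hπg]
  · rintro ⟨k, hk⟩
    induction k using Quot.ind with | mk e => ?_
    refine ⟨Quot.mk r' e, Subtype.ext ?_⟩
    change (if Quot.mk r e = Quot.mk r b then Quot.mk r a else Quot.mk r e) = _
    split_ifs with h
    · rcases hk with hk | hk
      · exact absurd h hk
      · exact hk.trans h.symm
    · rfl

open Classical in
theorem card_quot_glue_add {E : Type*} [Finite E] (r : E → E → Prop) (a b : E) :
    Nat.card (Quot fun e e' => r e e' ∨ (e = a ∧ e' = b)) +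
      (if Quot.mk r a = Quot.mk r b then 0 else 1) = Nat.card (Quot r) := by
  rw [card_quot_glue]
  have := Fintype.ofFinite (Quot r)
  split_ifs with h
  · simp [h]
  · simp only [h, or_false, Nat.card_eq_fintype_card]
    rw [Fintype.card_subtype_compl, Fintype.card_subtype_eq]
    exact Nat.sub_add_cancel (Fintype.card_pos_iff.2 ⟨Quot.mk r a⟩)

/-! ### Labels of degree zero and one. -/

section Labels

variable {K : Type*} [Fintype K]

theorem labelExp_degree_eq_zero {l : K → Bool} (h : (labelExp l).degree = 0) :
    l = fun _ => false := by
  rw [Finsupp.degree_eq_zero_iff] at h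
  funext k
  have := DFunLike.congr_fun h k
  rw [labelExp_apply] at this
  simpa using this

open Classical in
theorem labelExp_degree_eq_one {l : K → Bool} (h : (labelExp l).degree = 1) :
    ∃ k, l = Function.update (fun _ => false) k true := by
  have h1 : (Finset.univ.filter fun k => l k = true).card = 1 := by
    rw [Finsupp.degree_eq_sum] at h
    rw [Finset.card_filter]
    exact h
  obtain ⟨k, hk⟩ := Finset.card_eq_one.1 h1
  refine ⟨k, ?_⟩
  funext k'
  have h2 := Finset.ext_iff.1 hk k'
  simp only [Finset.mem_filter, Finset.mem_univ, true_and, Finset.mem_singleton] at h2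
  by_cases hkk : k' = k
  · rw [hkk, Function.update_self, ← hkk]
    exact h2.2 hkk
  · rw [Function.update_of_ne hkk]
    exact Bool.eq_false_iff.2 fun h3 => hkk (h2.1 h3)

open Classical in
theorem labelCoeff_one (l : K → Bool) :
    labelCoeff K 1 l = if l = fun _ => false then 1 else 0 := by
  rw [labelCoeff_apply, MvPolynomial.coeff_one]
  congr 1
  rw [eq_iff_iff]
  have h0 : labelExp (fun _ : K => false) = 0 := by
    ext k
    simp [labelExp_apply]
  rw [← h0, labelExp_injective.eq_iff, eq_comm]

open Classical in
theorem labelCoeff_X (k : K) (l : K → Bool) :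
    labelCoeff K (MvPolynomial.X k) l =
      if l = Function.update (fun _ => false) k true then 1 else 0 := by
  rw [← mul_one (MvPolynomial.X k), labelCoeff_X_mul, labelCoeff_one]
  by_cases hl : l = Function.update (fun _ => false) k true
  · subst hl
    simp
  · rw [if_neg hl]
    split_ifs with h1 h2
    · refine absurd ?_ hl
      rw [← h2, Function.update_idem, ← h1, Function.update_eq_self]
    · rfl
    · rfl

omit [Fintype K] in
theorem update_false_injective [DecidableEq K] {k k' : K}
    (h : Function.update (fun _ => false) k true = Function.update (fun _ => false) k' true) :
    k = k' := by
  by_contra hne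
  have := congrFun h k
  simp [Function.update_of_ne hne] at this

theorem labelCoeff_X_add_X_ne_zero (p q : K) :
    labelCoeff K (MvPolynomial.X p + MvPolynomial.X q) ≠ 0 := by
  classical
  intro h
  have h1 := congrFun h (Function.update (fun _ => false) p true)
  rw [map_add, Pi.add_apply, labelCoeff_X, labelCoeff_X, if_pos rfl, Pi.zero_apply] at h1
  split_ifs at h1 <;> norm_num at h1

/-- The functions of degree one which are annihilated by the difference of two variables. -/
theorem exists_eq_of_degree_one {p q : K} (hpq : p ≠ q) (P : MvPolynomial K ℚ)
    (hdeg : ∀ l, labelCoeff K P l ≠ 0 → (labelExp l).degree = 1)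
    (hann : labelCoeff K ((MvPolynomial.X p - MvPolynomial.X q) * P) = 0) :
    ∃ a : ℚ, labelCoeff K P = labelCoeff K (MvPolynomial.C a *
      (MvPolynomial.X p + MvPolynomial.X q)) := by
  classical
  have h1 : ∀ l, (if l p then labelCoeff K P (Function.update l p false) else 0) =
      if l q then labelCoeff K P (Function.update l q false) else 0 := by
    intro l
    have := congrFun hann l
    rwa [sub_mul, map_sub, Pi.sub_apply, labelCoeff_X_mul, labelCoeff_X_mul, Pi.zero_apply,
      sub_eq_zero] at this
  obtain ⟨e, he⟩ : ∃ e : K → K → Bool, ∀ k, e k = Function.update (fun _ => false) k true :=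
    ⟨_, fun _ => rfl⟩
  have he1 : ∀ k, e k k = true := fun k => by rw [he, Function.update_self]
  have he0 : ∀ {k k'}, k' ≠ k → e k k' = false := fun h => by
    rw [he, Function.update_of_ne h]
  -- Compare coefficients of `X_k X_p`: only the product of `X_p` with the `X_k`-term contributes.
  have h2 : ∀ k, k ≠ q → k ≠ p → labelCoeff K P (e k) = 0 := by
    intro k hkq hkp
    have := h1 (Function.update (e k) p true)
    rw [Function.update_self, if_pos rfl, Function.update_idem,
      Function.update_of_ne hpq.symm, he0 hkq.symm, if_neg (by simp)] at this
    rw [← this]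
    rw [← he0 hkp.symm, Function.update_eq_self]
  -- Compare coefficients of `X_p X_q`.
  have h3 : labelCoeff K P (e q) = labelCoeff K P (e p) := by
    have := h1 (Function.update (e q) p true)
    rw [Function.update_self, if_pos rfl, Function.update_idem, Function.update_of_ne hpq.symm,
      he1, if_pos rfl] at this
    have e1 : Function.update (e q) p false = e q := by
      rw [Function.update_eq_self_iff, he0 hpq]
    have e2 : Function.update (Function.update (e q) p true) q false = e p := by
      funext k
      by_cases hkq : k = q
      · rw [hkq, Function.update_self, he0 hpq.symm]
      · rw [Function.update_of_ne hkq]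
        by_cases hkp : k = p
        · rw [hkp, Function.update_self, he1]
        · rw [Function.update_of_ne hkp, he0 hkq, he0 hkp]
    rwa [e1, e2] at this
  refine ⟨labelCoeff K P (e p), ?_⟩
  rw [← MvPolynomial.smul_eq_C_mul, map_smul, map_add]
  funext l
  rw [Pi.smul_apply, Pi.add_apply, labelCoeff_X, labelCoeff_X, smul_eq_mul, ← he, ← he]
  by_cases h0 : labelCoeff K P l = 0
  · rw [h0]
    by_cases hp : l = e p
    · rw [← hp, h0, zero_mul]
    · by_cases hq : l = e q
      · rw [← h3, ← hq, h0, zero_mul]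
      · rw [if_neg hp, if_neg hq, add_zero, mul_zero]
  · obtain ⟨k, hk⟩ := labelExp_degree_eq_one (hdeg l h0)
    rw [← he] at hk
    subst hk
    have hinj : ∀ {k k'}, k ≠ k' → ¬ e k = e k' := fun h h' =>
      h (update_false_injective (by rwa [he, he] at h'))
    by_cases hkp : k = p
    · subst hkp
      rw [if_pos rfl, if_neg (hinj hpq), add_zero, mul_one]
    · by_cases hkq : k = q
      · subst hkq
        rw [if_pos rfl, if_neg (hinj hkp), zero_add, mul_one, h3]
      · exact absurd (h2 k hkq hkp) h0

end Labels

/-- Both composites of `χ₀` and `χ₁` are multiplication by `x₁ - x₃`. This is the nondegeneracy that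
keeps the induced maps on cohomology from vanishing. -/
theorem chiMat_mul_chiMat {S : Type*} [CommRing S] (x₁ x₂ x₃ x₄ : S) (w : Bool) :
    chiMat x₁ x₂ x₃ x₄ w * chiMat x₁ x₂ x₃ x₄ (!w) =
      (x₁ - x₃) • (1 : Matrix (Fin 2 × Fin 2) (Fin 2 × Fin 2) S) := by
  ext ⟨p, i⟩ ⟨q, j⟩
  simp only [Matrix.mul_apply, Fintype.sum_prod_type, Fin.sum_univ_two, Matrix.smul_apply,
    Matrix.one_apply]
  cases w <;> fin_cases p <;> fin_cases q <;> fin_cases i <;> fin_cases j <;>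
    simp [chiMat, chiZero, chiOne] <;> ring

/-! ### The maps induced by `χ₀` and `χ₁`, up to scalars. -/

namespace Shadow

variable {Γ : Shadow} {σ : Γ.Edge → Bool}

variable (Γ) in
/-- The map `χ₀` or `χ₁` on the tensor product of the factorizations at all vertices; the Boolean
describes the target. -/
noncomputable def coreChi (c : Fin Γ.n) (w : Bool) : Γ.CoreChain →ₗ[Γ.Ring] Γ.CoreChain where
  toFun f g := ∑ u, Γ.atVertex c (fun x₁ x₂ x₃ x₄ => chiMat x₁ x₂ x₃ x₄ w) (g c) u *
    f (Function.update g c u)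
  map_add' f f' := by
    funext g; simp [mul_add, Finset.sum_add_distrib]
  map_smul' r f := by
    funext g; simp [Finset.mul_sum, mul_left_comm]

theorem coreChi_apply (c : Fin Γ.n) (w : Bool) (f : Γ.CoreChain) (g : Fin Γ.n → Fin 2 × Fin 2) :
    Γ.coreChi c w f g = ∑ u, Γ.atVertex c (fun x₁ x₂ x₃ x₄ => chiMat x₁ x₂ x₃ x₄ w) (g c) u *
      f (Function.update g c u) := rfl

theorem chi_slice (s : Γ.State) (c : Fin Γ.n) (f : Γ.Chain) (L : Fin Γ.loops → Bool) :
    (fun g => Γ.chi s c f (g, L)) = Γ.coreChi c (s c) fun g => f (g, L) := rfl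

theorem coreD_coreChi {s t : Γ.State} {c : Fin Γ.n} (ht : t = Γ.flip s c) (f : Γ.CoreChain) :
    Γ.coreD s (Γ.coreChi c (s c) f) = Γ.coreChi c (s c) (Γ.coreD t f) := by
  subst ht
  let f' : Γ.Chain := fun g => f g.1
  funext g
  have h1 := congrFun (Γ.d_chi s c f') (g, fun _ => false)
  rw [d_apply] at h1
  refine h1.trans ?_
  have h2 : (fun g => Γ.d (Γ.flip s c) f' (g, fun _ => false)) = Γ.coreD (Γ.flip s c) f := by
    funext g
    rw [d_apply]
  rw [← h2]
  rfl

theorem coreChi_coreChi_same (c : Fin Γ.n) (w : Bool) (f : Γ.CoreChain) :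
    Γ.coreChi c w (Γ.coreChi c (!w) f) =
      (MvPolynomial.X (c, false) - MvPolynomial.X (Γ.incoming c true) : Γ.Ring) • f := by
  funext g
  have h1 := chiMat_mul_chiMat (MvPolynomial.X (c, false) : Γ.Ring) (MvPolynomial.X (c, true))
    (MvPolynomial.X (Γ.incoming c true)) (MvPolynomial.X (Γ.incoming c false)) w
  simp only [coreChi_apply, Function.update_self, Function.update_idem, Finset.mul_sum]
  rw [Finset.sum_comm]
  simp only [← mul_assoc, ← Finset.sum_mul]
  have h2 : ∀ v, ∑ u, Γ.atVertex c (fun x₁ x₂ x₃ x₄ => chiMat x₁ x₂ x₃ x₄ w) (g c) u *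
      Γ.atVertex c (fun x₁ x₂ x₃ x₄ => chiMat x₁ x₂ x₃ x₄ (!w)) u v =
      if g c = v then MvPolynomial.X (c, false) - MvPolynomial.X (Γ.incoming c true) else 0 := by
    intro v
    have h3 := congrFun (congrFun h1 (g c)) v
    rw [Matrix.mul_apply] at h3
    refine h3.trans ?_
    rw [Matrix.smul_apply, Matrix.one_apply]
    split_ifs <;> simp
  simp only [h2, ite_mul, zero_mul]
  rw [Finset.sum_ite_eq, if_pos (Finset.mem_univ _), Function.update_eq_self]
  rfl

theorem coreChi_comm {c c' : Fin Γ.n} (hc : c ≠ c') (w w' : Bool) (f : Γ.CoreChain) :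
    Γ.coreChi c w (Γ.coreChi c' w' f) = Γ.coreChi c' w' (Γ.coreChi c w f) := by
  funext g
  simp only [coreChi_apply, Function.update_of_ne hc, Function.update_of_ne hc.symm,
    Finset.mul_sum]
  rw [Finset.sum_comm]
  refine Finset.sum_congr rfl fun u _ => Finset.sum_congr rfl fun v _ => ?_
  rw [Function.update_comm hc]
  ring

theorem coreChi_vecPart {s t : Γ.State} {c : Fin Γ.n} (ht : t = Γ.flip s c) (j : ℤ)
    (f : Γ.CoreChain) : Γ.coreChi c (s c) (vecPart (coreDeg t) j f) =
      vecPart (coreDeg s) (j + 1) (Γ.coreChi c (s c) f) := by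
  subst ht
  funext g
  rw [vecPart_apply, coreChi_apply, coreChi_apply, map_sum]
  refine Finset.sum_congr rfl fun u _ => ?_
  rw [vecPart_apply]
  refine (part_mul' (chiMat_isHomog _ _ _ _ (s c) (g c) u) ?_ _).symm
  rw [coreDeg, coreDeg, ← Finset.add_sum_erase _ _ (Finset.mem_univ c),
    ← Finset.add_sum_erase (a := c) (s := Finset.univ) _ (Finset.mem_univ c)]
  have h4 : ∑ c' ∈ Finset.univ.erase c, genDeg (Γ.flip s c c') (Function.update g c u c') =
      ∑ c' ∈ Finset.univ.erase c, genDeg (s c') (g c') :=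
    Finset.sum_congr rfl fun c' hc' => by
      rw [Function.update_of_ne (Finset.ne_of_mem_erase hc'), flip,
        Function.update_of_ne (Finset.ne_of_mem_erase hc')]
  rw [h4, Function.update_self, flip, Function.update_self]
  ring

theorem flip_apply (s : Γ.State) (c : Fin Γ.n) : Γ.flip s c c = !s c := Function.update_self ..

theorem flip_apply_ne (s : Γ.State) {c c' : Fin Γ.n} (h : c' ≠ c) : Γ.flip s c c' = s c' :=
  Function.update_of_ne h ..

theorem flip_flip (s : Γ.State) (c : Fin Γ.n) : Γ.flip (Γ.flip s c) c = s := by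
  rw [flip, flip_apply, flip, Function.update_idem, Bool.not_not, Function.update_eq_self]

theorem flip_comm (s : Γ.State) {c c' : Fin Γ.n} (h : c ≠ c') :
    Γ.flip (Γ.flip s c) c' = Γ.flip (Γ.flip s c') c := by
  rw [flip, flip_apply_ne _ h.symm, flip, Function.update_comm h, flip, flip,
    Function.update_of_ne h]

/-- If both arcs at `c` lie on the same circle, then this circle contains all edges at `c`. -/
theorem eq_of_joined {α : Type*} (F : Γ.Edge → α) {s t : Γ.State} {c : Fin Γ.n}
    (ht : t = Γ.flip s c) (hF : ∀ e e', Γ.Joined t e e' → F e = F e')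
    (hx : F (c, false) = F (Γ.incoming c true)) {e e' : Γ.Edge} (he : Γ.Joined s e e') :
    F e = F e' := by
  obtain ⟨c', hc'⟩ := he
  by_cases hcc : c' = c
  · subst hcc
    have htc : t c' = !s c' := by rw [ht, flip_apply]
    rcases hc' with ⟨hs, b, rfl, rfl⟩ | ⟨hs, ⟨rfl, rfl⟩ | ⟨rfl, rfl⟩⟩
    · rw [hs] at htc
      have h1 := hF _ _ ⟨c', Or.inr ⟨htc, Or.inl ⟨rfl, rfl⟩⟩⟩
      have h2 := hF _ _ ⟨c', Or.inr ⟨htc, Or.inr ⟨rfl, rfl⟩⟩⟩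
      cases b
      · rw [h2, hx]
      · rw [← hx, h1]
    · rw [hs] at htc
      have h1 := hF _ _ ⟨c', Or.inl ⟨htc, true, rfl, rfl⟩⟩
      rw [hx, h1]
    · rw [hs] at htc
      have h1 := hF _ _ ⟨c', Or.inl ⟨htc, false, rfl, rfl⟩⟩
      rw [h1, hx]
  · refine hF _ _ ⟨c', ?_⟩
    rwa [ht, flip_apply_ne _ hcc]

/-- The two arcs at `c` lie on the same circle. -/
def OneCircle (s : Γ.State) (c : Fin Γ.n) : Prop :=
  Quot.mk (Γ.Joined s) (c, false) = Quot.mk (Γ.Joined s) (Γ.incoming c true)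

/-- Once the two arcs at `c` are joined, all four edges there are identified, whichever smoothing
was made; elsewhere the smoothings coincide. -/
theorem card_glued {s t : Γ.State} {c : Fin Γ.n} (ht : t = Γ.flip s c) :
    Nat.card (Quot fun e e' => Γ.Joined s e e' ∨ (e = (c, false) ∧ e' = Γ.incoming c true)) =
    Nat.card (Quot fun e e' => Γ.Joined t e e' ∨ (e = (c, false) ∧ e' = Γ.incoming c true)) := by
  have hs : s = Γ.flip t c := by rw [ht, flip_flip]
  refine Nat.card_congr ⟨Quot.lift (Quot.mk _) ?_, Quot.lift (Quot.mk _) ?_, ?_, ?_⟩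
  · rintro e e' (he | ⟨rfl, rfl⟩)
    · exact eq_of_joined (Quot.mk _) ht (fun e e' h => Quot.sound (Or.inl h))
        (Quot.sound (Or.inr ⟨rfl, rfl⟩)) he
    · exact Quot.sound (Or.inr ⟨rfl, rfl⟩)
  · rintro e e' (he | ⟨rfl, rfl⟩)
    · exact eq_of_joined (Quot.mk _) hs (fun e e' h => Quot.sound (Or.inl h))
        (Quot.sound (Or.inr ⟨rfl, rfl⟩)) he
    · exact Quot.sound (Or.inr ⟨rfl, rfl⟩)
  · intro k
    induction k using Quot.ind
    rfl
  · intro k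
    induction k using Quot.ind
    rfl

open Classical in
-- Joining the two arcs at `c` lowers the number of circles by one unless they already lie on the
-- same circle, and both smoothings lead to the same count.
theorem card_flip {s t : Γ.State} {c : Fin Γ.n} (ht : t = Γ.flip s c) :
    Fintype.card (Quot (Γ.Joined s)) + (if OneCircle t c then 0 else 1) =
      Fintype.card (Quot (Γ.Joined t)) + (if OneCircle s c then 0 else 1) := by
  have h1 : _ + (if OneCircle s c then 0 else 1) = _ :=
    card_quot_glue_add (Γ.Joined s) (c, false) (Γ.incoming c true)
  have h2 : _ + (if OneCircle t c then 0 else 1) = _ :=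
    card_quot_glue_add (Γ.Joined t) (c, false) (Γ.incoming c true)
  rw [card_glued ht] at h1
  rw [Nat.card_eq_fintype_card (α := Quot (Γ.Joined s))] at h1
  rw [Nat.card_eq_fintype_card (α := Quot (Γ.Joined t))] at h2
  omega

theorem exists_generator (h : Γ.IsColoring σ) (s : Γ.State) :
    ∃ f, Γ.coreD s f = 0 ∧ coreMap h s f = evalLabels σ s 1 ∧
      vecPart (coreDeg s) (-(Fintype.card (Quot (Γ.Joined s)) : ℤ)) f = f := by
  obtain ⟨f, hf, hf'⟩ := exists_coreMap_eq h s (evalLabels σ s 1)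
  refine ⟨vecPart (coreDeg s) (-(Fintype.card (Quot (Γ.Joined s)) : ℤ)) f, ?_, ?_, ?_⟩
  · rw [coreD_vecPart, hf, map_zero]
  · funext l
    rw [coreMap_vecPart, hf', evalLabels_apply, map_one, labelCoeff_one]
    split_ifs with h1 h2 h2
    · rfl
    · rfl
    · refine absurd ?_ h1
      rw [h2, sum_circleDeg, labelExp_degree]
      simp
    · rfl
  · funext g
    rw [vecPart_apply]
    exact (part_isHomog _ _).part_eq

open Classical in
/-- The image of `1`, up to a scalar, under the map induced by `χ₀` or `χ₁` at `c`. -/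
noncomputable def edgeFactor (σ : Γ.Edge → Bool) (s : Γ.State) (c : Fin Γ.n) : Γ.Ring :=
  if OneCircle s c then 1 else signedX σ (c, false) + signedX σ (Γ.incoming c true)

/-- The two edges have opposite colours, so a difference of variables becomes, up to sign, a sum of
circle variables. -/
theorem X_sub_X (h : Γ.IsColoring σ) (c : Fin Γ.n) :
    (MvPolynomial.X (c, false) - MvPolynomial.X (Γ.incoming c true) : Γ.Ring) =
      MvPolynomial.C (colorSign σ (c, false)) *
        (signedX σ (c, false) + signedX σ (Γ.incoming c true)) := by
  have h1 : colorSign σ (Γ.incoming c true) = -colorSign σ (c, false) := by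
    rw [colorSign, colorSign, (h c).2.2]
    cases σ (c, false) <;> simp
  rw [← C_colorSign_mul_signedX σ (c, false), ← C_colorSign_mul_signedX σ (Γ.incoming c true), h1,
    map_neg]
  ring

theorem coreMap_coreChi_eq_zero (h : Γ.IsColoring σ) {s t : Γ.State} {c : Fin Γ.n}
    (ht : t = Γ.flip s c) {f : Γ.CoreChain} (hf : Γ.coreD t f = 0) (hf' : coreMap h t f = 0) :
    coreMap h s (Γ.coreChi c (s c) f) = 0 := by
  obtain ⟨k, rfl⟩ := exists_coreD_eq h t f hf hf'
  rw [← coreD_coreChi ht, coreMap_coreD]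

theorem evalLabels_signedX_add_ne_zero (σ : Γ.Edge → Bool) (s : Γ.State) (e e' : Γ.Edge) {a : ℚ}
    (ha : a ≠ 0) : evalLabels σ s (MvPolynomial.C a * (signedX σ e + signedX σ e')) ≠ 0 := by
  rw [← MvPolynomial.smul_eq_C_mul, map_smul, evalLabels_apply, map_add, toCircles_signedX,
    toCircles_signedX]
  exact smul_ne_zero ha (labelCoeff_X_add_X_ne_zero _ _)

theorem colorSign_ne_zero (σ : Γ.Edge → Bool) (e : Γ.Edge) : colorSign σ e ≠ 0 := fun h => by
  have := colorSign_mul_self σ e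
  rw [h, zero_mul] at this
  exact zero_ne_one this

/-- The image of the generator is nonzero and of known degree. When circles merge, only multiples of
`1` have this degree. When one circle splits into `p` and `q`, the image has degree one in the
variables and is killed by `X_p - X_q`, because `X_p` and `X_q` agree in the source; so it is a
multiple of `X_p + X_q`. -/
theorem exists_edgeScalar_generator (h : Γ.IsColoring σ) {s t : Γ.State} {c : Fin Γ.n}
    (ht : t = Γ.flip s c) (f : Γ.CoreChain) (hf : Γ.coreD t f = 0)
    (hf1 : coreMap h t f = evalLabels σ t 1)
    (hfj : vecPart (coreDeg t) (-(Fintype.card (Quot (Γ.Joined t)) : ℤ)) f = f) :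
    (OneCircle s c ↔ ¬ OneCircle t c) ∧ ∃ a : ℚ, a ≠ 0 ∧ coreMap h s (Γ.coreChi c (s c) f) =
      evalLabels σ s (MvPolynomial.C a * edgeFactor σ s c) := by
  classical
  have hs : s = Γ.flip t c := by rw [ht, flip_flip]
  have htc : t c = !s c := by rw [ht, flip_apply]
  have hcyc : Γ.coreD s (Γ.coreChi c (s c) f) = 0 := by rw [coreD_coreChi ht, hf, map_zero]
  -- Applying the opposite map returns `±(X_p + X_q)` times the generator, which is nonzero even
  -- when `p = q`.
  have hne : coreMap h s (Γ.coreChi c (s c) f) ≠ 0 := by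
    intro h0
    have h1 := coreMap_coreChi_eq_zero h hs hcyc h0
    have h2 : s c = !t c := by rw [htc, Bool.not_not]
    rw [h2, coreChi_coreChi_same, coreMap_smul h t _ 1 hf1, X_sub_X h, mul_one] at h1
    exact evalLabels_signedX_add_ne_zero σ t _ _ (colorSign_ne_zero σ _) h1
  have hdeg : ∀ l, coreMap h s (Γ.coreChi c (s c) f) l ≠ 0 →
      2 * ((labelExp l).degree : ℤ) - Fintype.card (Quot (Γ.Joined s)) =
        -(Fintype.card (Quot (Γ.Joined t)) : ℤ) + 1 := by
    intro l hl
    rw [← hfj, coreChi_vecPart ht, coreMap_vecPart, sum_circleDeg] at hl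
    by_contra hc
    exact hl (if_neg hc)
  obtain ⟨l₀, hl₀⟩ : ∃ l, coreMap h s (Γ.coreChi c (s c) f) l ≠ 0 := by
    by_contra hc
    push Not at hc
    exact hne (funext hc)
  have hl₀d := hdeg l₀ hl₀
  have hcard := card_flip ht
  -- If the arcs were joined in both smoothings or in neither, the numbers of circles would agree,
  -- and `hl₀d` would make twice an integer equal to one.
  have hiff : OneCircle s c ↔ ¬ OneCircle t c := by
    by_cases h1 : OneCircle s c <;> by_cases h2 : OneCircle t c <;> simp only [h1, h2] at hcard ⊢
    · simp at hcard
      omega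
    · simp
    · simp
    · simp at hcard
      omega
  refine ⟨hiff, ?_⟩
  obtain ⟨A, hA⟩ := evalLabels_surjective σ s (coreMap h s (Γ.coreChi c (s c) f))
  by_cases h1 : OneCircle s c
  · have h2 := hiff.1 h1
    rw [if_neg h2, if_pos h1] at hcard
    have h0 : ∀ l, coreMap h s (Γ.coreChi c (s c) f) l ≠ 0 → l = fun _ => false := fun l hl =>
      labelExp_degree_eq_zero (by have := hdeg l hl; omega)
    refine ⟨coreMap h s (Γ.coreChi c (s c) f) fun _ => false, ?_, ?_⟩
    · rw [← h0 l₀ hl₀]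
      exact hl₀
    · rw [edgeFactor, if_pos h1, ← MvPolynomial.smul_eq_C_mul, map_smul, evalLabels_apply, map_one]
      funext l
      rw [Pi.smul_apply, labelCoeff_one, smul_eq_mul]
      split_ifs with hl
      · rw [hl, mul_one]
      · rw [mul_zero]
        by_contra hc
        exact hl (h0 l hc)
  · have h2 : OneCircle t c := by
      by_contra h2
      exact h1 (hiff.2 h2)
    rw [if_pos h2, if_neg h1] at hcard
    -- The annihilation hypothesis holds because the difference acts as zero on the source.
    have h3 := exists_eq_of_degree_one h1 (toCircles σ s A) (fun l hl => by
      rw [← evalLabels_apply, hA] at hl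
      have := hdeg l hl
      omega) (by
      rw [← toCircles_signedX σ s (c, false), ← toCircles_signedX σ s (Γ.incoming c true),
        ← map_sub, ← map_mul, ← evalLabels_apply, ← coreMap_smul h s _ _ hA.symm, ← map_smul]
      refine coreMap_coreChi_eq_zero h ht (by rw [map_smul, hf, smul_zero]) ?_
      rw [coreMap_smul h t _ _ hf1, mul_one, evalLabels_apply, map_sub, toCircles_signedX,
        toCircles_signedX, h2, sub_self, map_zero])
    obtain ⟨a, ha⟩ := h3
    refine ⟨a, ?_, ?_⟩
    · rintro rfl
      rw [← evalLabels_apply, hA, map_zero, zero_mul, map_zero] at ha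
      exact hne ha
    · have h4 : toCircles σ s (MvPolynomial.C a *
          (signedX σ (c, false) + signedX σ (Γ.incoming c true))) = MvPolynomial.C a *
            (MvPolynomial.X (Quot.mk _ (c, false)) +
              MvPolynomial.X (Quot.mk _ (Γ.incoming c true))) := by
        rw [map_mul, map_add, toCircles_signedX, toCircles_signedX, MvPolynomial.algHom_C,
          MvPolynomial.algebraMap_eq]
      rw [← hA, evalLabels_apply, ha, edgeFactor, if_neg h1, evalLabels_apply, h4]

theorem oneCircle_iff (h : Γ.IsColoring σ) {s t : Γ.State} {c : Fin Γ.n}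
    (ht : t = Γ.flip s c) : OneCircle s c ↔ ¬ OneCircle t c := by
  obtain ⟨f, hf, hf1, hfj⟩ := exists_generator h t
  exact (exists_edgeScalar_generator h ht f hf hf1 hfj).1

/-- The classes form a cyclic module over the polynomial ring and the map is linear over it, so the
image of the generator determines everything. -/
theorem exists_edgeScalar (h : Γ.IsColoring σ) {s t : Γ.State} {c : Fin Γ.n}
    (ht : t = Γ.flip s c) : ∃ a : ℚ, a ≠ 0 ∧ ∀ f r, Γ.coreD t f = 0 →
      coreMap h t f = evalLabels σ t r → coreMap h s (Γ.coreChi c (s c) f) =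
        evalLabels σ s (MvPolynomial.C a * (edgeFactor σ s c * r)) := by
  obtain ⟨f₀, hf₀, hf1, hfj⟩ := exists_generator h t
  obtain ⟨-, a, ha, haf⟩ := exists_edgeScalar_generator h ht f₀ hf₀ hf1 hfj
  refine ⟨a, ha, fun f r hf hfr => ?_⟩
  have h1 : coreMap h s (Γ.coreChi c (s c) (f - r • f₀)) = 0 := by
    refine coreMap_coreChi_eq_zero h ht ?_ ?_
    · rw [map_sub, map_smul, hf, hf₀, smul_zero, sub_zero]
    · rw [map_sub, hfr, coreMap_smul h t _ _ hf1, mul_one, sub_self]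
  rw [map_sub, map_smul, map_sub, sub_eq_zero, coreMap_smul h s _ _ haf] at h1
  rw [h1]
  ring_nf

/-- The scalar by which `χ₀` or `χ₁` at `c` differs from a map of Khovanov's Frobenius algebra. -/
noncomputable def edgeScalar (h : Γ.IsColoring σ) (s : Γ.State) (c : Fin Γ.n) : ℚ :=
  (exists_edgeScalar h (rfl : Γ.flip s c = Γ.flip s c)).choose

theorem edgeScalar_ne_zero (h : Γ.IsColoring σ) (s : Γ.State) (c : Fin Γ.n) :
    edgeScalar h s c ≠ 0 :=
  (exists_edgeScalar h (rfl : Γ.flip s c = Γ.flip s c)).choose_spec.1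

theorem coreMap_coreChi (h : Γ.IsColoring σ) {s t : Γ.State} {c : Fin Γ.n}
    (ht : t = Γ.flip s c) {f : Γ.CoreChain} {r : Γ.Ring} (hf : Γ.coreD t f = 0)
    (hfr : coreMap h t f = evalLabels σ t r) : coreMap h s (Γ.coreChi c (s c) f) =
      evalLabels σ s (MvPolynomial.C (edgeScalar h s c) * (edgeFactor σ s c * r)) := by
  subst ht
  exact (exists_edgeScalar h (rfl : Γ.flip s c = Γ.flip s c)).choose_spec.2 f r hf hfr

end Shadow

/-! ### Multiplicative cocycles on a cube. -/

section Coboundary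

variable {n : ℕ}

/-- A multiplicative function on the edges of a cube which commutes on all squares is a
coboundary. -/
theorem exists_potential (ω : (Fin n → Bool) → Fin n → ℚ) (hω : ∀ t c, ω t c ≠ 0)
    (hsq : ∀ t c c', c ≠ c' → t c = true → t c' = true →
      ω t c * ω (Function.update t c false) c' = ω t c' * ω (Function.update t c' false) c) :
    ∃ μ : (Fin n → Bool) → ℚ, (∀ t, μ t ≠ 0) ∧
      ∀ t c, t c = true → μ t = ω t c * μ (Function.update t c false) := by
  classical
  -- The product of `ω` along the path from the zero vertex to `t` which switches coordinates on in
  -- increasing order.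
  let μ : (Fin n → Bool) → ℚ := fun t =>
    ∏ c, if t c then ω (fun c' => t c' && decide (c' ≤ c)) c else 1
  have hmax : ∀ t m, t m = true → (∀ c, m < c → t c = false) →
      μ t = ω t m * μ (Function.update t m false) := by
    intro t m hm hlt
    change (∏ c, _) = _ * ∏ c, _
    rw [← Finset.mul_prod_erase _ _ (Finset.mem_univ m),
      ← Finset.mul_prod_erase (a := m) (s := Finset.univ) _ (Finset.mem_univ m), if_pos hm,
      Function.update_self, if_neg (by simp), one_mul]
    congr 1
    · congr 1
      funext c
      by_cases hc : c ≤ m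
      · simp [hc]
      · simp [hc, hlt c (not_le.1 hc)]
    · refine Finset.prod_congr rfl fun c hc => ?_
      have hcm := Finset.ne_of_mem_erase hc
      rw [Function.update_of_ne hcm]
      by_cases htc : t c = true
      · rw [if_pos htc, if_pos htc]
        have hlt' : c < m := by
          refine lt_of_le_of_ne (not_lt.1 fun h => ?_) hcm
          rw [hlt c h] at htc
          exact absurd htc (by simp)
        congr 1
        funext c'
        by_cases h1 : c' = m
        · subst h1
          simp [not_le.2 hlt']
        · rw [Function.update_of_ne h1]
      · rw [if_neg htc, if_neg htc]
  refine ⟨μ, fun t => Finset.prod_ne_zero_iff.2 fun c _ => ?_, ?_⟩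
  · split_ifs
    · exact hω _ _
    · exact one_ne_zero
  · suffices H : ∀ (N : ℕ) (t : Fin n → Bool), (Finset.univ.filter fun c => t c = true).card = N →
        ∀ c, t c = true → μ t = ω t c * μ (Function.update t c false) from
      fun t => H _ t rfl
    intro N
    induction N with
    | zero =>
      intro t ht c hc
      exact absurd (Finset.mem_filter.2 ⟨Finset.mem_univ c, hc⟩)
        (Finset.card_eq_zero.1 ht ▸ Finset.notMem_empty c)
    | succ N ih =>
      intro t ht c hc
      have hne : (Finset.univ.filter fun c => t c = true).Nonempty :=
        ⟨c, Finset.mem_filter.2 ⟨Finset.mem_univ c, hc⟩⟩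
      obtain ⟨m, hm, hmm⟩ := Finset.exists_max_image _ id hne
      simp only [Finset.mem_filter, Finset.mem_univ, true_and, id_eq] at hm hmm
      have hlt : ∀ c', m < c' → t c' = false := fun c' h =>
        Bool.eq_false_iff.2 fun h' => absurd h (not_lt.2 (hmm c' h'))
      by_cases hcm : c = m
      · subst hcm
        exact hmax t c hc hlt
      · have hcard : (Finset.univ.filter fun c => Function.update t m false c = true).card = N := by
          have h1 : (Finset.univ.filter fun c => Function.update t m false c = true) =
              (Finset.univ.filter fun c => t c = true).erase m := by
            ext c'
            by_cases h : c' = m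
            · subst h; simp
            · simp [h]
          rw [h1, Finset.card_erase_of_mem (by simpa using hm), ht, Nat.add_sub_cancel]
        -- The maximal coordinate `m` is removed from both vertices. The induction hypothesis then
        -- applies below, and the square at `m` and `c` exchanges the factors.
        rw [hmax t m hm hlt, ih _ hcard c (by rw [Function.update_of_ne hcm, hc]),
          hmax (Function.update t c false) m (by rw [Function.update_of_ne (Ne.symm hcm), hm])
            (fun c' h => by
              by_cases h1 : c' = c
              · rw [h1, Function.update_self]
              · rw [Function.update_of_ne h1, hlt c' h]),
          Function.update_comm hcm, ← mul_assoc, ← mul_assoc, hsq t m c (Ne.symm hcm) hm hc]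

end Coboundary

/-! ### A positive functional which detects composites of edge maps. -/

section Mass

variable {K : Type*} [Fintype K]

open Classical in
/-- The sum of the coefficients of all squarefree monomials. -/
noncomputable def mass (K : Type*) [Fintype K] : MvPolynomial K ℚ →ₗ[ℚ] ℚ :=
  ∑ l, LinearMap.proj l ∘ₗ labelCoeff K

open Classical in
theorem mass_apply (P : MvPolynomial K ℚ) : mass K P = ∑ l, labelCoeff K P l := by
  simp only [mass, LinearMap.sum_apply, LinearMap.comp_apply, LinearMap.proj_apply]

theorem mass_one : mass K 1 = 1 := by
  classical
  rw [mass_apply]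
  simp only [labelCoeff_one]
  rw [Finset.sum_ite_eq' _ _ fun _ => (1 : ℚ), if_pos (Finset.mem_univ _)]

theorem mass_X (k : K) : mass K (MvPolynomial.X k) = 1 := by
  classical
  rw [mass_apply]
  simp only [labelCoeff_X]
  rw [Finset.sum_ite_eq' _ _ fun _ => (1 : ℚ), if_pos (Finset.mem_univ _)]

theorem labelCoeff_X_mul_X_nonneg (k k' : K) (l : K → Bool) :
    0 ≤ labelCoeff K (MvPolynomial.X k * MvPolynomial.X k') l := by
  classical
  rw [labelCoeff_X_mul, labelCoeff_X]
  split_ifs <;> norm_num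

theorem mass_X_mul_X_nonneg (k k' : K) :
    0 ≤ mass K (MvPolynomial.X k * MvPolynomial.X k') := by
  rw [mass_apply]
  exact Finset.sum_nonneg fun l _ => labelCoeff_X_mul_X_nonneg k k' l

theorem mass_X_mul_X_pos {k k' : K} (h : k ≠ k') :
    0 < mass K (MvPolynomial.X k * MvPolynomial.X k') := by
  classical
  rw [mass_apply]
  refine Finset.sum_pos' (fun l _ => labelCoeff_X_mul_X_nonneg k k' l)
    ⟨Function.update (Function.update (fun _ => false) k' true) k true, Finset.mem_univ _, ?_⟩
  rw [labelCoeff_X_mul, Function.update_self, if_pos rfl, Function.update_idem, labelCoeff_X,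
    if_pos]
  · exact one_pos
  · rw [Function.update_eq_self_iff, Function.update_of_ne h]

/-- All four products have nonnegative mass. Since `p' ≠ q'`, the variable `X_p` meets a different
one among `X_p'` and `X_q'`, which gives a nonzero squarefree term. -/
theorem mass_mul_pos {p q p' q' : K} (h' : p' ≠ q') :
    0 < mass K ((MvPolynomial.X p + MvPolynomial.X q) *
      (MvPolynomial.X p' + MvPolynomial.X q')) := by
  have e1 : (MvPolynomial.X p + MvPolynomial.X q : MvPolynomial K ℚ) *
      (MvPolynomial.X p' + MvPolynomial.X q') =
      MvPolynomial.X p * MvPolynomial.X p' + MvPolynomial.X p * MvPolynomial.X q' +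
      (MvPolynomial.X q * MvPolynomial.X p' + MvPolynomial.X q * MvPolynomial.X q') := by ring
  rw [e1, map_add, map_add, map_add]
  have h1 := mass_X_mul_X_nonneg p p'
  have h2 := mass_X_mul_X_nonneg p q'
  have h3 := mass_X_mul_X_nonneg q p'
  have h4 := mass_X_mul_X_nonneg q q'
  by_cases hp : p = p'
  · have := mass_X_mul_X_pos (fun h => h' (hp.symm.trans h) : p ≠ q')
    linarith
  · have := mass_X_mul_X_pos hp
    linarith

end Mass

/-! ### Commutativity of the scalars on squares. -/

namespace Shadow

variable {Γ : Shadow} {σ : Γ.Edge → Bool}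

theorem mass_signedX (s : Γ.State) (e e' : Γ.Edge) :
    mass _ (toCircles σ s (signedX σ e + signedX σ e')) = 2 := by
  rw [map_add, toCircles_signedX, toCircles_signedX, map_add, mass_X, mass_X]
  norm_num

/-- Both paths around a square have the same total change in the number of circles, hence the same
number of splittings. The mass is `1` without splittings and `2` with one. With two splittings the
two products agree and positivity applies. -/
theorem mass_edgeFactor (h : Γ.IsColoring σ) (s : Γ.State) {c c' : Fin Γ.n} (hc : c ≠ c') :
    mass _ (toCircles σ s (edgeFactor σ s c * edgeFactor σ (Γ.flip s c) c')) =
      mass _ (toCircles σ s (edgeFactor σ s c' * edgeFactor σ (Γ.flip s c') c)) ∧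
    mass _ (toCircles σ s (edgeFactor σ s c * edgeFactor σ (Γ.flip s c) c')) ≠ 0 := by
  classical
  have k1 := card_flip (rfl : Γ.flip s c = Γ.flip s c)
  have k2 := card_flip (rfl : Γ.flip (Γ.flip s c) c' = Γ.flip (Γ.flip s c) c')
  have k3 := card_flip (rfl : Γ.flip s c' = Γ.flip s c')
  have k4 := card_flip (flip_comm s hc)
  have o1 := oneCircle_iff h (rfl : Γ.flip s c = Γ.flip s c)
  have o2 := oneCircle_iff h (rfl : Γ.flip (Γ.flip s c) c' = Γ.flip (Γ.flip s c) c')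
  have o3 := oneCircle_iff h (rfl : Γ.flip s c' = Γ.flip s c')
  have o4 := oneCircle_iff h (flip_comm s hc)
  by_cases a1 : OneCircle s c <;> by_cases a2 : OneCircle (Γ.flip s c) c' <;>
    by_cases a3 : OneCircle s c' <;> by_cases a4 : OneCircle (Γ.flip s c') c <;>
    simp only [a1, a2, a3, a4, true_iff, false_iff, not_not, edgeFactor, if_true, if_false, one_mul,
      mul_one, mass_signedX, map_one, mass_one]
      at o1 o2 o3 o4 k1 k2 k3 k4 ⊢ <;>
    simp only [o1, o2, o3, o4, if_true, if_false] at k1 k2 k3 k4 <;>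
    first
    | (exfalso; omega)
    | (refine ⟨trivial, ?_⟩; norm_num)
    | skip
  · refine ⟨by rw [mul_comm], ?_⟩
    rw [map_mul, map_add, map_add, toCircles_signedX, toCircles_signedX, toCircles_signedX,
      toCircles_signedX]
    exact (mass_mul_pos a3).ne'

/-- The `χ` maps at different vertices commute. Applied to the generator, the two composites yield
equal multiples of elements of equal nonzero mass, so the scalars can be compared after
cancellation. -/
theorem edgeScalar_square (h : Γ.IsColoring σ) (s : Γ.State) {c c' : Fin Γ.n} (hc : c ≠ c') :
    edgeScalar h s c * edgeScalar h (Γ.flip s c) c' =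
      edgeScalar h s c' * edgeScalar h (Γ.flip s c') c := by
  classical
  obtain ⟨f, hf, hf1, -⟩ := exists_generator h (Γ.flip (Γ.flip s c) c')
  have key : ∀ {c c' : Fin Γ.n} {t u : Γ.State}, c ≠ c' → t = Γ.flip s c → u = Γ.flip t c' →
      Γ.coreD u f = 0 → coreMap h u f = evalLabels σ u 1 →
      coreMap h s (Γ.coreChi c (s c) (Γ.coreChi c' (s c') f)) =
        (edgeScalar h s c * edgeScalar h t c') •
          evalLabels σ s (edgeFactor σ s c * edgeFactor σ t c') := by
    intro c c' t u hc ht hu hf hf1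
    have e1 : t c' = s c' := by rw [ht, flip_apply_ne _ hc.symm]
    have e2 := coreMap_coreChi h hu hf hf1
    have e3 : Γ.coreD t (Γ.coreChi c' (t c') f) = 0 := by rw [coreD_coreChi hu, hf, map_zero]
    rw [← e1, coreMap_coreChi h ht e3 e2, ← map_smul, MvPolynomial.smul_eq_C_mul, MvPolynomial.C_mul]
    ring_nf
  have h1 := key hc rfl rfl hf hf1
  have h2 := key hc.symm rfl (flip_comm s hc) hf hf1
  rw [coreChi_comm hc, h2] at h1
  obtain ⟨m1, m2⟩ := mass_edgeFactor h s hc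
  have h3 := congrArg (fun F : (Quot (Γ.Joined s) → Bool) → ℚ => ∑ l, F l) h1
  simp only [Pi.smul_apply, smul_eq_mul, ← Finset.mul_sum, evalLabels_apply] at h3
  rw [← mass_apply, ← mass_apply, ← m1] at h3
  exact (mul_right_cancel₀ m2 h3).symm

end Shadow
-- Comparison with multiplication and comultiplication.
namespace Shadow

variable {Γ : Shadow} {σ : Γ.Edge → Bool}

/-- An edge on one of the circles which meet `c`. -/
def Near (s : Γ.State) (c : Fin Γ.n) (e : Γ.Edge) : Prop :=
  Quot.mk (Γ.Joined s) e = Quot.mk _ (c, false) ∨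
    Quot.mk (Γ.Joined s) e = Quot.mk _ (Γ.incoming c true)

open Classical in
/-- The circle of an edge, if the circles which meet `c` are identified with each other. -/
noncomputable def farCircle (s : Γ.State) (c : Fin Γ.n) (e : Γ.Edge) :
    Option (Quot (Γ.Joined s)) :=
  if Near s c e then none else some (Quot.mk _ e)

theorem farCircle_eq_none_iff {s : Γ.State} {c : Fin Γ.n} {e : Γ.Edge} :
    farCircle s c e = none ↔ Near s c e := by
  rw [farCircle]
  split_ifs with h <;> simp [h]

/-- Collapsing all circles at `c` removes the dependence on the smoothing there. -/
theorem farCircle_eq_farCircle {s t : Γ.State} {c : Fin Γ.n} (ht : t = Γ.flip s c)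
    {e e' : Γ.Edge} (h : Quot.mk (Γ.Joined s) e = Quot.mk _ e') :
    farCircle t c e = farCircle t c e' := by
  have h1 : ∀ a b, Γ.Joined s a b → farCircle t c a = farCircle t c b := fun a b hab => by
    refine eq_of_joined (farCircle t c) ht (fun a b hab => ?_) ?_ hab
    · rw [farCircle, farCircle, Near, Near, Quot.sound hab]
    · rw [farCircle_eq_none_iff.2 (Or.inl rfl), farCircle_eq_none_iff.2 (Or.inr rfl)]
  exact congrArg (Quot.lift (farCircle t c) h1) h

theorem Near.of_flip {s t : Γ.State} {c : Fin Γ.n} (ht : t = Γ.flip s c) {e : Γ.Edge}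
    (h : Near s c e) : Near t c e := by
  rw [← farCircle_eq_none_iff]
  rcases h with h | h
  · rw [farCircle_eq_farCircle ht h, farCircle_eq_none_iff]
    exact Or.inl rfl
  · rw [farCircle_eq_farCircle ht h, farCircle_eq_none_iff]
    exact Or.inr rfl

theorem near_iff {s t : Γ.State} {c : Fin Γ.n} (ht : t = Γ.flip s c) {e : Γ.Edge} :
    Near s c e ↔ Near t c e :=
  ⟨Near.of_flip ht, Near.of_flip (by rw [ht, flip_flip])⟩

theorem mk_eq_of_not_near {s t : Γ.State} {c : Fin Γ.n} (ht : t = Γ.flip s c) {e e' : Γ.Edge}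
    (he : ¬ Near t c e) (h : Quot.mk (Γ.Joined s) e = Quot.mk _ e') :
    Quot.mk (Γ.Joined t) e = Quot.mk _ e' := by
  have h1 := farCircle_eq_farCircle ht h
  have h2 : ¬ Near t c e' := by
    rwa [← farCircle_eq_none_iff, ← h1, farCircle_eq_none_iff]
  rw [farCircle, farCircle, if_neg he, if_neg h2] at h1
  exact Option.some_injective _ h1

/-- Circles which do not meet `c` are the same in both smoothings. -/
theorem mk_eq_iff_of_not_near {s t : Γ.State} {c : Fin Γ.n} (ht : t = Γ.flip s c)
    {e e' : Γ.Edge} (he : ¬ Near t c e) :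
    Quot.mk (Γ.Joined s) e = Quot.mk _ e' ↔ Quot.mk (Γ.Joined t) e = Quot.mk _ e' :=
  ⟨mk_eq_of_not_near ht he, mk_eq_of_not_near (by rw [ht, flip_flip])
    fun h => he ((near_iff ht).1 h)⟩

/-- The labels of all edges which do not lie on a circle which meets `c` agree. -/
def Agree {s t : Γ.State} (c : Fin Γ.n) (x : Quot (Γ.Joined t) → Bool)
    (y : Quot (Γ.Joined s) → Bool) : Prop :=
  ∀ e, ¬ Near t c e → x (Quot.mk _ e) = y (Quot.mk _ e)

open Classical in
/-- The coefficients of the map of Khovanov's Frobenius algebra at `c`. -/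
noncomputable def frobCoeff {s t : Γ.State} (c : Fin Γ.n) (x : Quot (Γ.Joined t) → Bool)
    (y : Quot (Γ.Joined s) → Bool) : ℤ :=
  if Agree c x y then
    if OneCircle t c then
      LinkDiagram.comulCoeff (x (Quot.mk _ (c, false))) (y (Quot.mk _ (c, false)))
        (y (Quot.mk _ (Γ.incoming c true)))
    else
      LinkDiagram.mulCoeff (x (Quot.mk _ (c, false))) (x (Quot.mk _ (Γ.incoming c true)))
        (y (Quot.mk _ (c, false)))
  else 0

open Classical in
theorem agree_update_iff {s t : Γ.State} {c : Fin Γ.n} (ht : t = Γ.flip s c) {e : Γ.Edge}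
    (he : ¬ Near t c e) (z : Quot (Γ.Joined t) → Bool) (y : Quot (Γ.Joined s) → Bool) :
    (z (Quot.mk _ e) = false ∧ Agree c (Function.update z (Quot.mk _ e) true) y) ↔
      (y (Quot.mk _ e) = true ∧ Agree c z (Function.update y (Quot.mk _ e) false)) := by
  constructor
  · rintro ⟨h1, h2⟩
    refine ⟨by rw [← h2 e he, Function.update_self], fun e' he' => ?_⟩
    by_cases h3 : Quot.mk (Γ.Joined t) e' = Quot.mk _ e
    · rw [h3, (mk_eq_iff_of_not_near ht he').2 h3, Function.update_self, h1]
    · rw [Function.update_of_ne fun h => h3 ((mk_eq_iff_of_not_near ht he').1 h), ← h2 e' he',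
        Function.update_of_ne h3]
  · rintro ⟨h1, h2⟩
    refine ⟨by rw [h2 e he, Function.update_self], fun e' he' => ?_⟩
    by_cases h3 : Quot.mk (Γ.Joined t) e' = Quot.mk _ e
    · rw [h3, (mk_eq_iff_of_not_near ht he').2 h3, Function.update_self, h1]
    · rw [Function.update_of_ne h3, h2 e' he',
        Function.update_of_ne fun h => h3 ((mk_eq_iff_of_not_near ht he').1 h)]

open Classical in
/-- The map of the Frobenius algebra commutes with the multiplication by `X` at an edge. -/
theorem frobCoeff_update (h : Γ.IsColoring σ) {s t : Γ.State} {c : Fin Γ.n}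
    (ht : t = Γ.flip s c) (e : Γ.Edge) (z : Quot (Γ.Joined t) → Bool)
    (y : Quot (Γ.Joined s) → Bool) :
    (if z (Quot.mk _ e) then 0 else frobCoeff c (Function.update z (Quot.mk _ e) true) y) =
      if y (Quot.mk _ e) then frobCoeff c z (Function.update y (Quot.mk _ e) false) else 0 := by
  -- Near `c` this is the finite check that multiplication and comultiplication of the Frobenius
  -- algebra are linear over it. Away from `c` the label of `e` is simply carried along.
  by_cases he : Near t c e
  · have a1 : ∀ b, Agree c (Function.update z (Quot.mk _ e) b) y ↔ Agree c z y := fun b =>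
      forall₂_congr fun e' he' => by
        rw [Function.update_of_ne fun h1 => he' (by rw [Near, h1]; exact he)]
    have a2 : ∀ b, Agree c z (Function.update y (Quot.mk _ e) b) ↔ Agree c z y := fun b =>
      forall₂_congr fun e' he' => by
        rw [Function.update_of_ne fun h1 => he' ((near_iff ht).1 (by
          rw [Near, h1]
          exact (near_iff ht).2 he))]
    by_cases ha : Agree c z y
    · have hs := (near_iff ht).2 he
      simp only [frobCoeff, a1, a2, if_pos ha]
      by_cases h1 : OneCircle t c
      · have h2 : ¬ OneCircle s c := fun h2 => (oneCircle_iff h ht).1 h2 h1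
        have he' : Quot.mk (Γ.Joined t) e = Quot.mk _ (c, false) := by
          rcases he with he | he
          · exact he
          · exact he.trans h1.symm
        rw [if_pos h1, he', Function.update_self, if_pos h1]
        rcases hs with hs | hs
        · rw [hs, Function.update_self, Function.update_of_ne (Ne.symm h2)]
          generalize z _ = b₁, y (Quot.mk _ (c, false)) = b₂,
            y (Quot.mk _ (Γ.incoming c true)) = b₃
          revert b₁ b₂ b₃
          decide
        · rw [hs, Function.update_self, Function.update_of_ne h2]
          generalize z _ = b₁, y (Quot.mk _ (c, false)) = b₂,
            y (Quot.mk _ (Γ.incoming c true)) = b₃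
          revert b₁ b₂ b₃
          decide
      · have h2 : OneCircle s c := (oneCircle_iff h ht).2 h1
        have hs' : Quot.mk (Γ.Joined s) e = Quot.mk _ (c, false) := by
          rcases hs with hs | hs
          · exact hs
          · exact hs.trans h2.symm
        rw [if_neg h1, if_neg h1, hs', Function.update_self]
        rcases he with he | he
        · rw [he, Function.update_self, Function.update_of_ne (Ne.symm h1)]
          generalize z (Quot.mk _ (c, false)) = b₁, z (Quot.mk _ (Γ.incoming c true)) = b₂,
            y _ = b₃
          revert b₁ b₂ b₃
          decide
        · rw [he, Function.update_self, Function.update_of_ne h1]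
          generalize z (Quot.mk _ (c, false)) = b₁, z (Quot.mk _ (Γ.incoming c true)) = b₂,
            y _ = b₃
          revert b₁ b₂ b₃
          decide
    · simp only [frobCoeff, a1, a2, if_neg ha, ite_self]
  · have hs : ¬ Near s c e := fun hs => he ((near_iff ht).1 hs)
    have n1 := fun h1 => he (Or.inl (Eq.symm h1))
    have n2 := fun h1 => he (Or.inr (Eq.symm h1))
    have n3 := fun h1 => hs (Or.inl (Eq.symm h1))
    have n4 := fun h1 => hs (Or.inr (Eq.symm h1))
    have ha := agree_update_iff ht he z y
    simp only [frobCoeff, Function.update_of_ne n1, Function.update_of_ne n2,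
      Function.update_of_ne n3, Function.update_of_ne n4]
    cases h1 : z (Quot.mk _ e) <;> cases h2 : y (Quot.mk _ e) <;>
      simp [h1, h2] at ha ⊢ <;> simp [ha]

theorem eq_false_iff_agree {s t : Γ.State} {c : Fin Γ.n} (ht : t = Γ.flip s c)
    (y : Quot (Γ.Joined s) → Bool) : (y = fun _ => false) ↔
      Agree (t := t) c (fun _ => false) y ∧ y (Quot.mk _ (c, false)) = false ∧
        y (Quot.mk _ (Γ.incoming c true)) = false := by
  constructor
  · rintro rfl
    exact ⟨fun _ _ => rfl, rfl, rfl⟩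
  · rintro ⟨h1, h2, h3⟩
    funext k
    induction k using Quot.ind with | mk e => ?_
    by_cases he : Near t c e
    · rcases (near_iff ht).2 he with h | h
      · rw [h, h2]
      · rw [h, h3]
    · exact (h1 e he).symm

open Classical in
theorem eq_update_iff_agree {s t : Γ.State} {c : Fin Γ.n} (ht : t = Γ.flip s c)
    {e e' : Γ.Edge} (hn : ∀ k, Near s c k ↔ Quot.mk (Γ.Joined s) k = Quot.mk _ e ∨
      Quot.mk (Γ.Joined s) k = Quot.mk _ e')
    (hne : Quot.mk (Γ.Joined s) e ≠ Quot.mk _ e') (y : Quot (Γ.Joined s) → Bool) :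
    (y = Function.update (fun _ => false) (Quot.mk _ e) true) ↔
      Agree (t := t) c (fun _ => false) y ∧ y (Quot.mk _ e) = true ∧
        y (Quot.mk _ e') = false := by
  constructor
  · rintro rfl
    refine ⟨fun e'' he'' => ?_, Function.update_self .., Function.update_of_ne hne.symm ..⟩
    rw [Function.update_of_ne fun h => he'' ((near_iff ht).1 ((hn _).2 (Or.inl h)))]
  · rintro ⟨h1, h2, h3⟩
    funext k
    induction k using Quot.ind with | mk k => ?_
    by_cases hk : Near t c k
    · rcases (hn _).1 ((near_iff ht).2 hk) with h | h
      · rw [h, h2, Function.update_self]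
      · rw [h, h3, Function.update_of_ne hne.symm]
    · rw [← h1 k hk, Function.update_of_ne fun h => hk ((near_iff ht).1 ((hn _).2 (Or.inl h)))]

/-- On the generator, `edgeFactor` encodes `1 · 1 = 1` for a merging and `Δ(1) = X ⊗ 1 + 1 ⊗ X` for
a splitting. -/
theorem frobCoeff_one (h : Γ.IsColoring σ) {s t : Γ.State} {c : Fin Γ.n}
    (ht : t = Γ.flip s c) (y : Quot (Γ.Joined s) → Bool) :
    (frobCoeff (t := t) c (fun _ => false) y : ℚ) = evalLabels σ s (edgeFactor σ s c) y := by
  classical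
  rw [evalLabels_apply, frobCoeff]
  by_cases h1 : OneCircle t c
  · have h2 : ¬ OneCircle s c := fun h2 => (oneCircle_iff h ht).1 h2 h1
    rw [edgeFactor, if_neg h2, map_add, toCircles_signedX, toCircles_signedX, map_add,
      Pi.add_apply, labelCoeff_X, labelCoeff_X, if_pos h1]
    have e1 := eq_update_iff_agree ht (fun k => Iff.rfl) h2 y
    have e2 := eq_update_iff_agree ht (fun k => or_comm) (Ne.symm h2) y
    by_cases ha : Agree (t := t) c (fun _ => false) y
    · simp only [ha, true_and, if_true] at e1 e2 ⊢
      simp only [e1, e2]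
      generalize y (Quot.mk _ (c, false)) = b₁, y (Quot.mk _ (Γ.incoming c true)) = b₂
      cases b₁ <;> cases b₂ <;> simp [LinkDiagram.comulCoeff]
    · simp only [ha, false_and, if_false, iff_false] at e1 e2 ⊢
      simp only [e1, e2, if_false]
      norm_num
  · have h2 : OneCircle s c := (oneCircle_iff h ht).2 h1
    rw [edgeFactor, if_pos h2, map_one, labelCoeff_one, if_neg h1]
    have e1 := eq_false_iff_agree ht y
    have h3 : y (Quot.mk _ (Γ.incoming c true)) = y (Quot.mk _ (c, false)) :=
      congrArg y (Eq.symm h2)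
    rw [h3, and_self] at e1
    simp only [e1]
    by_cases ha : Agree (t := t) c (fun _ => false) y
    · simp only [ha, true_and, if_true]
      generalize y _ = b₁
      cases b₁ <;> simp [LinkDiagram.mulCoeff]
    · simp [ha]

open Classical in
theorem evalLabels_X_mul (σ : Γ.Edge → Bool) (s : Γ.State) (e : Γ.Edge) (r : Γ.Ring)
    (l : Quot (Γ.Joined s) → Bool) :
    evalLabels σ s (MvPolynomial.X e * r) l = colorSign σ e *
      if l (Quot.mk _ e) then evalLabels σ s r (Function.update l (Quot.mk _ e) false)
      else 0 := by
  rw [evalLabels_apply, map_mul, toCircles_X, mul_assoc, ← MvPolynomial.smul_eq_C_mul, map_smul,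
    Pi.smul_apply, labelCoeff_X_mul, smul_eq_mul,
    evalLabels_apply]

open Classical in
-- Both sides are linear under multiplication by each edge variable and agree on constants, so
-- induction on the polynomial proves them equal.
theorem sum_frobCoeff (h : Γ.IsColoring σ) {s t : Γ.State} {c : Fin Γ.n}
    (ht : t = Γ.flip s c) (r : Γ.Ring) (y : Quot (Γ.Joined s) → Bool) :
    ∑ x : Quot (Γ.Joined t) → Bool, (frobCoeff c x y : ℚ) * evalLabels σ t r x =
      evalLabels σ s (edgeFactor σ s c * r) y := by
  induction r using MvPolynomial.induction_on generalizing y with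
  | C a =>
    have h1 : (MvPolynomial.C a : Γ.Ring) = a • 1 := by
      rw [MvPolynomial.smul_eq_C_mul, mul_one]
    rw [h1, mul_smul_comm, mul_one, map_smul, map_smul, Pi.smul_apply, ← frobCoeff_one h ht,
      evalLabels_apply, map_one]
    simp only [Pi.smul_apply, labelCoeff_one, smul_eq_mul, mul_ite, mul_one, mul_zero]
    rw [Finset.sum_ite_eq' _ _ fun x => (frobCoeff c x y : ℚ) * a,
      if_pos (Finset.mem_univ _), mul_comm]
  | add p q hp hq =>
    simp only [map_add, mul_add, Pi.add_apply, Finset.sum_add_distrib, hp, hq]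
  | mul_X p e hp =>
    -- Multiplication by the variable of `e` turns the label of its circle from `1` to `X`.
    -- Reindexing by this flip moves it onto the coefficient matrix.
    let ι : (Quot (Γ.Joined t) → Bool) → (Quot (Γ.Joined t) → Bool) := fun x =>
      Function.update x (Quot.mk _ e) (!x (Quot.mk _ e))
    have h0 : ∀ x, ι x = Function.update x (Quot.mk _ e) (!x (Quot.mk _ e)) := fun _ => rfl
    have h1 : Function.Involutive ι := fun x => by
      rw [h0, h0, Function.update_self, Function.update_idem, Bool.not_not, Function.update_eq_self]
    have h2 : edgeFactor σ s c * (p * MvPolynomial.X e) =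
        MvPolynomial.X e * (edgeFactor σ s c * p) := by ring
    rw [h2, evalLabels_X_mul, mul_comm p, ← h1.bijective.sum_comp]
    have h3 : ∀ x : Quot (Γ.Joined t) → Bool, (frobCoeff c (ι x) y : ℚ) *
        evalLabels σ t (MvPolynomial.X e * p) (ι x) = colorSign σ e *
        (((if y (Quot.mk _ e) then frobCoeff c x (Function.update y (Quot.mk _ e) false) else 0 :
          ℤ) : ℚ) * evalLabels σ t p x) := by
      intro x
      rw [← frobCoeff_update h ht, evalLabels_X_mul, h0,
        Function.update_self, Function.update_idem]
      cases hx : x (Quot.mk _ e)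
      · simp only [Bool.not_false, if_true, Bool.false_eq_true, if_false]
        rw [← hx, Function.update_eq_self]
        ring
      · simp
    simp only [h3, ← Finset.mul_sum]
    congr 1
    split_ifs
    · exact hp _
    · simp

open Classical in
theorem coreMap_coreChi_apply (h : Γ.IsColoring σ) {s t : Γ.State} {c : Fin Γ.n}
    (ht : t = Γ.flip s c) {f : Γ.CoreChain} (hf : Γ.coreD t f = 0)
    (y : Quot (Γ.Joined s) → Bool) : coreMap h s (Γ.coreChi c (s c) f) y =
      edgeScalar h s c * ∑ x, (frobCoeff c x y : ℚ) * coreMap h t f x := by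
  obtain ⟨r, hr⟩ := evalLabels_surjective σ t (coreMap h t f)
  rw [coreMap_coreChi h ht hf hr.symm, ← hr, sum_frobCoeff h ht, ← MvPolynomial.smul_eq_C_mul,
    map_smul, Pi.smul_apply, smul_eq_mul]

open Classical in
theorem chainMap_chi (h : Γ.IsColoring σ) {s t : Γ.State} {c : Fin Γ.n}
    (ht : t = Γ.flip s c) {f : Γ.Chain} (hf : Γ.d t f = 0) (y : Γ.Circle s → Bool) :
    chainMap h s (Γ.chi s c f) y = edgeScalar h s c * ∑ x : Γ.Circle t → Bool,
      ((if ∀ k : Fin Γ.loops, x (Sum.inr k) = y (Sum.inr k) then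
        frobCoeff c (fun k => x (Sum.inl k)) (fun k => y (Sum.inl k)) else 0 : ℤ) : ℚ) *
          chainMap h t f x := by
  rw [chainMap_apply, chi_slice, coreMap_coreChi_apply h ht ((d_eq_zero_iff t f).1 hf _),
    ← Equiv.sum_comp (Equiv.sumArrowEquivProdArrow _ _ _).symm, Fintype.sum_prod_type]
  congr 1
  refine Finset.sum_congr rfl fun x _ => ?_
  rw [Finset.sum_eq_single fun k => y (Sum.inr k)]
  · rw [if_pos (by exact fun k => rfl)]
    rfl
  · intro L _ hL
    rw [if_neg (by exact fun h1 => hL (funext h1))]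
    simp
  · intro h1
    exact absurd (Finset.mem_univ _) h1

end Shadow

/-! ### Isomorphisms of complexes with specified graded pieces. -/

section SubHomology

variable {R V W : Type*} [CommRing R] [AddCommGroup V] [Module R V] [AddCommGroup W] [Module R W]

/-- The homology of a differential at the submodule `P`, where `Q` is the submodule of the
elements whose differentials lie in `P`. -/
abbrev SubHomology (P Q : Submodule R V) (d : V →ₗ[R] V) : Type _ :=
  ↥(P ⊓ LinearMap.ker d) ⧸ (Q.map d).comap (P ⊓ LinearMap.ker d).subtype

theorem subHomology_congr {P Q : Submodule R V} {d : V →ₗ[R] V} {P' Q' : Submodule R W}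
    {d' : W →ₗ[R] W} (e : V ≃ₗ[R] W) (hP : ∀ x, x ∈ P ↔ e x ∈ P') (hQ : ∀ x, x ∈ Q ↔ e x ∈ Q')
    (hd : ∀ x, e (d x) = d' (e x)) :
    Nonempty (SubHomology P Q d ≃ₗ[R] SubHomology P' Q' d') := by
  have h1 : (P ⊓ LinearMap.ker d).map (e : V →ₗ[R] W) = P' ⊓ LinearMap.ker d' := by
    ext y
    constructor
    · rintro ⟨x, ⟨hx, hx'⟩, rfl⟩
      refine ⟨(hP x).1 hx, ?_⟩
      change d' (e x) = 0
      rw [← hd, LinearMap.mem_ker.1 hx', map_zero]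
    · rintro ⟨hy, hy'⟩
      refine ⟨e.symm y, ⟨(hP _).2 (by rwa [e.apply_symm_apply]), ?_⟩, e.apply_symm_apply y⟩
      apply e.injective
      rw [hd, e.apply_symm_apply, map_zero]
      exact hy'
  refine ⟨Submodule.Quotient.equiv _ _ (e.ofSubmodules _ _ h1) ?_⟩
  ext ⟨y, hy⟩
  constructor
  · rintro ⟨⟨x, hx⟩, ⟨z, hz, hzx⟩, hxy⟩
    have h2 : e x = y := congrArg Subtype.val hxy
    refine ⟨e z, (hQ z).1 hz, ?_⟩
    change d' (e z) = y
    change d z = x at hzx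
    rw [← hd, hzx, h2]
  · rintro ⟨z, hz, hzy⟩
    change d' z = y at hzy
    have h2 : e (d (e.symm z)) = y := by rw [hd, e.apply_symm_apply, hzy]
    have h3 : d (e.symm z) ∈ P ⊓ LinearMap.ker d := by
      rw [← h1] at hy
      obtain ⟨x, hx, hxy⟩ := hy
      have h4 : d (e.symm z) = x := e.injective (h2.trans hxy.symm)
      rwa [h4]
    exact ⟨⟨d (e.symm z), h3⟩, ⟨e.symm z, (hQ _).2 (by rwa [e.apply_symm_apply]), rfl⟩,
      Subtype.ext h2⟩

end SubHomology

/-! ### Extension of scalars from ℤ to ℚ. -/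

section Rationalization

variable {G : Type*}

/-- Integral vectors as rational vectors. -/
def ratVec (G : Type*) : (G → ℤ) →ₗ[ℤ] (G → ℚ) :=
  LinearMap.pi fun g => (algebraMap ℤ ℚ).toAddMonoidHom.toIntLinearMap ∘ₗ LinearMap.proj g

theorem ratVec_apply (f : G → ℤ) (g : G) : ratVec G f g = f g := rfl

theorem ratVec_injective : Function.Injective (ratVec G) := fun f f' h => by
  funext g
  have := congrFun h g
  rw [ratVec_apply, ratVec_apply] at this
  exact_mod_cast this

theorem exists_ratVec_eq [Finite G] (F : G → ℚ) :
    ∃ (N : ℤ) (f : G → ℤ), N ≠ 0 ∧ ratVec G f = (N : ℚ) • F := by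
  obtain ⟨b, hb⟩ := IsLocalization.exist_integer_multiples_of_finite (nonZeroDivisors ℤ) F
  choose f hf using hb
  refine ⟨b, f, nonZeroDivisors.ne_zero b.2, ?_⟩
  funext g
  have := hf g
  rw [ratVec_apply, Pi.smul_apply, smul_eq_mul]
  rw [zsmul_eq_mul] at this
  exact this

variable {p q : G → Prop} {PZ QZ : Submodule ℤ (G → ℤ)} {PQ QQ : Submodule ℚ (G → ℚ)}
  {dZ : (G → ℤ) →ₗ[ℤ] (G → ℤ)} {dQ : (G → ℚ) →ₗ[ℚ] (G → ℚ)}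

theorem ratVec_mem_iff (hPZ : ∀ f, f ∈ PZ ↔ ∀ x, f x ≠ 0 → p x)
    (hPQ : ∀ F, F ∈ PQ ↔ ∀ x, F x ≠ 0 → p x) (f : G → ℤ) : ratVec G f ∈ PQ ↔ f ∈ PZ := by
  rw [hPZ, hPQ]
  refine forall_congr' fun x => ?_
  rw [ratVec_apply, Int.cast_ne_zero]

/-- Homology commutes with the extension of scalars from the integers to the rational numbers. -/
theorem subHomology_rat [Finite G] (hPZ : ∀ f, f ∈ PZ ↔ ∀ x, f x ≠ 0 → p x)
    (hPQ : ∀ F, F ∈ PQ ↔ ∀ x, F x ≠ 0 → p x) (hQZ : ∀ f, f ∈ QZ ↔ ∀ x, f x ≠ 0 → q x)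
    (hQQ : ∀ F, F ∈ QQ ↔ ∀ x, F x ≠ 0 → q x) (hd : ∀ f, dQ (ratVec G f) = ratVec G (dZ f)) :
    Nonempty (SubHomology PQ QQ dQ ≃ₗ[ℚ] ℚ ⊗[ℤ] SubHomology PZ QZ dZ) := by
  have hP := ratVec_mem_iff hPZ hPQ
  have hQ := ratVec_mem_iff hQZ hQQ
  have hker : ∀ f, f ∈ PZ ⊓ LinearMap.ker dZ → ratVec G f ∈ PQ ⊓ LinearMap.ker dQ :=
    fun f hf => ⟨(hP f).2 hf.1, by
      rw [SetLike.mem_coe, LinearMap.mem_ker, hd, LinearMap.mem_ker.1 hf.2, map_zero]⟩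
  let a : ↥(PZ ⊓ LinearMap.ker dZ) →+ SubHomology PQ QQ dQ :=
    { toFun := fun f => Submodule.Quotient.mk ⟨ratVec G f.1, hker f.1 f.2⟩
      map_zero' := by
        rw [Submodule.Quotient.mk_eq_zero]
        exact ⟨0, QQ.zero_mem, by rw [map_zero]; exact (map_zero (ratVec G)).symm⟩
      map_add' := fun f f' => by
        rw [← Submodule.Quotient.mk_add]
        congr 1
        exact Subtype.ext (map_add (ratVec G) _ _) }
  have ha : ∀ f, a f = 0 ↔ ∃ g ∈ QQ, dQ g = ratVec G f.1 := fun f =>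
    Submodule.Quotient.mk_eq_zero _
  let φ : SubHomology PZ QZ dZ →ₗ[ℤ] SubHomology PQ QQ dQ :=
    Submodule.liftQ _ a.toIntLinearMap (by
      rintro f ⟨g, hg, hgf⟩
      exact (ha f).2 ⟨ratVec G g, (hQ g).2 hg, by rw [hd]; exact congrArg (ratVec G) hgf⟩)
  have hφ : ∀ f, φ (Submodule.Quotient.mk f) = a f := fun f => rfl
  -- Clearing denominators in a rational primitive shows that the kernel of `φ` is torsion.
  have hzero : ∀ x, φ x = 0 → ∃ N : ℤ, N ≠ 0 ∧ N • x = 0 := by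
    intro x hx
    obtain ⟨f, rfl⟩ := Submodule.Quotient.mk_surjective _ x
    obtain ⟨g, hg, hgf⟩ := (ha f).1 hx
    obtain ⟨N, g', hN, hg'⟩ := exists_ratVec_eq g
    refine ⟨N, hN, ?_⟩
    rw [← Submodule.Quotient.mk_smul, Submodule.Quotient.mk_eq_zero]
    refine ⟨g', (hQ g').1 ?_, ?_⟩
    · rw [hg']
      exact QQ.smul_mem _ hg
    · apply ratVec_injective
      rw [← hd, hg', map_smul, hgf]
      refine Eq.trans ?_ (map_smul (ratVec G) N f.1).symm
      funext y
      simp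
  -- The target is a rational vector space, and every rational cycle has an integral multiple. With
  -- `hzero`, this makes `φ` the localization at the nonzero integers.
  have hloc : IsLocalizedModule (nonZeroDivisors ℤ) φ := by
    constructor
    · intro N
      have hN : ((N : ℤ) : ℚ) ≠ 0 := Int.cast_ne_zero.2 (nonZeroDivisors.ne_zero N.2)
      rw [Module.End.isUnit_iff]
      have hsm : ∀ x : SubHomology PQ QQ dQ,
          algebraMap ℤ (Module.End ℤ (SubHomology PQ QQ dQ)) N x = ((N : ℤ) : ℚ) • x := fun x => by
        rw [Module.algebraMap_end_apply, Int.cast_smul_eq_zsmul]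
      constructor
      · intro x y hxy
        rw [hsm, hsm] at hxy
        exact smul_right_injective _ hN hxy
      · intro y
        exact ⟨((N : ℤ) : ℚ)⁻¹ • y, by rw [hsm, smul_inv_smul₀ hN]⟩
    · intro y
      obtain ⟨⟨F, hF⟩, rfl⟩ := Submodule.Quotient.mk_surjective _ y
      obtain ⟨N, f, hN, hf⟩ := exists_ratVec_eq F
      have hf' : f ∈ PZ ⊓ LinearMap.ker dZ := by
        refine ⟨(hP f).1 ?_, ?_⟩
        · rw [hf]
          exact PQ.smul_mem _ hF.1
        · apply ratVec_injective
          rw [← hd, hf, map_smul, LinearMap.mem_ker.1 hF.2, smul_zero, map_zero]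
      refine ⟨(Submodule.Quotient.mk ⟨f, hf'⟩, ⟨N, mem_nonZeroDivisors_of_ne_zero hN⟩), ?_⟩
      rw [hφ]
      change N • (Submodule.Quotient.mk ⟨F, hF⟩ : SubHomology PQ QQ dQ) =
        Submodule.Quotient.mk ⟨ratVec G f, hker f hf'⟩
      rw [← Int.cast_smul_eq_zsmul ℚ, ← Submodule.Quotient.mk_smul]
      congr 1
      exact Subtype.ext hf.symm
    · intro x y hxy
      obtain ⟨N, hN, h⟩ := hzero (x - y) (by rw [map_sub, hxy, sub_self])
      refine ⟨⟨N, mem_nonZeroDivisors_of_ne_zero hN⟩, ?_⟩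
      rw [smul_sub, sub_eq_zero] at h
      exact h
  exact ⟨((isLocalizedModule_iff_isBaseChange (nonZeroDivisors ℤ) ℚ φ).1 hloc).equiv.symm⟩

end Rationalization

/-! ### Identification with Khovanov's complex of the mirror image. -/

namespace LinkDiagram

variable {D : LinkDiagram} {σ : D.Edge → Bool}

variable (D) in
/-- The resolution of `D` which is the smoothing of the mirror image given by a vertex of the
cube. -/
def mirrorState (t : Fin D.n → Bool) : D.State := D.mirror.khSmoothing t

theorem mirrorState_apply (t : Fin D.n → Bool) (c : Fin D.n) :
    D.mirrorState t c = xor (t c) (!D.positive c) := rfl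

theorem mirrorState_involutive : Function.Involutive D.mirrorState := fun t => by
  funext c
  rw [mirrorState_apply, mirrorState_apply, Bool.xor_assoc, Bool.xor_self, Bool.xor_false]

theorem mirrorState_eq_positive_iff (t : Fin D.n → Bool) (c : Fin D.n) :
    D.mirrorState t c = D.positive c ↔ t c = true := by
  rw [mirrorState_apply]
  cases t c <;> cases D.positive c <;> simp

theorem mirrorState_update (t : Fin D.n → Bool) (c : Fin D.n) (h : t c = true) :
    D.mirrorState (Function.update t c false) = D.flip (D.mirrorState t) c := by
  funext c'
  by_cases hc : c' = c
  · subst hc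
    rw [Shadow.flip_apply, mirrorState_apply, mirrorState_apply, Function.update_self, h]
    cases D.positive c' <;> rfl
  · rw [Shadow.flip_apply_ne _ hc, mirrorState_apply, mirrorState_apply, Function.update_of_ne hc]

variable (D) in
/-- The basis of Khovanov's complex of the mirror image. -/
abbrev CubeGen : Type := Σ t : Fin D.n → Bool, (D.Circle (D.mirrorState t) → Bool)

noncomputable instance : Fintype D.CubeGen := inferInstanceAs (Fintype D.mirror.KhGen)

/-- The cohomological degree in Khovanov's complex of the mirror image. -/
def genCohDeg (x : D.CubeGen) : ℤ := D.mirror.khCohDeg x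

/-- The internal degree in Khovanov's complex of the mirror image. -/
noncomputable def genQDeg (x : D.CubeGen) : ℤ := D.mirror.khDeg x

theorem genCohDeg_eq (x : D.CubeGen) : genCohDeg x =
    ∑ c : Fin D.n, (if x.1 c = true then (1 : ℤ) else 0) -
      ∑ c : Fin D.n, if (!D.positive c) = true then 1 else 0 := rfl

theorem genQDeg_eq (x : D.CubeGen) : genQDeg x =
    ∑ k, (if x.2 k = true then (-1 : ℤ) else 1) + ∑ c : Fin D.n, (if x.1 c = true then (1 : ℤ) else 0) +
      ∑ c : Fin D.n, (if (!D.positive c) = true then 0 else 1) -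
      2 * ∑ c : Fin D.n, if (!D.positive c) = true then 1 else 0 := rfl

theorem cohDeg_mirrorState (x : D.CubeGen) : D.cohDeg (D.mirrorState x.1) = genCohDeg x := by
  rw [genCohDeg_eq, cohDeg, ← Finset.sum_sub_distrib]
  refine Finset.sum_congr rfl fun c _ => ?_
  rw [mirrorState_apply]
  cases x.1 c <;> cases D.positive c <;> rfl

/-- The labels `1` and `X` have opposite degrees in the two theories, and a check at each crossing
shows that the shifts are opposite too. This is the origin of `-j`. -/
theorem shift_mirrorState (x : D.CubeGen) :
    ∑ k, circleDeg (x.2 k) + D.shift (D.mirrorState x.1) = -genQDeg x := by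
  have h1 : ∑ k, (if x.2 k = true then (-1 : ℤ) else 1) = -∑ k, circleDeg (x.2 k) := by
    rw [← Finset.sum_neg_distrib]
    refine Finset.sum_congr rfl fun k _ => ?_
    cases x.2 k <;> rfl
  have h2 : D.shift (D.mirrorState x.1) =
      2 * (∑ c : Fin D.n, if (!D.positive c) = true then (1 : ℤ) else 0) -
        (∑ c : Fin D.n, (if (!D.positive c) = true then (0 : ℤ) else 1)) -
        ∑ c : Fin D.n, (if x.1 c = true then (1 : ℤ) else 0) := by
    rw [shift, Finset.mul_sum, ← Finset.sum_sub_distrib, ← Finset.sum_sub_distrib]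
    refine Finset.sum_congr rfl fun c _ => ?_
    rw [mirrorState_apply]
    cases x.1 c <;> cases D.positive c <;> rfl
  rw [genQDeg_eq, h1, h2]
  ring

/-- The sign in Khovanov's complex. -/
def cubeSign {n : ℕ} (t : Fin n → Bool) (c : Fin n) : ℚ :=
  ∏ c' ∈ Finset.univ.filter (· < c), if t c' then (-1 : ℚ) else 1

theorem cubeSign_ne_zero {n : ℕ} (t : Fin n → Bool) (c : Fin n) : cubeSign t c ≠ 0 :=
  Finset.prod_ne_zero_iff.2 fun _ _ => by split_ifs <;> norm_num

theorem cubeSign_update {n : ℕ} (t : Fin n → Bool) (c : Fin n) (b : Bool) :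
    cubeSign (Function.update t c b) c = cubeSign t c :=
  Finset.prod_congr rfl fun c' hc' => by
    rw [Function.update_of_ne (Finset.mem_filter.1 hc').2.ne]

/-- The sign conventions of the two cubes differ by a factor depending on the direction `c` but not
on the vertex `t`, so it does not disturb the square relation for the scalars. -/
theorem cubeSign_mirrorState (t : Fin D.n → Bool) (c : Fin D.n) :
    cubeSign (D.mirrorState t) c = cubeSign t c * cubeSign (fun c => !D.positive c) c := by
  rw [cubeSign, cubeSign, cubeSign, ← Finset.prod_mul_distrib]
  refine Finset.prod_congr rfl fun c' _ => ?_
  rw [mirrorState_apply]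
  cases t c' <;> cases D.positive c' <;> norm_num

/-- The edge scalars, corrected by the discrepancy of the signs, commute on squares. A potential for
their inverses gives the required rescaling of the vertices. -/
theorem exists_normalization (h : D.IsColoring σ) : ∃ μ : (Fin D.n → Bool) → ℚ,
    (∀ t, μ t ≠ 0) ∧ ∀ t c, t c = true →
      μ t * (cubeSign (D.mirrorState t) c * Shadow.edgeScalar h (D.mirrorState t) c) =
        cubeSign t c * μ (Function.update t c false) := by
  have hη := fun c => cubeSign_ne_zero (fun c => !D.positive c) c
  obtain ⟨μ, hμ, hμ'⟩ := exists_potential (fun t c =>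
    (cubeSign (fun c => !D.positive c) c * Shadow.edgeScalar h (D.mirrorState t) c)⁻¹)
    (fun t c => inv_ne_zero (mul_ne_zero (hη c) (Shadow.edgeScalar_ne_zero h _ c)))
    (fun t c c' hc h1 h2 => by
      have h3 := Shadow.edgeScalar_square h (D.mirrorState t) hc
      rw [mirrorState_update t c h1, mirrorState_update t c' h2, ← mul_inv, ← mul_inv]
      congr 1
      linear_combination cubeSign (fun c => !D.positive c) c *
        cubeSign (fun c => !D.positive c) c' * h3)
  refine ⟨μ, hμ, fun t c htc => ?_⟩
  have h1 := hη c
  have h2 := Shadow.edgeScalar_ne_zero h (D.mirrorState t) c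
  rw [hμ' t c htc, cubeSign_mirrorState]
  field_simp

/-- The coefficients of Khovanov's complex of the mirror image. -/
noncomputable def edgeCoeff (c : Fin D.n) (x y : D.CubeGen) : ℤ := D.mirror.khCoeff c x y

variable (D) in
/-- The differential of Khovanov's complex of the mirror image over the integers. -/
noncomputable def mirrorD : (D.CubeGen → ℤ) →ₗ[ℤ] (D.CubeGen → ℤ) := D.mirror.khD

theorem mirrorD_apply (f : D.CubeGen → ℤ) (y : D.CubeGen) : D.mirrorD f y =
    ∑ x : D.CubeGen, ∑ c : Fin D.n, (∏ c' ∈ Finset.univ.filter (· < c),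
      if x.1 c' = true then (-1 : ℤ) else 1) * edgeCoeff c x y * f x := rfl

variable (D) in
/-- The differential of Khovanov's complex of the mirror image over the rational numbers. -/
noncomputable def mirrorDRat : (D.CubeGen → ℚ) →ₗ[ℚ] (D.CubeGen → ℚ) where
  toFun f y := ∑ x, ∑ c, cubeSign x.1 c * (edgeCoeff c x y : ℚ) * f x
  map_add' f f' := by
    funext y; simp [mul_add, Finset.sum_add_distrib]
  map_smul' r f := by
    funext y; simp [Finset.mul_sum, mul_left_comm]

theorem mirrorDRat_apply (f : D.CubeGen → ℚ) (y : D.CubeGen) :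
    D.mirrorDRat f y = ∑ x, ∑ c, cubeSign x.1 c * (edgeCoeff c x y : ℚ) * f x := rfl

theorem mirrorDRat_ratVec (f : D.CubeGen → ℤ) :
    D.mirrorDRat (ratVec _ f) = ratVec _ (D.mirrorD f) := by
  funext y
  rw [mirrorDRat_apply, ratVec_apply, mirrorD_apply]
  simp only [Int.cast_sum, Int.cast_mul, Int.cast_prod]
  refine Finset.sum_congr rfl fun x _ => Finset.sum_congr rfl fun c _ => ?_
  rw [ratVec_apply, cubeSign]
  congr 2
  refine Finset.prod_congr rfl fun c' _ => ?_
  split_ifs <;> norm_num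

variable (D) in
/-- The part of Khovanov's complex of the mirror image over the integers of given degrees. -/
def mirrorPart (i j : ℤ) : Submodule ℤ (D.CubeGen → ℤ) := D.mirror.khPart i j

variable (D) in
/-- The part of Khovanov's complex of the mirror image over the rational numbers of given
degrees. -/
def mirrorPartRat (i j : ℤ) : Submodule ℚ (D.CubeGen → ℚ) where
  carrier := {f | ∀ x, f x ≠ 0 → genCohDeg x = i ∧ genQDeg x = j}
  zero_mem' := by simp
  add_mem' {f f'} hf hf' x h := by
    by_contra hc
    have h1 : f x = 0 := by_contra fun h1 => hc (hf x h1)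
    have h2 : f' x = 0 := by_contra fun h2 => hc (hf' x h2)
    simp [h1, h2] at h
  smul_mem' r f hf x h := by
    refine hf x fun h1 => h ?_
    simp [h1]

/-- The cube of the cohomology groups `H(Γ)` in terms of Khovanov's generators. -/
noncomputable def cubeEquiv (h : D.IsColoring σ) (μ : (Fin D.n → Bool) → ℚ) (hμ : ∀ t, μ t ≠ 0) :
    D.Cube ≃ₗ[ℚ] (D.CubeGen → ℚ) :=
  (LinearEquiv.piCongrLeft ℚ D.H (mirrorState_involutive (D := D)).toPerm).symm ≪≫ₗ
    (LinearEquiv.piCongrRight fun t => (Shadow.hEquiv h (D.mirrorState t)) ≪≫ₗ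
      LinearEquiv.smulOfNeZero ℚ _ (μ t) (hμ t)) ≪≫ₗ
    (LinearEquiv.piCurry ℚ fun (_ : Fin D.n → Bool) _ => ℚ).symm

theorem cubeEquiv_apply (h : D.IsColoring σ) (μ : (Fin D.n → Bool) → ℚ) (hμ : ∀ t, μ t ≠ 0)
    (f : D.Cube) (x : D.CubeGen) : cubeEquiv h μ hμ f x =
      μ x.1 * Shadow.hEquiv h (D.mirrorState x.1) (f (D.mirrorState x.1)) x.2 := rfl

theorem mem_cubeDeg_iff (h : D.IsColoring σ) (μ : (Fin D.n → Bool) → ℚ) (hμ : ∀ t, μ t ≠ 0)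
    (i j : ℤ) (f : D.Cube) :
    f ∈ D.cubeDeg i j ↔ cubeEquiv h μ hμ f ∈ D.mirrorPartRat i (-j) := by
  constructor
  · intro hf x hx
    rw [cubeEquiv_apply] at hx
    have hx' := right_ne_zero_of_mul hx
    obtain ⟨h1, h2⟩ := hf (D.mirrorState x.1)
    rw [Shadow.mem_HDeg_iff h] at h1
    constructor
    · rw [← cohDeg_mirrorState]
      by_contra hc
      rw [h2 hc, map_zero] at hx'
      exact hx' rfl
    · have h3 := shift_mirrorState x
      by_contra hc
      refine hx' (h1 x.2 fun h4 => hc ?_)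
      linarith
  · intro hf s
    obtain ⟨t, rfl⟩ := (mirrorState_involutive (D := D)).surjective s
    constructor
    · rw [Shadow.mem_HDeg_iff h]
      intro l hl
      by_contra hc
      have h1 := hf ⟨t, l⟩ (mul_ne_zero (hμ t) hc)
      have h3 := shift_mirrorState (D := D) ⟨t, l⟩
      refine hl ?_
      have h4 := h1.2
      change ∑ k, circleDeg (l k) + D.shift (D.mirrorState t) = _ at h3
      linarith
    · intro hi
      apply (Shadow.hEquiv h _).injective
      rw [map_zero]
      funext l
      by_contra hc
      have h1 := hf ⟨t, l⟩ (mul_ne_zero (hμ t) hc)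
      rw [← cohDeg_mirrorState] at h1
      exact hi h1.1

open Classical in
/-- The matrix of the map of Khovanov's Frobenius algebra at `c`. -/
noncomputable def circleCoeff {s t : D.State} (c : Fin D.n) (x : D.Circle t → Bool)
    (y : D.Circle s → Bool) : ℤ :=
  if ∀ k : Fin D.loops, x (Sum.inr k) = y (Sum.inr k) then
    Shadow.frobCoeff c (fun k => x (Sum.inl k)) (fun k => y (Sum.inl k)) else 0

theorem edgeCoeff_eq (c : Fin D.n) (t : Fin D.n → Bool) (htc : t c = true)
    (x : D.Circle (D.mirrorState (Function.update t c false)) → Bool)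
    (y : D.Circle (D.mirrorState t) → Bool) :
    edgeCoeff c ⟨Function.update t c false, x⟩ ⟨t, y⟩ = circleCoeff c x y := by
  classical
  have h1 : ∀ {s : D.State} {e e' : D.Edge}, D.circleOf s e = D.circleOf s e' ↔
      Quot.mk (D.Joined s) e = Quot.mk _ e' := Sum.inl_injective.eq_iff
  have h2 : (Function.update t c false c = false ∧
      t = Function.update (Function.update t c false) c true) := by
    rw [Function.update_self, Function.update_idem, ← htc, Function.update_eq_self]
    exact ⟨rfl, rfl⟩
  have h3 : (∀ e : D.Edge,
      ¬ D.mirror.SameCircle ⟨Function.update t c false, x⟩ e (c, false) →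
      ¬ D.mirror.SameCircle ⟨Function.update t c false, x⟩ e (D.incoming c true) →
        D.mirror.label ⟨Function.update t c false, x⟩ e = D.mirror.label ⟨t, y⟩ e) ↔
      Shadow.Agree (s := D.mirrorState t) (t := D.mirrorState (Function.update t c false)) c
        (fun k => x (Sum.inl k)) (fun k => y (Sum.inl k)) := by
    refine forall_congr' fun e => ?_
    have e1 : D.mirror.SameCircle ⟨Function.update t c false, x⟩ e (c, false) ↔ _ :=
      h1 (s := D.mirrorState (Function.update t c false))
    have e2 : D.mirror.SameCircle ⟨Function.update t c false, x⟩ e (D.incoming c true) ↔ _ :=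
      h1 (s := D.mirrorState (Function.update t c false))
    rw [e1, e2, Shadow.Near, not_or, and_imp]
    rfl
  have h4 : D.mirror.SameCircle ⟨Function.update t c false, x⟩ (c, false) (D.incoming c true) ↔
      Shadow.OneCircle (D.mirrorState (Function.update t c false)) c :=
    h1 (s := D.mirrorState (Function.update t c false))
  unfold edgeCoeff khCoeff circleCoeff Shadow.frobCoeff
  by_cases hL : ∀ k : Fin D.loops, x (Sum.inr k) = y (Sum.inr k)
  · by_cases hA : Shadow.Agree (s := D.mirrorState t)
        (t := D.mirrorState (Function.update t c false)) c
        (fun k => x (Sum.inl k)) (fun k => y (Sum.inl k))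
    · rw [if_pos ⟨h2.1, h2.2, hL, h3.2 hA⟩, if_pos hL, if_pos hA]
      by_cases hO : Shadow.OneCircle (D.mirrorState (Function.update t c false)) c
      · rw [if_pos hO]
        exact if_pos (h4.2 hO)
      · rw [if_neg hO]
        exact if_neg fun hO' => hO (h4.1 hO')
    · rw [if_neg fun hc => hA (h3.1 hc.2.2.2), if_pos hL, if_neg hA]
  · rw [if_neg fun hc => hL hc.2.2.1, if_neg hL]

theorem edgeCoeff_eq_zero (c : Fin D.n) (x y : D.CubeGen)
    (hxy : ¬ (y.1 c = true ∧ x.1 = Function.update y.1 c false)) : edgeCoeff c x y = 0 := by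
  classical
  refine if_neg fun hc => hxy ?_
  obtain ⟨h1, h2, -⟩ := hc
  have h3 : y.1 = Function.update x.1 c true := h2
  have h4 : x.1 c = false := h1
  refine ⟨by rw [h3, Function.update_self], ?_⟩
  rw [h3, Function.update_idem, ← h4, Function.update_eq_self]

open Classical in
-- For fixed target and direction `c`, at most one vertex of the cube is a source, namely `t` with
-- the coordinate `c` switched off.
theorem sum_edgeCoeff (c : Fin D.n) (t : Fin D.n → Bool) (y : D.Circle (D.mirrorState t) → Bool)
    (F : D.CubeGen → ℚ) :
    ∑ x : D.CubeGen, cubeSign x.1 c * (edgeCoeff c x ⟨t, y⟩ : ℚ) * F x =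
      if t c = true then cubeSign t c * ∑ x, (circleCoeff c x y : ℚ) *
        F ⟨Function.update t c false, x⟩ else 0 := by
  split_ifs with htc
  · have h1 : (Finset.univ : Finset D.CubeGen) = Finset.univ.sigma fun _ => Finset.univ :=
      Finset.ext fun x => by simp
    rw [h1, Finset.sum_sigma, Finset.sum_eq_single (Function.update t c false)]
    · rw [Finset.mul_sum]
      refine Finset.sum_congr rfl fun x _ => ?_
      rw [cubeSign_update, mul_assoc, edgeCoeff_eq c t htc]
    · intro t' _ ht'
      refine Finset.sum_eq_zero fun x _ => ?_
      rw [edgeCoeff_eq_zero _ _ _ fun h => ht' h.2]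
      simp
    · intro h
      exact absurd (Finset.mem_univ _) h
  · refine Finset.sum_eq_zero fun x _ => ?_
    rw [edgeCoeff_eq_zero _ _ _ fun h => htc h.1]
    simp

open Classical in
theorem hEquiv_chiH (h : D.IsColoring σ) {s t : D.State} {c : Fin D.n} (ht : t = D.flip s c)
    (f : D.Cube) (y : D.Circle s → Bool) :
    Shadow.hEquiv h s (D.chiH s c (f (D.flip s c))) y = Shadow.edgeScalar h s c *
      ∑ x, (circleCoeff c x y : ℚ) * Shadow.hEquiv h t (f t) x := by
  subst ht
  obtain ⟨f₀, hf₀, h1⟩ := Shadow.exists_cls_eq _ (f (D.flip s c))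
  rw [← h1]
  exact Shadow.chainMap_chi h rfl hf₀ y

theorem cubeEquiv_delta (h : D.IsColoring σ) (μ : (Fin D.n → Bool) → ℚ) (hμ : ∀ t, μ t ≠ 0)
    (hμ' : ∀ t c, t c = true →
      μ t * (cubeSign (D.mirrorState t) c * Shadow.edgeScalar h (D.mirrorState t) c) =
        cubeSign t c * μ (Function.update t c false)) (f : D.Cube) :
    cubeEquiv h μ hμ (D.delta f) = D.mirrorDRat (cubeEquiv h μ hμ f) := by
  classical
  funext ⟨t, y⟩
  have h0 : D.delta f (D.mirrorState t) = ∑ c, (if D.mirrorState t c = D.positive c then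
      cubeSign (D.mirrorState t) c • D.chiH (D.mirrorState t) c (f (D.flip (D.mirrorState t) c))
      else 0) := by
    rw [delta, LinearMap.pi_apply, LinearMap.sum_apply]
    refine Finset.sum_congr rfl fun c _ => ?_
    split_ifs <;> rfl
  rw [mirrorDRat_apply, Finset.sum_comm, cubeEquiv_apply]
  change μ t * Shadow.hEquiv h (D.mirrorState t) (D.delta f (D.mirrorState t)) y = _
  rw [h0, map_sum, Finset.sum_apply, Finset.mul_sum]
  refine Finset.sum_congr rfl fun c _ => ?_
  rw [sum_edgeCoeff]
  by_cases htc : t c = true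
  · rw [if_pos htc, if_pos ((mirrorState_eq_positive_iff t c).2 htc), map_smul, Pi.smul_apply,
      smul_eq_mul, hEquiv_chiH h (mirrorState_update t c htc), ← mul_assoc (cubeSign _ _),
      ← mul_assoc, hμ' t c htc, mul_assoc, Finset.mul_sum]
    congr 1
    refine Finset.sum_congr rfl fun x _ => ?_
    rw [cubeEquiv_apply]
    ring
  · rw [if_neg htc, if_neg fun hc => htc ((mirrorState_eq_positive_iff t c).1 hc), map_zero]
    exact mul_zero _

theorem nonempty_H₂_equiv (D : LinkDiagram) (i j : ℤ) :
    Nonempty (D.H₂ i j ≃ₗ[ℚ] ℚ ⊗[ℤ] D.mirror.Kh i (-j)) := by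
  obtain ⟨σ, hσ⟩ := D.exists_coloring
  have h : D.IsColoring σ := hσ
  obtain ⟨μ, hμ, hμ'⟩ := exists_normalization h
  -- The rescaled basis of labels carries the cube of the groups `H(Γ)` to the rational complex of
  -- the mirror image; the second isomorphism returns to integral coefficients.
  obtain ⟨e⟩ := subHomology_congr (cubeEquiv h μ hμ) (mem_cubeDeg_iff h μ hμ i j)
    (mem_cubeDeg_iff h μ hμ (i - 1) j) (cubeEquiv_delta h μ hμ hμ')
  obtain ⟨e'⟩ := subHomology_rat (PZ := D.mirrorPart i (-j)) (QZ := D.mirrorPart (i - 1) (-j))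
    (PQ := D.mirrorPartRat i (-j)) (QQ := D.mirrorPartRat (i - 1) (-j))
    (fun f => Iff.rfl) (fun f => Iff.rfl) (fun f => Iff.rfl) (fun f => Iff.rfl)
    (mirrorDRat_ratVec (D := D))
  exact ⟨e.trans e'⟩

end LinkDiagram

/-! ### Label functions and tensor powers of `A₂`. -/

/-- The functions which vanish outside of `S` correspond to the span of the basis vectors in
`S`. -/
theorem equivFun_symm_mem_span_iff {ι V : Type*} [Fintype ι] [AddCommGroup V] [Module ℚ V]
    (b : Module.Basis ι ℚ V) (S : Set ι) (F : ι → ℚ) :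
    b.equivFun.symm F ∈ Submodule.span ℚ (b '' S) ↔ ∀ i, i ∉ S → F i = 0 := by
  rw [b.mem_span_image]
  constructor
  · intro h i hi
    by_contra hc
    refine hi (h ?_)
    rw [Finset.mem_coe, Finsupp.mem_support_iff, ← b.equivFun_apply, b.equivFun.apply_symm_apply]
    exact hc
  · intro h i hi
    by_contra hc
    rw [Finset.mem_coe, Finsupp.mem_support_iff, ← b.equivFun_apply, b.equivFun.apply_symm_apply]
      at hi
    exact hi (h i hc)

/-- The basis `1, X` of `A₂`. -/
noncomputable def boolBasis : Module.Basis Bool ℚ A₂ :=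
  Module.Basis.ofEquivFun
    { toFun := fun z b => if b then z.snd else z.fst
      invFun := fun F => TrivSqZeroExt.inl (F false) + TrivSqZeroExt.inr (F true)
      map_add' := fun z z' => by funext b; cases b <;> simp
      map_smul' := fun r z => by funext b; cases b <;> simp
      left_inv := TrivSqZeroExt.inl_fst_add_inr_snd_eq
      right_inv := fun F => by funext b; cases b <;> simp }

theorem boolBasis_apply (b : Bool) : boolBasis b = A₂basis b := by
  rw [boolBasis, Module.Basis.coe_ofEquivFun]
  cases b
  · change (TrivSqZeroExt.inl 1 + TrivSqZeroExt.inr 0 : A₂) = 1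
    rw [TrivSqZeroExt.inr_zero, add_zero, TrivSqZeroExt.inl_one]
  · change (TrivSqZeroExt.inl 0 + TrivSqZeroExt.inr 1 : A₂) = DualNumber.eps
    rw [show TrivSqZeroExt.inl (0 : ℚ) = (0 : A₂) from TrivSqZeroExt.inl_zero ℚ, zero_add]
    rfl

/-- The basis of a tensor power of `A₂` given by labels. -/
noncomputable def powBasis (k : ℕ) : Module.Basis (Fin k → Bool) ℚ (⨂[ℚ] _ : Fin k, A₂) :=
  Basis.piTensorProduct fun _ => boolBasis

theorem powBasis_apply (k : ℕ) (l : Fin k → Bool) :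
    powBasis k l = PiTensorProduct.tprod ℚ fun i => A₂basis (l i) := by
  rw [powBasis, Basis.piTensorProduct_apply]
  simp only [boolBasis_apply]

/-- Functions of labels of degree `j` form the part of degree `j` of a tensor power of `A₂`. -/
theorem nonempty_labelPart_equiv (K : Type*) [Fintype K] (j : ℤ) :
    Nonempty (Shadow.labelPart K j ≃ₗ[ℚ] A₂pow (Nat.card K) j) := by
  classical
  let ε : Fin (Nat.card K) ≃ K := (Finite.equivFin K).symm
  let e : ((K → Bool) → ℚ) ≃ₗ[ℚ] (⨂[ℚ] _ : Fin (Nat.card K), A₂) :=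
    LinearEquiv.funCongrLeft ℚ ℚ (ε.arrowCongr (Equiv.refl Bool)) ≪≫ₗ (powBasis _).equivFun.symm
  have hA : A₂pow (Nat.card K) j = Submodule.span ℚ (powBasis (Nat.card K) ''
      {l | ∑ i, circleDeg (l i) = j}) := by
    rw [A₂pow]
    congr 1
    ext z
    constructor
    · rintro ⟨l, hl, rfl⟩
      exact ⟨l, hl, powBasis_apply _ l⟩
    · rintro ⟨l, hl, rfl⟩
      exact ⟨l, hl, powBasis_apply _ l⟩
  refine ⟨e.ofSubmodules _ _ ?_⟩
  ext z
  obtain ⟨F, rfl⟩ := e.surjective z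
  rw [Submodule.mem_map_equiv, e.symm_apply_apply, hA]
  change _ ↔ (powBasis _).equivFun.symm _ ∈ _
  rw [equivFun_symm_mem_span_iff]
  have hsum : ∀ l : Fin (Nat.card K) → Bool,
      ∑ k, circleDeg (ε.arrowCongr (Equiv.refl Bool) l k) = ∑ i, circleDeg (l i) := fun l => by
    rw [← ε.sum_comp]
    simp
  constructor
  · intro hF l hl
    refine hF _ ?_
    rw [hsum]
    exact hl
  · intro hF l hl
    obtain ⟨l', rfl⟩ := (ε.arrowCongr (Equiv.refl Bool)).surjective l
    rw [hsum] at hl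
    exact hF l' hl

theorem nonempty_HDeg_equiv (Γ : Shadow) (s : Γ.State) (j : ℤ) :
    Nonempty (Γ.HDeg s j ≃ₗ[ℚ] A₂pow (Nat.card (Γ.Circle s)) j) := by
  obtain ⟨σ, hσ⟩ := Γ.exists_coloring
  have h : Γ.IsColoring σ := hσ
  obtain ⟨e⟩ := nonempty_labelPart_equiv (Γ.Circle s) j
  refine ⟨((Shadow.hEquiv h s).ofSubmodules _ _ ?_).trans e⟩
  ext F
  rw [Submodule.mem_map_equiv, Shadow.mem_HDeg_iff h, LinearEquiv.apply_symm_apply]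

end KR

open scoped TensorProduct in
theorem mainTheorem9 :
    (∀ (Γ : KR.Shadow) (s : Γ.State) (j : ℤ),
      Nonempty (Γ.HDeg s j ≃ₗ[ℚ] KR.A₂pow (Nat.card (Γ.Circle s)) j)) ∧
    (∀ (D : KR.LinkDiagram) (i j : ℤ),
      Nonempty (D.H₂ i j ≃ₗ[ℚ] ℚ ⊗[ℤ] D.mirror.Kh i (-j))) :=
  ⟨KR.nonempty_HDeg_equiv, KR.LinkDiagram.nonempty_H₂_equiv⟩
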